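/- Let $m\ge 3$ and $i\ge 1$. **Series.** Let $(r_j(g))_{j\ge1}$, $(q_j(g))_{j\ge 1}$ be the unique formal power series in $g$ such that, with the convention $q_j=0$ for $j\le 0$, $$r_j(g)=j+\sum_{a=0}^{m-2}q_{j-a}(g),\qquad q_j(g)=g\prod_{a=0}^{m-2}r_{j+a}(g)\qquad (j\ge 1).$$ **Trees.** An *$m$-bipartite tree* is a plane tree rooted at a leaf (a vertex of degree $1$), whose vertices other than the leaves, called nodes, all have degree $m$ and are coloured white or black, no two adjacent nodes having the same colour; leaves are opening or closing, in equal numbers, the root leaf being opening; the root node (if the tree is not a single edge) is white; opening (resp. closing) leaves are adjacent to white (resp. black) nodes, except in the single-edge tree; and every white node has exactly one black node as a child, its other $m-2$ children being opening leaves. Walk clockwise around the tree from the root leaf (excluded); starting at height $i$, go up by one at each opening leaf and down by one at each closing leaf. The $i$-height of a closing leaf is the height from which its down-step starts. The tree is *$i$-balanced* if the resulting path stays nonnegative, and it is *$i$-enriched* if it is $i$-balanced and each closing leaf, of $i$-height $h$, carries an integer in $\{0,\dots,h-1\}$. **Maps.** A *rooted $m$-regular bipartite map* is a connected graph cellularly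 embedded in a closed oriented surface (of arbitrary genus), considered up to orientation-preserving homeomorphism, with all vertices of degree $m$ and properly coloured black and white, and with a distinguished corner at a white vertex (the root vertex). It is *marked with multiplicities* if some of its edges are marked, each marked edge being given an orientation and a positive integer multiplicity. A *1-orientation* is an orientation of the edges such that white vertices have outdegree $m-1$ and black vertices have outdegree $1$. The marked map is *admissible* if it has a 1-orientation that agrees with the given orientation of the marked edges, in which every vertex has an oriented path of unmarked edges to the root vertex, and in which the unique ingoing edge at the root vertex is the one preceding the root corner in clockwise order. Let $\mathcal Q_i$ be the family of admissible marked $m$-regular bipartite maps with multiplicities whose multiplicities add up to less than $i$. **Proposition.** There is a bijection between the $i$-enriched $m$-bipartite trees having a root node whose unique node-child is its rightmost child, and $\mathcal Q_i$, such that the number of black nodes of the tree equals the number of black vertices of the map. For every $n$, both families have finitely many members with $n$ black nodes (resp. black vertices), and the counting series of both families, with $g$ conjugate to the number of black nodes (resp. black vertices), is $q_i(g)$. -/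

import Mathlib

/-! ### The series `r_i(g)` and `q_i(g)` -/

namespace QSystem

open PowerSeries

/-- `i + ∑_{a=0}^{m-2} q_{i-a}`.  The subtraction is truncated; as every family `q` used below has
`q 0 = 0`, this is the convention `q_j = 0` for `j ≤ 0`. -/
noncomputable def rOf (m : ℕ) (q : ℕ → PowerSeries ℕ) (i : ℕ) : PowerSeries ℕ :=
  (i : PowerSeries ℕ) + ∑ a ∈ Finset.range (m - 1), q (i - a)

/-- `(r, q)` solves `r_i = i + ∑_{a=0}^{m-2} q_{i-a}` and `q_i = g ∏_{a=0}^{m-2} r_{i+a}` for `i ≥ 1`,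
with `q_j = 0` for `j ≤ 0`. -/
def IsSolution (m : ℕ) (r q : ℕ → PowerSeries ℕ) : Prop :=
  q 0 = 0 ∧
  (∀ i, 1 ≤ i → r i = (i : PowerSeries ℕ) + ∑ a ∈ Finset.range (m - 1), q (i - a)) ∧
  (∀ i, 1 ≤ i → q i = X * ∏ a ∈ Finset.range (m - 1), r (i + a))

/-- One round of substitution in the system. -/
noncomputable def step (m : ℕ) (q : ℕ → PowerSeries ℕ) (i : ℕ) : PowerSeries ℕ :=
  if i = 0 then 0 else X * ∏ a ∈ Finset.range (m - 1), rOf m q (i + a)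

/-- The series `q_i(g)`: its coefficient of `g^n` is read off after `n + 1` substitutions in the
system.  The lemmas `isSolution` and `isSolution_unique` show that this is the solution of the
system. -/
noncomputable def qSeries (m i : ℕ) : PowerSeries ℕ :=
  PowerSeries.mk fun n => coeff n ((step m)^[n + 1] (fun _ => 0) i)

/-- The series `r_i(g)`. -/
noncomputable def rSeries (m i : ℕ) : PowerSeries ℕ := rOf m (qSeries m) i

/-- Equality of the coefficients of order `< n`. -/
def Agree (n : ℕ) (f g : PowerSeries ℕ) : Prop := ∀ k < n, coeff k f = coeff k g

theorem Agree.add {n : ℕ} {f g f' g' : PowerSeries ℕ} (h : Agree n f g) (h' : Agree n f' g') :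
    Agree n (f + f') (g + g') := fun k hk => by
  simp [h k hk, h' k hk]

theorem Agree.mul {n : ℕ} {f g f' g' : PowerSeries ℕ} (h : Agree n f g) (h' : Agree n f' g') :
    Agree n (f * f') (g * g') := fun k hk => by
  rw [coeff_mul, coeff_mul]
  refine Finset.sum_congr rfl fun p hp => ?_
  have := Finset.HasAntidiagonal.mem_antidiagonal.1 hp
  rw [h p.1 (by omega), h' p.2 (by omega)]

theorem Agree.sum {n : ℕ} {s : Finset ℕ} {f g : ℕ → PowerSeries ℕ}
    (h : ∀ a, Agree n (f a) (g a)) : Agree n (∑ a ∈ s, f a) (∑ a ∈ s, g a) := fun k hk => by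
  rw [map_sum, map_sum]
  exact Finset.sum_congr rfl fun a _ => h a k hk

theorem Agree.prod {n : ℕ} {s : Finset ℕ} {f g : ℕ → PowerSeries ℕ}
    (h : ∀ a, Agree n (f a) (g a)) : Agree n (∏ a ∈ s, f a) (∏ a ∈ s, g a) := by
  classical
  induction s using Finset.induction_on with
  | empty => intro k _; simp
  | insert a s ha ih =>
    rw [Finset.prod_insert ha, Finset.prod_insert ha]
    exact (h a).mul ih

theorem step_agree {m n : ℕ} {q q' : ℕ → PowerSeries ℕ} (h : ∀ i, Agree n (q i) (q' i)) (i : ℕ) :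
    Agree (n + 1) (step m q i) (step m q' i) := by
  unfold step
  split_ifs with hi
  · intro k _; rfl
  · have key : Agree n (∏ a ∈ Finset.range (m - 1), rOf m q (i + a))
        (∏ a ∈ Finset.range (m - 1), rOf m q' (i + a)) :=
      Agree.prod fun a => Agree.add (fun _ _ => rfl) (Agree.sum fun b => h _)
    intro k hk
    cases k with
    | zero => simp
    | succ k =>
      rw [coeff_succ_X_mul, coeff_succ_X_mul]
      exact key k (by omega)

theorem iterate_agree (m : ℕ) (q q' : ℕ → PowerSeries ℕ) (n : ℕ) (i : ℕ) :
    Agree n ((step m)^[n] q i) ((step m)^[n] q' i) := by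
  induction n generalizing i with
  | zero => intro k hk; omega
  | succ n ih =>
    rw [Function.iterate_succ_apply', Function.iterate_succ_apply']
    exact step_agree ih i

theorem qSeries_agree (m n i : ℕ) :
    Agree n (qSeries m i) ((step m)^[n] (fun _ => 0) i) := by
  intro k hk
  obtain ⟨d, rfl⟩ : ∃ d, n = (k + 1) + d := ⟨n - (k + 1), by omega⟩
  rw [Function.iterate_add_apply]
  unfold qSeries
  rw [coeff_mk]
  exact iterate_agree m _ _ (k + 1) i k (by omega)

theorem step_qSeries (m : ℕ) : step m (qSeries m) = qSeries m := by
  funext i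
  ext k
  have h1 := step_agree (m := m) (fun i => qSeries_agree m k i) i k (by omega)
  have h2 := qSeries_agree m (k + 1) i k (by omega)
  rw [Function.iterate_succ_apply'] at h2
  rw [h1, h2]

theorem isSolution (m : ℕ) : IsSolution m (rSeries m) (qSeries m) := by
  refine ⟨?_, fun i _ => rfl, fun i hi => ?_⟩
  · rw [← step_qSeries]; simp [step]
  · conv_lhs => rw [← step_qSeries]
    rw [step, if_neg (by omega)]
    rfl

theorem isSolution_unique {m : ℕ} {r q : ℕ → PowerSeries ℕ} (h : IsSolution m r q) :
    q = qSeries m ∧ ∀ i, 1 ≤ i → r i = rSeries m i := by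
  obtain ⟨h0, hr, hq⟩ := h
  have hs : step m q = q := by
    funext i
    unfold step
    split_ifs with hi
    · rw [hi, h0]
    · rw [hq i (by omega)]
      congr 1
      exact Finset.prod_congr rfl fun a _ => (hr _ (by omega)).symm
  have hit : ∀ n, (step m)^[n] q = q := fun n => Function.iterate_fixed hs n
  have hqq : q = qSeries m := by
    funext i
    ext k
    have h1 := iterate_agree m q (fun _ => 0) (k + 1) i k (by omega)
    rw [hit] at h1
    rw [h1, qSeries_agree m (k + 1) i k (by omega)]
  refine ⟨hqq, fun i hi => ?_⟩
  rw [hr i hi, hqq]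
  rfl

end QSystem

/-! ### Blossoming trees -/

inductive LeafKind : Type
  | opening : LeafKind
  | closing : LeafKind
  deriving DecidableEq

inductive Color : Type
  | white : Color
  | black : Color
  deriving DecidableEq

/-- The colour different from the given one. -/
def Color.other : Color → Color
  | Color.white => Color.black
  | Color.black => Color.white

/-- Rooted plane trees with coloured nodes, all of degree `m`, and with leaves of two kinds.  The
root leaf (which is opening) and its edge are not recorded: a term describes what hangs at the other
end of the root edge.  So `leaf closing` is the nodeless tree, and a node has `m - 1` children,
listed from left to right, that is in the order in which a clockwise walk around the tree starting
at the root leaf meets them. -/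
inductive BlossomTree (m : ℕ) : Type
  | leaf (k : LeafKind) : BlossomTree m
  | node (c : Color) (child : Fin (m - 1) → BlossomTree m) : BlossomTree m

namespace BlossomTree

variable {m : ℕ}

/-- The tree is (what hangs at) a node of colour `c`. -/
def IsNode (c : Color) : BlossomTree m → Prop
  | leaf _ => False
  | node c' _ => c' = c

/-- The tree is a single leaf of kind `k`. -/
def IsLeaf (k : LeafKind) : BlossomTree m → Prop
  | leaf k' => k' = k
  | node _ _ => False

/-- The kinds of the leaves other than the root leaf, in the order of a clockwise walk. -/
def leafWord : BlossomTree m → List LeafKind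
  | leaf k => [k]
  | node _ child => (List.ofFn fun j => leafWord (child j)).flatten

/-- Number of black nodes. -/
def blackNodes : BlossomTree m → ℕ
  | leaf _ => 0
  | node c child => (if c = Color.black then 1 else 0) + ∑ j, blackNodes (child j)

/-- At every node: the children of a black node are white nodes and closing leaves; the children of
a white node are black nodes and opening leaves, and exactly one of them is a black node. -/
def LocalRule : BlossomTree m → Prop
  | leaf _ => True
  | node Color.white child =>
      (∀ j, (child j).IsNode Color.black ∨ (child j).IsLeaf LeafKind.opening) ∧
      (∃! j, (child j).IsNode Color.black) ∧ ∀ j, LocalRule (child j)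
  | node Color.black child =>
      (∀ j, (child j).IsNode Color.white ∨ (child j).IsLeaf LeafKind.closing) ∧
      ∀ j, LocalRule (child j)

/-- As many opening as closing leaves, the root leaf (an opening one) included. -/
def IsBlossoming (T : BlossomTree m) : Prop :=
  T.leafWord.count LeafKind.opening + 1 = T.leafWord.count LeafKind.closing

/-- `m`-bipartite trees: the nodeless tree, and the trees with a white root node. -/
def IsMBipartite (T : BlossomTree m) : Prop :=
  T.IsBlossoming ∧ (T.IsLeaf LeafKind.closing ∨ T.IsNode Color.white) ∧ T.LocalRule

/-- Height, after `j` steps, of the leaf-path shifted so as to start at height `i`: an opening leaf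
is an up-step, a closing leaf a down-step. -/
def pathHeight (T : BlossomTree m) (i j : ℕ) : ℤ :=
  i + (T.leafWord.take j).count LeafKind.opening - (T.leafWord.take j).count LeafKind.closing

/-- The leaf-path starting at height `i` stays nonnegative. -/
def IsBalanced (T : BlossomTree m) (i : ℕ) : Prop :=
  ∀ j ≤ T.leafWord.length, 0 ≤ T.pathHeight i j

/-- The closing leaves, given by their positions in the leaf word. -/
def ClosingLeaf (T : BlossomTree m) : Type :=
  {j : Fin T.leafWord.length // T.leafWord.get j = LeafKind.closing}

/-- The `i`-height of a closing leaf: the starting height of its down-step in the path that starts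
at height `i`. -/
def iHeight (T : BlossomTree m) (i : ℕ) (c : T.ClosingLeaf) : ℤ := T.pathHeight i c.1

/-- There is a root node, and its rightmost child is a node. -/
def RightmostRootChild : BlossomTree m → Prop
  | leaf _ => False
  | node _ child => ∃ j : Fin (m - 1), (j : ℕ) + 1 = m - 1 ∧ ∃ c, (child j).IsNode c

end BlossomTree

/-- `i`-enriched `m`-bipartite trees: each closing leaf of `i`-height `h` carries an index in
`{0, …, h - 1}`. -/
structure EnrichedTree (m i : ℕ) where
  tree : BlossomTree m
  isMBipartite : tree.IsMBipartite
  balanced : tree.IsBalanced i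
  index : tree.ClosingLeaf → ℕ
  index_lt : ∀ c, (index c : ℤ) < tree.iHeight i c

/-- The `i`-enriched `m`-bipartite trees whose root node has its node-child in rightmost
position. -/
def RightEnrichedTree (m i : ℕ) : Type :=
  {T : EnrichedTree m i // T.tree.RightmostRootChild}

namespace RightEnrichedTree

/-- Number of black nodes. -/
def blackNodes {m i : ℕ} (T : RightEnrichedTree m i) : ℕ := T.1.tree.blackNodes

/-- Counting series by the number of black nodes. -/
noncomputable def series (m i : ℕ) : PowerSeries ℕ :=
  PowerSeries.mk fun n => Nat.card {T : RightEnrichedTree m i // T.blackNodes = n}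

end RightEnrichedTree

/-! ### Maps -/

/-- The vertices of a map: the cycles of the rotation `σ` of its half-edges. -/
abbrev MapVertex {D : Type} (σ : Equiv.Perm D) : Type :=
  Quotient (Equiv.Perm.SameCycle.setoid σ)

/-- The vertex incident to a half-edge. -/
def vertexOf {D : Type} (σ : Equiv.Perm D) (h : D) : MapVertex σ :=
  Quotient.mk (Equiv.Perm.SameCycle.setoid σ) h

/-- Marked rooted `m`-regular bipartite maps with multiplicities.  A map (connected, on an oriented
surface of any genus) is given by its finite set `D` of half-edges, the permutation `σ` sending a
half-edge to the next one clockwise around its vertex, and the involution `opp` exchanging the two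
halves of each edge.  The root corner is given by the root half-edge, which follows it clockwise. -/
structure MarkedMap (m : ℕ) where
  D : Type
  finite : Finite D
  σ : Equiv.Perm D
  opp : Equiv.Perm D
  opp_opp : ∀ h, opp (opp h) = h
  opp_ne : ∀ h, opp h ≠ h
  connected : ∀ h h' : D, ∃ p ∈ Subgroup.closure {σ, opp}, p h = h'
  regular : ∀ v : MapVertex σ, Nat.card {h : D // vertexOf σ h = v} = m
  color : MapVertex σ → Color
  bipartite : ∀ h, color (vertexOf σ (opp h)) = (color (vertexOf σ h)).other
  root : D
  root_white : color (vertexOf σ root) = Color.white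
  /-- `mult h` is positive iff the edge of `h` is marked and oriented from `h` to `opp h`; it is
  then the multiplicity of that marked edge. -/
  mult : D → ℕ
  mult_opp : ∀ h, mult h ≠ 0 → mult (opp h) = 0

namespace MarkedMap

variable {m : ℕ}

/-- The root vertex. -/
def rootVertex (M : MarkedMap m) : MapVertex M.σ := vertexOf M.σ M.root

/-- The edge of the half-edge `h` is marked. -/
def IsMarked (M : MarkedMap m) (h : M.D) : Prop := M.mult h ≠ 0 ∨ M.mult (M.opp h) ≠ 0

/-- Sum of the multiplicities of the marked edges. -/
noncomputable def totalMult (M : MarkedMap m) : ℕ := ∑ᶠ h, M.mult h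

/-- The number of black vertices. -/
noncomputable def blackVertices (M : MarkedMap m) : ℕ :=
  Nat.card {v : MapVertex M.σ // M.color v = Color.black}

/-- An orientation of the edges, given by the set of outgoing half-edges. -/
def IsOrientation (M : MarkedMap m) (O : Set M.D) : Prop := ∀ h, M.opp h ∈ O ↔ h ∉ O

/-- The outdegree of a vertex. -/
noncomputable def outdegree (M : MarkedMap m) (O : Set M.D) (v : MapVertex M.σ) : ℕ :=
  Nat.card {h : M.D // vertexOf M.σ h = v ∧ h ∈ O}

/-- 1-orientations: white vertices have outdegree `m - 1`, black ones have outdegree `1`. -/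
def IsOneOrientation (M : MarkedMap m) (O : Set M.D) : Prop :=
  M.IsOrientation O ∧
  ∀ v, M.outdegree O v = match M.color v with
    | Color.white => m - 1
    | Color.black => 1

/-- The orientation agrees with that of the marked edges. -/
def IsCompatible (M : MarkedMap m) (O : Set M.D) : Prop := ∀ h, M.mult h ≠ 0 → h ∈ O

/-- `v` and `w` are the origin and the end of an unmarked edge. -/
def UnmarkedStep (M : MarkedMap m) (O : Set M.D) (v w : MapVertex M.σ) : Prop :=
  ∃ h ∈ O, ¬ M.IsMarked h ∧ vertexOf M.σ h = v ∧ vertexOf M.σ (M.opp h) = w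

/-- From every vertex there is an oriented path of unmarked edges to the root vertex. -/
def IsRootAccessible (M : MarkedMap m) (O : Set M.D) : Prop :=
  ∀ v, Relation.ReflTransGen (M.UnmarkedStep O) v M.rootVertex

/-- There is a compatible root-accessible 1-orientation in which the half-edge preceding the root
corner clockwise is the unique ingoing half-edge at the root vertex. -/
def IsAdmissible (M : MarkedMap m) : Prop :=
  ∃ O : Set M.D, M.IsOneOrientation O ∧ M.IsCompatible O ∧ M.IsRootAccessible O ∧
    ∀ h, vertexOf M.σ h = M.rootVertex → (h ∉ O ↔ h = M.σ.symm M.root)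

/-- Two marked maps are isomorphic: a bijection between the half-edges preserves the whole
structure. -/
def Iso (M M' : MarkedMap m) : Prop :=
  ∃ e : M.D ≃ M'.D,
    (∀ h, e (M.σ h) = M'.σ (e h)) ∧
    (∀ h, e (M.opp h) = M'.opp (e h)) ∧
    e M.root = M'.root ∧
    (∀ h, M'.color (vertexOf M'.σ (e h)) = M.color (vertexOf M.σ h)) ∧
    (∀ h, M'.mult (e h) = M.mult h)

theorem Iso.refl (M : MarkedMap m) : Iso M M :=
  ⟨Equiv.refl _, fun _ => rfl, fun _ => rfl, rfl, fun _ => rfl, fun _ => rfl⟩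

theorem Iso.symm {M M' : MarkedMap m} : Iso M M' → Iso M' M := by
  rintro ⟨e, h1, h2, h3, h4, h5⟩
  refine ⟨e.symm, fun h => ?_, fun h => ?_, ?_, fun h => ?_, fun h => ?_⟩
  · rw [Equiv.symm_apply_eq, h1, Equiv.apply_symm_apply]
  · rw [Equiv.symm_apply_eq, h2, Equiv.apply_symm_apply]
  · rw [Equiv.symm_apply_eq, h3]
  · rw [← h4, Equiv.apply_symm_apply]
  · rw [← h5, Equiv.apply_symm_apply]

theorem Iso.trans {M M' M'' : MarkedMap m} : Iso M M' → Iso M' M'' → Iso M M'' := by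
  rintro ⟨e, h1, h2, h3, h4, h5⟩ ⟨f, k1, k2, k3, k4, k5⟩
  refine ⟨e.trans f, fun h => ?_, fun h => ?_, ?_, fun h => ?_, fun h => ?_⟩
  · simp [h1, k1]
  · simp [h2, k2]
  · simp [h3, k3]
  · simp [h4, k4]
  · simp [h5, k5]

theorem Iso.sameCycle_iff {M M' : MarkedMap m} (e : M.D ≃ M'.D)
    (h1 : ∀ h, e (M.σ h) = M'.σ (e h)) (x y : M.D) :
    M'.σ.SameCycle (e x) (e y) ↔ M.σ.SameCycle x y := by
  have hc : M'.σ = e.permCongr M.σ := by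
    ext x
    simp [Equiv.permCongr_apply, h1]
  have hz : ∀ k : ℤ, (M'.σ ^ k) (e x) = e ((M.σ ^ k) x) := by
    intro k
    have : e.permCongr M.σ ^ k = e.permCongr (M.σ ^ k) :=
      (map_zpow e.permCongrHom M.σ k).symm
    rw [hc, this]
    simp [Equiv.permCongr_apply]
  constructor
  · rintro ⟨k, hk⟩
    exact ⟨k, e.injective (by rw [← hz, hk])⟩
  · rintro ⟨k, hk⟩
    exact ⟨k, by rw [hz, hk]⟩

theorem Iso.blackVertices_eq {M M' : MarkedMap m} (h : Iso M M') :
    M.blackVertices = M'.blackVertices := by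
  obtain ⟨e, h1, -, -, h4, -⟩ := h
  let E : MapVertex M.σ ≃ MapVertex M'.σ :=
    Quotient.congr e fun x y => (Iso.sameCycle_iff e h1 x y).symm
  refine Nat.card_congr (E.subtypeEquiv fun v => ?_)
  induction v using Quotient.inductionOn with
  | h x =>
    have := h4 x
    unfold vertexOf at this
    change M.color (Quotient.mk _ x) = Color.black ↔ M'.color (Quotient.mk _ (e x)) = Color.black
    rw [this]

/-- Admissible marked maps with multiplicities adding up to less than `i`, up to isomorphism. -/
def admissibleSetoid (m i : ℕ) : Setoid {M : MarkedMap m // M.IsAdmissible ∧ M.totalMult < i} where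
  r M M' := Iso M.1 M'.1
  iseqv := ⟨fun M => Iso.refl M.1, Iso.symm, Iso.trans⟩

end MarkedMap

/-- The family `𝒬_i`: isomorphism classes of admissible marked `m`-regular bipartite maps with
multiplicities adding up to less than `i`. -/
def AdmissibleMaps (m i : ℕ) : Type 1 := Quotient (MarkedMap.admissibleSetoid m i)

namespace AdmissibleMaps

/-- Number of black vertices. -/
noncomputable def blackVertices {m i : ℕ} : AdmissibleMaps m i → ℕ :=
  Quotient.lift (fun M => M.1.blackVertices) fun _ _ h => MarkedMap.Iso.blackVertices_eq h

/-- Counting series by the number of black vertices. -/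
noncomputable def series (m i : ℕ) : PowerSeries ℕ :=
  PowerSeries.mk fun n => Nat.card {M : AdmissibleMaps m i // M.blackVertices = n}

end AdmissibleMaps

/-! Both families are fibred over the same set of trees, and corresponding fibres are finite of
equal cardinality. Since every white node has exactly one black child, an `m`-bipartite tree amounts
to a `PairTree`, whose nodes are white-black pairs; the base consists of those `T` whose root pair
has its black child in rightmost position. The number of black nodes or vertices depends only on
`T`, so fibrewise equality of cardinals gives a size-preserving bijection; no canonical one is
constructed. The common cardinal is the product of the `i`-heights of the closing leaves of `T`.

For enriched trees this is immediate (`card_indexing`): an index below each height is chosen, and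
having such indices already forces the path to be balanced.

For maps, the fibre consists of the ways of matching the opening leaves and the root leaf with the
closing leaves, and of giving the new edges multiplicities of sum less than `i`, nonzero whenever a
non-root opening leaf comes after its partner. Partial sums of multiplicities turn such a matching
into an injection that sends a closing leaf either to an earlier opening leaf or to one of `i`
labels (`WeightedMatching.card_eq`). The sets of allowed values increase along the word, so each
closing leaf has (openings before it) + `i` - (closings before it) choices, which is its height
(`card_leafClosure`).

It remains to see that an admissible map is cut open into exactly one tree such that unmarked cut
edges meet the clockwise walk first at their white end. Existence: a 1-orientation matches each
white vertex with the origin of its ingoing edge, which is Hall's condition for the unmarked edges;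
root-accessibility makes it strict for sets avoiding the root. Such a region is explored by always
going to the last available black vertex and then dividing what is left among the children with the
help of maximal tight sets (`exists_regions`, `exists_explores`). Uniqueness: two trees are compared
along the clockwise walk; where they first differ, either an unmarked edge is crossed in the wrong
order or a finite set is injected into a proper subset of itself (`not_closing_of_node`,
`not_lt_of_node`). Conversely, gluing the leaves of a tree gives an admissible map with that tree
(`isAdmissible_glue`, `isTreeOf_glue`), and every explored map arises so
(`ExploresAll.exists_iso_glue`).

The series follows by decomposing pair trees at the root: trees hung at height `h` and forests below
a pair satisfy the system of `r` and `q`, whose solution is unique (`forestSeries_eq_qSeries`). -/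

/-! ### Generating functions of types with a size function -/

section GeneratingFunction

open PowerSeries

/-- Every size is taken finitely often. -/
def FiniteFibres {α : Type*} (s : α → ℕ) : Prop := ∀ n, Finite {a // s a = n}

/-- The generating function of a type with a size function. -/
noncomputable def gf {α : Type*} (s : α → ℕ) : PowerSeries ℕ :=
  PowerSeries.mk fun n => Nat.card {a // s a = n}

variable {α β : Type*} {s : α → ℕ} {t : β → ℕ}

theorem coeff_gf (s : α → ℕ) (n : ℕ) : coeff n (gf s) = Nat.card {a // s a = n} := by
  simp [gf]

theorem FiniteFibres.congr (hs : FiniteFibres s) (e : α ≃ β) (h : ∀ a, t (e a) = s a) :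
    FiniteFibres t := fun n => by
  have := hs n
  exact Finite.of_equiv _ (e.subtypeEquiv (p := fun a => s a = n) (q := fun b => t b = n)
    fun a => by simp [h])

theorem gf_congr (e : α ≃ β) (h : ∀ a, t (e a) = s a) : gf s = gf t := by
  ext n
  rw [coeff_gf, coeff_gf]
  exact Nat.card_congr (e.subtypeEquiv fun a => by simp [h])

theorem gf_isEmpty [IsEmpty α] (s : α → ℕ) : gf s = 0 := by
  ext n
  simp [coeff_gf]

theorem gf_const_zero (α : Type*) [Finite α] : gf (fun _ : α => 0) = (Nat.card α : PowerSeries ℕ) := by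
  ext n
  rw [coeff_gf, ← map_natCast (C (R := ℕ)), coeff_C]
  split_ifs with h
  · subst h
    simp
  · have : IsEmpty {_a : α // 0 = n} := ⟨fun a => h a.2.symm⟩
    simp

theorem gf_add_one (s : α → ℕ) : gf (fun a => s a + 1) = X * gf s := by
  ext n
  rw [coeff_gf]
  cases n with
  | zero => simp
  | succ n =>
    rw [coeff_succ_X_mul, coeff_gf]
    exact Nat.card_congr (Equiv.subtypeEquivRight fun a => by simp)

/-- The fibres of a size function on a sum. -/
def fibreSumEquiv (s : α → ℕ) (t : β → ℕ) (n : ℕ) :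
    {x : α ⊕ β // Sum.elim s t x = n} ≃ {a // s a = n} ⊕ {b // t b = n} :=
  Equiv.subtypeSum

/-- Finite fibres are required because `Nat.card` of an infinite type is `0`, which would break
additivity. -/
theorem gf_sum (hs : FiniteFibres s) (ht : FiniteFibres t) :
    gf (Sum.elim s t) = gf s + gf t := by
  ext n
  have := hs n
  have := ht n
  rw [map_add, coeff_gf, coeff_gf, coeff_gf, Nat.card_congr (fibreSumEquiv s t n), Nat.card_sum]

/-- The fibres of an additive size function on a product. -/
def fibreProdEquiv (s : α → ℕ) (t : β → ℕ) (n : ℕ) :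
    {x : α × β // s x.1 + t x.2 = n} ≃
      Σ p : Finset.HasAntidiagonal.antidiagonal n, {a // s a = p.1.1} × {b // t b = p.1.2} where
  toFun x := ⟨⟨(s x.1.1, t x.1.2), by simpa using x.2⟩, ⟨x.1.1, rfl⟩, ⟨x.1.2, rfl⟩⟩
  invFun y := ⟨(y.2.1.1, y.2.2.1), by
    have := Finset.HasAntidiagonal.mem_antidiagonal.1 y.1.2
    rw [y.2.1.2, y.2.2.2, this]⟩
  left_inv x := rfl
  right_inv := by
    rintro ⟨⟨⟨k, l⟩, h⟩, ⟨a, ha⟩, ⟨b, hb⟩⟩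
    dsimp at ha hb
    subst ha hb
    rfl

theorem FiniteFibres.prod (hs : FiniteFibres s) (ht : FiniteFibres t) :
    FiniteFibres (fun x : α × β => s x.1 + t x.2) := fun n => by
  have := hs
  have := ht
  unfold FiniteFibres at *
  exact Finite.of_equiv _ (fibreProdEquiv s t n).symm

theorem gf_prod (hs : FiniteFibres s) (ht : FiniteFibres t) :
    gf (fun x : α × β => s x.1 + t x.2) = gf s * gf t := by
  ext n
  have := hs
  have := ht
  unfold FiniteFibres at *
  rw [coeff_gf, coeff_mul, Nat.card_congr (fibreProdEquiv s t n), Nat.card_sigma]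
  simp only [coeff_gf, Nat.card_prod]
  exact Finset.sum_coe_sort (Finset.HasAntidiagonal.antidiagonal n)
    fun x => Nat.card {a // s a = x.1} * Nat.card {b // t b = x.2}

/-- The two conclusions share one induction: the product rule needs the finiteness already obtained
for the remaining factors. -/
theorem finiteFibres_pi_and_gf_pi {k : ℕ} {α : Fin k → Type} {s : ∀ j, α j → ℕ}
    (hs : ∀ j, FiniteFibres (s j)) :
    FiniteFibres (fun f : ∀ j, α j => ∑ j, s j (f j)) ∧
      gf (fun f : ∀ j, α j => ∑ j, s j (f j)) = ∏ j, gf (s j) := by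
  induction k with
  | zero =>
    refine ⟨fun n => inferInstance, ?_⟩
    have := gf_const_zero (∀ j, α j)
    simpa using this
  | succ k ih =>
    obtain ⟨h1, h2⟩ := ih (s := fun j => s j.succ) fun j => hs j.succ
    have hsz : ∀ x : α 0 × (∀ j : Fin k, α j.succ),
        ∑ j, s j (Fin.consEquiv α x j) = s 0 x.1 + ∑ j : Fin k, s j.succ (x.2 j) := fun x => by
      rw [Fin.sum_univ_succ]
      simp [Fin.consEquiv]
    refine ⟨((hs 0).prod h1).congr (Fin.consEquiv α) hsz, ?_⟩
    rw [← gf_congr (Fin.consEquiv α) hsz, gf_prod (hs 0) h1, h2, Fin.prod_univ_succ]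

theorem finiteFibres_sigma_and_gf_sigma {k : ℕ} {α : Fin k → Type} {s : ∀ j, α j → ℕ}
    (hs : ∀ j, FiniteFibres (s j)) :
    FiniteFibres (fun x : Σ j, α j => s x.1 x.2) ∧
      gf (fun x : Σ j, α j => s x.1 x.2) = ∑ j, gf (s j) := by
  have e : ∀ n, {x : Σ j, α j // s x.1 x.2 = n} ≃ Σ j, {a : α j // s j a = n} := fun n =>
    { toFun := fun x => ⟨x.1.1, x.1.2, x.2⟩
      invFun := fun x => ⟨⟨x.1, x.2.1⟩, x.2.2⟩
      left_inv := fun _ => rfl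
      right_inv := fun _ => rfl }
  unfold FiniteFibres at *
  refine ⟨fun n => Finite.of_equiv _ (e n).symm, ?_⟩
  ext n
  rw [coeff_gf, Nat.card_congr (e n), Nat.card_sigma, map_sum]
  simp [coeff_gf]

end GeneratingFunction

/-! ### Trees of white-black pairs -/

/-- What can hang at a half-edge of a black node of an `m`-bipartite tree: a closing leaf, or a white
node, given together with its black child.  The number `a` is the position of the black child among
the `m - 1` children of the white node (the others being opening leaves), and `child` lists the
children of the black node. -/
inductive PairTree (m : ℕ) : Type
  | closing : PairTree m
  | node (a : Fin (m - 1)) (child : Fin (m - 1) → PairTree m) : PairTree m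

/-- The product of the heights of the down-steps (closing leaves) of a path starting at height `h`;
negative heights count as `0`. -/
def heightProd : List LeafKind → ℤ → ℕ
  | [], _ => 1
  | LeafKind.opening :: w, h => heightProd w (h + 1)
  | LeafKind.closing :: w, h => h.toNat * heightProd w (h - 1)

/-- The difference between the numbers of opening and of closing leaves. -/
def netHeight (w : List LeafKind) : ℤ :=
  w.count LeafKind.opening - w.count LeafKind.closing

theorem netHeight_append (v w : List LeafKind) :
    netHeight (v ++ w) = netHeight v + netHeight w := by
  simp only [netHeight, List.count_append]
  push_cast
  ring

theorem heightProd_append (v w : List LeafKind) (h : ℤ) :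
    heightProd (v ++ w) h = heightProd v h * heightProd w (h + netHeight v) := by
  induction v generalizing h with
  | nil => simp [heightProd, netHeight]
  | cons k v ih =>
    have hc : h + 1 + netHeight v = h + netHeight (LeafKind.opening :: v) ∧
        h - 1 + netHeight v = h + netHeight (LeafKind.closing :: v) := by
      constructor <;> simp [netHeight] <;> ring
    cases k
    · simp only [List.cons_append, heightProd, ih, hc.1]
    · simp only [List.cons_append, heightProd, ih, hc.2, mul_assoc]

theorem heightProd_replicate_opening (n : ℕ) (h : ℤ) :
    heightProd (List.replicate n LeafKind.opening) h = 1 := by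
  induction n generalizing h with
  | zero => rfl
  | succ n ih => simp [List.replicate_succ, heightProd, ih]

theorem netHeight_replicate_opening (n : ℕ) :
    netHeight (List.replicate n LeafKind.opening) = n := by
  simp [netHeight, List.count_replicate]

theorem netHeight_flatten {k : ℕ} (w : Fin k → List LeafKind) (hw : ∀ j, netHeight (w j) = -1) :
    netHeight (List.ofFn w).flatten = -k := by
  induction k with
  | zero => simp [netHeight]
  | succ k ih =>
    rw [List.ofFn_succ, List.flatten_cons, netHeight_append, hw, ih _ fun j => hw j.succ]
    push_cast
    ring

/-- Each word lowers the height by one, so the `j`-th one starts at `h - j`. -/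
theorem heightProd_flatten {k : ℕ} (w : Fin k → List LeafKind) (hw : ∀ j, netHeight (w j) = -1)
    (h : ℤ) : heightProd (List.ofFn w).flatten h = ∏ j, heightProd (w j) (h - j) := by
  induction k generalizing h with
  | zero => simp [heightProd]
  | succ k ih =>
    rw [List.ofFn_succ, List.flatten_cons, heightProd_append, hw, ih _ fun j => hw j.succ,
      Fin.prod_univ_succ]
    congr 1
    · simp
    · refine Finset.prod_congr rfl fun j _ => ?_
      congr 1
      simp
      ring

namespace PairTree

variable {m : ℕ}

/-- The kinds of the leaves in clockwise order. -/
def word : PairTree m → List LeafKind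
  | closing => [LeafKind.closing]
  | node a child =>
      List.replicate a LeafKind.opening ++ (List.ofFn fun j => word (child j)).flatten ++
        List.replicate (m - 2 - a) LeafKind.opening

/-- The number of black nodes. -/
def size : PairTree m → ℕ
  | closing => 0
  | node _ child => (∑ j, size (child j)) + 1

/-- A pair carries `m - 2` opening leaves and `m - 1` subtrees of net height `-1`. -/
theorem netHeight_word (T : PairTree m) : netHeight T.word = -1 := by
  induction T with
  | closing => simp [word, netHeight]
  | node a child ih =>
    rw [word, netHeight_append, netHeight_append, netHeight_flatten _ ih,
      netHeight_replicate_opening, netHeight_replicate_opening]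
    have := a.2
    omega

/-- The product of the heights of the closing leaves. -/
def weight (T : PairTree m) (h : ℤ) : ℕ := heightProd T.word h

theorem weight_closing (h : ℤ) : weight (closing : PairTree m) h = h.toNat := by
  simp [weight, word, heightProd]

/-- The `a` opening leaves before the black child raise the height, and each earlier subtree lowers
it by one; the opening leaves after the black child contribute no factor. -/
theorem weight_node (a : Fin (m - 1)) (child : Fin (m - 1) → PairTree m) (h : ℤ) :
    weight (node a child) h = ∏ j, weight (child j) (h + a - j) := by
  rw [weight, word, heightProd_append, heightProd_append, heightProd_replicate_opening,
    heightProd_replicate_opening, heightProd_flatten _ fun j => netHeight_word _,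
    netHeight_replicate_opening]
  simp [weight]

/-- The child of rank `a` starts at the same height as the whole tree, so following these children
leads to a closing leaf at height `h`, whose factor is `0`. -/
theorem weight_of_nonpos (T : PairTree m) {h : ℤ} (hh : h ≤ 0) : T.weight h = 0 := by
  induction T generalizing h with
  | closing => rw [weight_closing]; omega
  | node a child ih =>
    rw [weight_node]
    exact Finset.prod_eq_zero (Finset.mem_univ a) (ih a (by omega))

theorem finite_size_le (n : ℕ) : {T : PairTree m | T.size ≤ n}.Finite := by
  induction n with
  | zero =>
    refine (Set.finite_singleton closing).subset fun T hT => ?_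
    cases T with
    | closing => rfl
    | node a child => simp [size] at hT
  | succ n ih =>
    have h1 : (Set.univ.pi fun _ : Fin (m - 1) => {T : PairTree m | T.size ≤ n}).Finite :=
      Set.Finite.pi fun _ => ih
    have h2 := (Set.finite_univ (α := Fin (m - 1))).image2 node h1
    refine ((Set.finite_singleton closing).union h2).subset fun T hT => ?_
    cases T with
    | closing => exact Or.inl rfl
    | node a child =>
      refine Or.inr ⟨a, trivial, child, fun j _ => ?_, rfl⟩
      have h3 : (child j).size ≤ ∑ j, (child j).size :=
        Finset.single_le_sum (f := fun j => (child j).size) (fun _ _ => Nat.zero_le _)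
          (Finset.mem_univ j)
      simp only [Set.mem_ofPred_eq, size] at hT ⊢
      omega

/-- Trees with an index at each closing leaf, in numeric form, to be hung at height `h`. -/
abbrev Indexed (m : ℕ) (h : ℤ) : Type := Σ T : PairTree m, Fin (T.weight h)

/-- Number of black nodes. -/
def indexedSize {h : ℤ} (x : Indexed m h) : ℕ := x.1.size

/-- The children of a black node, with their indices, the first child being at height `h`. -/
abbrev IndexedForest (m : ℕ) (h : ℤ) : Type := ∀ j : Fin (m - 1), Indexed m (h - (j : ℕ))

/-- Number of black nodes, that of the root included. -/
def forestSize {h : ℤ} (f : IndexedForest m h) : ℕ := (∑ j, indexedSize (f j)) + 1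

theorem finiteFibres_indexedSize (h : ℤ) : FiniteFibres (indexedSize (m := m) (h := h)) := by
  intro n
  have : Finite {T : PairTree m // T.size = n} :=
    ((finite_size_le n).subset fun T (hT : T.size = n) => hT.le).to_subtype
  refine Finite.of_injective
    (β := Σ T : {T : PairTree m // T.size = n}, Fin (T.1.weight h))
    (fun x => ⟨⟨x.1.1, x.2⟩, x.1.2⟩) ?_
  rintro ⟨⟨T, k⟩, hT⟩ ⟨⟨T', k'⟩, hT'⟩ hh
  obtain ⟨h1, h2⟩ := Sigma.mk.inj hh
  obtain rfl := congrArg Subtype.val h1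
  obtain rfl := eq_of_heq h2
  rfl

/-- The series of indexed forests below a white-black pair whose leftmost subtree is at height
`h + m - 2`. -/
noncomputable def forestSeries (m : ℕ) (h : ℤ) : PowerSeries ℕ :=
  gf (forestSize (m := m) (h := h + (m - 2 : ℕ)))

/-- The series of indexed trees at height `h`. -/
noncomputable def indexedSeries (m : ℕ) (h : ℤ) : PowerSeries ℕ :=
  gf (indexedSize (m := m) (h := h))

theorem finiteFibres_forestSize (h : ℤ) : FiniteFibres (forestSize (m := m) (h := h)) := by
  intro n
  have h1 := (finiteFibres_pi_and_gf_pi (k := m - 1) (α := fun j => Indexed m (h - (j : ℕ)))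
    (s := fun j => indexedSize) fun j => finiteFibres_indexedSize _).1 (n - 1)
  refine Finite.of_injective (fun x : {f : IndexedForest m h // forestSize f = n} =>
    (⟨x.1, ?_⟩ : {f : IndexedForest m h // ∑ j, indexedSize (f j) = n - 1})) ?_
  · have := x.2
    unfold forestSize at this
    omega
  · intro x y hxy
    simpa [Subtype.ext_iff] using hxy

theorem gf_forestSize (h : ℤ) :
    gf (forestSize (m := m) (h := h)) =
      PowerSeries.X * ∏ j : Fin (m - 1), indexedSeries m (h - (j : ℕ)) := by
  rw [show forestSize (m := m) (h := h) = fun f => (∑ j, indexedSize (f j)) + 1 from rfl,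
    gf_add_one]
  congr 1
  exact (finiteFibres_pi_and_gf_pi (k := m - 1) (α := fun j => Indexed m (h - (j : ℕ)))
    (s := fun j => indexedSize) fun j => finiteFibres_indexedSize _).2

/-- The children sit at heights `i + m - 2, …, i` from left to right; reading them from right to
left gives the product over `i + a`. -/
theorem forestSeries_eq (i : ℕ) :
    forestSeries m i =
      PowerSeries.X * ∏ a ∈ Finset.range (m - 1), indexedSeries m ((i + a : ℕ) : ℤ) := by
  rw [forestSeries, gf_forestSize, ← Finset.prod_range_reflect, Finset.prod_range]
  congr 1
  refine Finset.prod_congr rfl fun j _ => ?_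
  congr 1
  have := j.2
  omega

/-- The last child sits at height `h ≤ 0`, where no tree has an indexing. This accounts for the
convention `q_j = 0` for `j ≤ 0`. -/
theorem forestSeries_of_nonpos (hm : 2 ≤ m) {h : ℤ} (hh : h ≤ 0) : forestSeries m h = 0 := by
  rw [forestSeries, gf_forestSize]
  have h1 : indexedSeries m (h + (m - 2 : ℕ) - ((⟨m - 2, by omega⟩ : Fin (m - 1)) : ℕ)) = 0 := by
    have : IsEmpty (Indexed m (h + (m - 2 : ℕ) - ((⟨m - 2, by omega⟩ : Fin (m - 1)) : ℕ))) := by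
      refine ⟨fun x => ?_⟩
      have h2 := x.2
      rw [weight_of_nonpos _ (by simpa using hh)] at h2
      exact h2.elim0
    exact gf_isEmpty _
  rw [Finset.prod_eq_zero (i := (⟨m - 2, by omega⟩ : Fin (m - 1))) (Finset.mem_univ _) h1, mul_zero]

/-- An indexed tree is a closing leaf with its index, or an indexed forest with the position of the
black child of the root. -/
def indexedEquiv (m : ℕ) (h : ℤ) :
    Indexed m h ≃ Fin h.toNat ⊕
      Σ a : Fin (m - 1), Σ child : Fin (m - 1) → PairTree m,
        Fin (∏ j, (child j).weight (h + (a : ℕ) - (j : ℕ))) where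
  toFun
    | ⟨closing, k⟩ => Sum.inl (k.cast (weight_closing h))
    | ⟨node a child, k⟩ => Sum.inr ⟨a, child, k.cast (weight_node a child h)⟩
  invFun
    | Sum.inl k => ⟨closing, k.cast (weight_closing h).symm⟩
    | Sum.inr ⟨a, child, k⟩ => ⟨node a child, k.cast (weight_node a child h).symm⟩
  left_inv := by rintro ⟨_ | ⟨a, child⟩, k⟩ <;> rfl
  right_inv := by rintro (k | ⟨a, child, k⟩) <;> rfl

/-- The indices of the subtrees of a forest, combined into a single number. -/
noncomputable def forestEquiv (m : ℕ) (h : ℤ) :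
    IndexedForest m h ≃ Σ child : Fin (m - 1) → PairTree m,
        Fin (∏ j, (child j).weight (h - (j : ℕ))) :=
  (show IndexedForest m h ≃ Σ child : Fin (m - 1) → PairTree m,
      ∀ j, Fin ((child j).weight (h - (j : ℕ))) from
    { toFun := fun f => ⟨fun j => (f j).1, fun j => (f j).2⟩
      invFun := fun x j => ⟨x.1 j, x.2 j⟩
      left_inv := fun _ => rfl
      right_inv := fun _ => rfl }).trans (Equiv.sigmaCongrRight fun _ => finPiFinEquiv)

theorem forestEquiv_fst (h : ℤ) (f : IndexedForest m h) :
    forestSize f = (∑ j, ((forestEquiv m h f).1 j).size) + 1 := rfl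

theorem indexedSeries_eq_sum (h : ℕ) :
    indexedSeries m h =
      (h : PowerSeries ℕ) + ∑ a : Fin (m - 1), gf (forestSize (m := m) (h := (h : ℤ) + (a : ℕ))) := by
  have h1 := finiteFibres_sigma_and_gf_sigma (k := m - 1)
    (α := fun a => IndexedForest m ((h : ℤ) + (a : ℕ)))
    (s := fun _ => forestSize) fun a => finiteFibres_forestSize _
  let e : Indexed m h ≃ Fin (h : ℤ).toNat ⊕ Σ a : Fin (m - 1), IndexedForest m ((h : ℤ) + (a : ℕ)) :=
    (indexedEquiv m h).trans (Equiv.sumCongr (Equiv.refl _)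
      (Equiv.sigmaCongrRight fun a => (forestEquiv m ((h : ℤ) + (a : ℕ))).symm))
  have h2 : FiniteFibres fun _ : Fin (h : ℤ).toNat => 0 := fun n => inferInstance
  rw [indexedSeries, gf_congr (t := Sum.elim (fun _ => 0) fun x => forestSize x.2) e, gf_sum h2 h1.1,
    h1.2, gf_const_zero]
  · simp
  · rintro ⟨_ | ⟨a, child⟩, k⟩
    · rfl
    · change forestSize ((forestEquiv m ((h : ℤ) + (a : ℕ))).symm ⟨child, _⟩) = _
      rw [forestEquiv_fst, Equiv.apply_symm_apply]
      rfl

theorem indexedSeries_eq (hm : 2 ≤ m) {h : ℕ} (hh : 1 ≤ h) :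
    indexedSeries m h =
      (h : PowerSeries ℕ) + ∑ a ∈ Finset.range (m - 1), forestSeries m ((h - a : ℕ) : ℤ) := by
  rw [indexedSeries_eq_sum, ← Finset.sum_range_reflect, Finset.sum_range]
  congr 1
  refine Finset.sum_congr rfl fun a _ => ?_
  have ha := a.2
  rcases le_or_gt (m - 2) (h + a) with h1 | h1
  · have h2 : (h : ℤ) + (a : ℕ) = ((h - (m - 1 - 1 - (a : ℕ)) : ℕ) : ℤ) + (m - 2 : ℕ) := by omega
    rw [forestSeries, h2]
  -- Here the subtraction is truncated and the right-hand term vanishes. The forest series vanishes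
  -- too, since the child of rank `h + a` exists and sits at height `0`.
  · rw [show h - (m - 1 - 1 - (a : ℕ)) = 0 by omega, forestSeries_of_nonpos hm (by simp),
      gf_forestSize]
    have h2 : indexedSeries m (((h : ℤ) + (a : ℕ)) - ((⟨h + a, by omega⟩ : Fin (m - 1)) : ℕ)) = 0 := by
      have : IsEmpty (Indexed m (((h : ℤ) + (a : ℕ)) - ((⟨h + a, by omega⟩ : Fin (m - 1)) : ℕ))) := by
        refine ⟨fun x => ?_⟩
        have h2 := x.2
        rw [weight_of_nonpos _ (by simp)] at h2
        exact h2.elim0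
      exact gf_isEmpty _
    rw [Finset.prod_eq_zero (i := (⟨h + a, by omega⟩ : Fin (m - 1))) (Finset.mem_univ _) h2, mul_zero]

theorem forestSeries_eq_qSeries (hm : 2 ≤ m) (i : ℕ) :
    forestSeries m i = QSystem.qSeries m i := by
  have h1 : QSystem.IsSolution m (fun j => indexedSeries m j) (fun j => forestSeries m j) :=
    ⟨forestSeries_of_nonpos hm (by simp), fun j hj => indexedSeries_eq hm hj,
      fun j _ => forestSeries_eq j⟩
  exact congrFun (QSystem.isSolution_unique h1).1 i

/-- The last position among the children of a node. -/
def lastPos (hm : 3 ≤ m) : Fin (m - 1) := ⟨m - 2, by omega⟩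

/-- A family of finite types indexed by the trees with rightmost root child, each having as many
members as there are indexings of the tree, is counted by `q_i`. -/
theorem finiteFibres_and_gf_eq_qSeries (hm : 3 ≤ m) (i : ℕ)
    (F : (Fin (m - 1) → PairTree m) → Type) [∀ c, Finite (F c)]
    (hF : ∀ c, Nat.card (F c) = (node (lastPos hm) c).weight i) :
    FiniteFibres (fun x : Σ c, F c => (node (lastPos hm) x.1).size) ∧
      gf (fun x : Σ c, F c => (node (lastPos hm) x.1).size) = QSystem.qSeries m i := by
  -- The `m - 2` opening children of the root come before its black child, hence the starting height
  -- `i + (m - 2)`. Only the cardinality of `F c` is known, so the equivalence is an arbitrary one.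
  have e1 : ∀ c, Nonempty (Fin (∏ j, (c j).weight ((i : ℤ) + (m - 2 : ℕ) - (j : ℕ))) ≃ F c) :=
    fun c => by
    have h1 : Nat.card (Fin (∏ j, (c j).weight ((i : ℤ) + (m - 2 : ℕ) - (j : ℕ)))) =
        Nat.card (F c) := by
      rw [hF, weight_node]
      simp [lastPos]
    exact Finite.card_eq.1 h1
  let e : IndexedForest m ((i : ℤ) + (m - 2 : ℕ)) ≃ Σ c, F c :=
    (forestEquiv m _).trans (Equiv.sigmaCongrRight fun c => (e1 c).some)
  have he : ∀ f, (node (lastPos hm) (e f).1).size = forestSize f := fun f => rfl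
  refine ⟨(finiteFibres_forestSize _).congr e he, ?_⟩
  rw [← forestSeries_eq_qSeries (by omega), forestSeries]
  exact (gf_congr e he).symm

end PairTree

/-! ### `m`-bipartite trees as trees of white-black pairs -/

namespace PairTree

variable {m : ℕ}

/-- The blossoming tree described by a tree of white-black pairs. -/
def toBlossom : PairTree m → BlossomTree m
  | closing => BlossomTree.leaf LeafKind.closing
  | node a child =>
      BlossomTree.node Color.white fun j =>
        if j = a then BlossomTree.node Color.black fun j' => toBlossom (child j')
        else BlossomTree.leaf LeafKind.opening

theorem flatten_ofFn_update {α : Type*} {k : ℕ} (a : Fin k) (x : α) (w : List α) :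
    (List.ofFn fun j : Fin k => if j = a then w else [x]).flatten =
      List.replicate a x ++ w ++ List.replicate (k - 1 - a) x := by
  induction k with
  | zero => exact a.elim0
  | succ k ih =>
    rw [List.ofFn_succ, List.flatten_cons]
    refine Fin.cases ?_ (fun b => ?_) a
    · simp [List.flatten_replicate_singleton, Fin.succ_ne_zero]
    · have h1 : ∀ i : Fin k, (i.succ = b.succ) = (i = b) := fun i => by simp
      have h2 : (k + 1 - 1 - (b.succ : ℕ)) = k - 1 - b := by rw [Fin.val_succ]; omega
      have h3 : ¬ (0 : Fin (k + 1)) = b.succ := (Fin.succ_ne_zero b).symm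
      simp only [h1, ih, h2, if_neg h3]
      simp [List.replicate_succ]

theorem leafWord_toBlossom (T : PairTree m) : T.toBlossom.leafWord = T.word := by
  induction T with
  | closing => simp [toBlossom, word, BlossomTree.leafWord]
  | node a child ih =>
    rw [toBlossom, BlossomTree.leafWord, word]
    have h1 : (fun j : Fin (m - 1) => BlossomTree.leafWord (if j = a then BlossomTree.node Color.black
          fun j' => toBlossom (child j') else BlossomTree.leaf LeafKind.opening)) =
        fun j => if j = a then (List.ofFn fun j => word (child j)).flatten else [LeafKind.opening] := by
      funext j
      split_ifs
      · simp [BlossomTree.leafWord, ih]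
      · simp [BlossomTree.leafWord]
    rw [h1, flatten_ofFn_update]
    congr 2

theorem blackNodes_toBlossom (T : PairTree m) : T.toBlossom.blackNodes = T.size := by
  induction T with
  | closing => simp [toBlossom, size, BlossomTree.blackNodes]
  | node a child ih =>
    rw [toBlossom, BlossomTree.blackNodes, size, Finset.sum_eq_single a]
    · simp [BlossomTree.blackNodes, ih, add_comm]
    · intro b _ hb
      simp [hb, BlossomTree.blackNodes]
    · simp

theorem toBlossom_injective : Function.Injective (toBlossom (m := m)) := by
  intro T
  induction T with
  | closing =>
    intro T' h
    cases T' with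
    | closing => rfl
    | node a child => simp [toBlossom] at h
  | node a child ih =>
    intro T' h
    cases T' with
    | closing => simp [toBlossom] at h
    | node a' child' =>
      simp only [toBlossom, BlossomTree.node.injEq, true_and] at h
      have h1 := congrFun h a
      by_cases haa : a = a'
      · subst haa
        simp only [if_true, BlossomTree.node.injEq, true_and] at h1
        congr
        funext j
        exact ih j (congrFun h1 j)
      · simp [haa] at h1

theorem localRule_toBlossom (T : PairTree m) :
    T.toBlossom.LocalRule ∧
      (T.toBlossom.IsNode Color.white ∨ T.toBlossom.IsLeaf LeafKind.closing) := by
  induction T with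
  | closing => simp [toBlossom, BlossomTree.LocalRule, BlossomTree.IsLeaf]
  | node a child ih =>
    refine ⟨?_, Or.inl (by simp [toBlossom, BlossomTree.IsNode])⟩
    rw [toBlossom, BlossomTree.LocalRule]
    refine ⟨fun j => ?_, ⟨a, by simp [BlossomTree.IsNode], fun j hj => ?_⟩, fun j => ?_⟩
    · by_cases h : j = a <;> simp [h, BlossomTree.IsNode, BlossomTree.IsLeaf]
    · by_contra h
      simp [h, BlossomTree.IsNode] at hj
    · by_cases h : j = a
      · simp only [h, if_true, BlossomTree.LocalRule]
        exact ⟨fun j => (ih j).2, fun j => (ih j).1⟩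
      · simp [h, BlossomTree.LocalRule]

/-- The two parts are proved together because a pair spans two levels of a blossoming tree: a white
node needs the second part for its black child, and a black node the first part for its children. -/
theorem exists_toBlossom (B : BlossomTree m) :
    (B.LocalRule → B.IsNode Color.white ∨ B.IsLeaf LeafKind.closing →
      ∃ T : PairTree m, T.toBlossom = B) ∧
    (B.LocalRule → B.IsNode Color.black → ∃ child : Fin (m - 1) → PairTree m,
      B = BlossomTree.node Color.black fun j => (child j).toBlossom) := by
  induction B with
  | leaf k =>
    refine ⟨fun _ h => ?_, fun _ h => h.elim⟩
    simp only [BlossomTree.IsNode, BlossomTree.IsLeaf, false_or] at h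
    exact ⟨closing, by rw [h]; rfl⟩
  | node c child ih =>
    refine ⟨fun h1 h2 => ?_, fun h1 h2 => ?_⟩
    · simp only [BlossomTree.IsNode, BlossomTree.IsLeaf, or_false] at h2
      subst h2
      rw [BlossomTree.LocalRule] at h1
      obtain ⟨h3, ⟨a, ha, hu⟩, h4⟩ := h1
      obtain ⟨ch, hch⟩ := (ih a).2 (h4 a) ha
      refine ⟨node a ch, ?_⟩
      rw [toBlossom]
      congr 1
      funext j
      by_cases hj : j = a
      · subst hj
        simp [hch]
      · rw [if_neg hj]
        rcases h3 j with h5 | h5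
        · exact absurd (hu j h5) hj
        · cases hc : child j with
          | leaf k => rw [hc] at h5; rw [show k = LeafKind.opening from h5]
          | node _ _ => rw [hc] at h5; exact h5.elim
    · simp only [BlossomTree.IsNode] at h2
      subst h2
      rw [BlossomTree.LocalRule] at h1
      choose ch hch using fun j => (ih j).1 (h1.2 j) (h1.1 j)
      exact ⟨ch, by simp [hch]⟩

theorem isBlossoming_toBlossom (T : PairTree m) : T.toBlossom.IsBlossoming := by
  have := T.netHeight_word
  rw [BlossomTree.IsBlossoming, leafWord_toBlossom]
  unfold netHeight at this
  omega

theorem isMBipartite_toBlossom (T : PairTree m) : T.toBlossom.IsMBipartite :=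
  ⟨T.isBlossoming_toBlossom, (T.localRule_toBlossom).2.symm, (T.localRule_toBlossom).1⟩

theorem rightmostRootChild_toBlossom_iff (hm : 3 ≤ m) (T : PairTree m) :
    T.toBlossom.RightmostRootChild ↔ ∃ child, T = node (lastPos hm) child := by
  cases T with
  | closing => simp [toBlossom, BlossomTree.RightmostRootChild]
  | node a child =>
    simp only [toBlossom, BlossomTree.RightmostRootChild]
    constructor
    · rintro ⟨j, hj, c, hc⟩
      by_cases hja : j = a
      · refine ⟨child, ?_⟩
        congr
        rw [← hja]
        ext
        simp only [lastPos]
        omega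
      · simp [hja, BlossomTree.IsNode] at hc
    · rintro ⟨ch, h⟩
      cases h
      exact ⟨lastPos hm, by simp only [lastPos]; omega, Color.black, by simp [BlossomTree.IsNode]⟩

end PairTree

/-! ### Indexings of the closing leaves and their number. -/

namespace BlossomTree

variable {m : ℕ}

/-- The indexings of the closing leaves that make the tree `i`-enriched. -/
abbrev Indexing (T : BlossomTree m) (i : ℕ) : Type :=
  {index : T.ClosingLeaf → ℕ // ∀ c, (index c : ℤ) < T.iHeight i c}

/-- An index in `{0, …, h - 1}` exists only if `h ≥ 1`, so every down-step ends at a nonnegative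
height. -/
theorem Indexing.isBalanced {T : BlossomTree m} {i : ℕ} (x : T.Indexing i) : T.IsBalanced i := by
  intro j
  induction j with
  | zero => simp [pathHeight]
  | succ j ih =>
    intro hj
    have h1 := ih (by omega)
    have hj' : j < T.leafWord.length := hj
    have h2 : T.leafWord.take (j + 1) = T.leafWord.take j ++ [T.leafWord[j]] :=
      (List.take_append_getElem hj').symm
    unfold pathHeight at h1 ⊢
    rw [h2, List.count_append, List.count_append]
    cases hk : T.leafWord[j] with
    | opening => simp; omega
    | closing =>
      have h3 := x.2 ⟨⟨j, hj'⟩, hk⟩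
      simp only [iHeight, pathHeight] at h3
      simp
      omega

instance (T : BlossomTree m) : Finite T.ClosingLeaf := by
  unfold ClosingLeaf; infer_instance

/-- Indexings choose a number below each height. -/
def indexingEquiv (T : BlossomTree m) (i : ℕ) :
    T.Indexing i ≃ ∀ c : T.ClosingLeaf, Fin (T.iHeight i c).toNat where
  toFun x c := ⟨x.1 c, by have := x.2 c; omega⟩
  invFun f := ⟨fun c => f c, fun c => by have := (f c).2; dsimp only; omega⟩
  left_inv _ := rfl
  right_inv _ := rfl

instance (T : BlossomTree m) (i : ℕ) : Finite (T.Indexing i) :=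
  Finite.of_equiv _ (T.indexingEquiv i).symm

end BlossomTree

/-- A factor `1` at the opening positions lets the product run over all positions, so that the first
letter can be split off and its effect absorbed in the starting height. -/
theorem prod_ite_eq_heightProd (w : List LeafKind) (h : ℤ) :
    (∏ t : Fin w.length, if w.get t = LeafKind.closing then
      (h + (w.take t).count LeafKind.opening - (w.take t).count LeafKind.closing).toNat else 1) =
      heightProd w h := by
  induction w generalizing h with
  | nil => simp [heightProd]
  | cons k w ih =>
    change (∏ t : Fin (w.length + 1), _) = _
    rw [Fin.prod_univ_succ]
    cases k
    · rw [heightProd, ← ih, List.get_cons_zero, if_neg (by decide), one_mul]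
      refine Finset.prod_congr rfl fun t _ => ?_
      rw [List.get_cons_succ']
      congr 2
      simp only [Fin.val_succ, List.take_succ_cons, List.count_cons_self]
      rw [List.count_cons_of_ne (by decide)]
      push_cast
      ring
    · rw [heightProd, ← ih, List.get_cons_zero, if_pos rfl]
      congr 1
      · simp
      refine Finset.prod_congr rfl fun t _ => ?_
      rw [List.get_cons_succ']
      congr 2
      simp only [Fin.val_succ, List.take_succ_cons, List.count_cons_self]
      rw [List.count_cons_of_ne (by decide)]
      push_cast
      ring

theorem prod_closing_eq_heightProd (w : List LeafKind) (h : ℤ) :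
    (∏ t : {t : Fin w.length // w.get t = LeafKind.closing},
      (h + (w.take t.1).count LeafKind.opening - (w.take t.1).count LeafKind.closing).toNat) =
      heightProd w h := by
  rw [← prod_ite_eq_heightProd, Finset.prod_ite, Finset.prod_const_one, mul_one]
  exact (Finset.prod_subtype _ (by simp) fun t : Fin w.length =>
    (h + (w.take t).count LeafKind.opening - (w.take t).count LeafKind.closing).toNat).symm

namespace PairTree

variable {m : ℕ}

theorem card_indexing (T : PairTree m) (i : ℕ) :
    Nat.card (T.toBlossom.Indexing i) = T.weight i := by
  rw [Nat.card_congr (T.toBlossom.indexingEquiv i)]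
  rw [weight, ← leafWord_toBlossom, ← prod_closing_eq_heightProd]
  unfold BlossomTree.ClosingLeaf
  rw [Nat.card_pi]
  simp only [Nat.card_fin]
  rfl

/-- The enriched tree given by a forest and an indexing. -/
def enrichedTree (hm : 3 ≤ m) (i : ℕ)
    (x : Σ c : Fin (m - 1) → PairTree m, (node (lastPos hm) c).toBlossom.Indexing i) :
    RightEnrichedTree m i :=
  ⟨⟨_, isMBipartite_toBlossom _, x.2.isBalanced, x.2.1, x.2.2⟩,
    (rightmostRootChild_toBlossom_iff hm _).2 ⟨x.1, rfl⟩⟩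

theorem enrichedTree_bijective (hm : 3 ≤ m) (i : ℕ) :
    Function.Bijective (enrichedTree (m := m) hm i) := by
  constructor
  · rintro ⟨c, x, hx⟩ ⟨c', x', hx'⟩ h
    have h1 := toBlossom_injective (congrArg (fun x => x.1.tree) h)
    simp only [node.injEq, true_and] at h1
    subst h1
    have h2 := congrArg Subtype.val h
    simp only [enrichedTree, EnrichedTree.mk.injEq, true_and, heq_eq_eq] at h2
    subst h2
    rfl
  · rintro ⟨⟨B, h1, h2, index, h3⟩, h4⟩
    obtain ⟨T, rfl⟩ := (exists_toBlossom B).1 h1.2.2 h1.2.1.symm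
    obtain ⟨c, rfl⟩ := (rightmostRootChild_toBlossom_iff hm T).1 h4
    exact ⟨⟨c, index, h3⟩, rfl⟩

theorem blackNodes_enrichedTree (hm : 3 ≤ m) (i : ℕ)
    (x : Σ c : Fin (m - 1) → PairTree m, (node (lastPos hm) c).toBlossom.Indexing i) :
    (enrichedTree hm i x).blackNodes = (node (lastPos hm) x.1).size :=
  blackNodes_toBlossom _

end PairTree

/-! ### Counting the ways of closing a path -/

/-- Systems of distinct representatives of an increasing sequence of finite sets. -/
theorem card_nested_injections {Y : Type*} [DecidableEq Y] {n : ℕ}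
    (A : Fin n → Finset Y) (hA : Monotone A) :
    Nat.card {f : Fin n → Y // Function.Injective f ∧ ∀ k, f k ∈ A k} =
      ∏ k, ((A k).card - k) := by
  induction n with
  | zero =>
    have : Unique {f : Fin 0 → Y // Function.Injective f ∧ ∀ k, f k ∈ A k} :=
      ⟨⟨⟨fun k => k.elim0, fun k => k.elim0, fun k => k.elim0⟩⟩,
        fun f => Subtype.ext (funext fun k => k.elim0)⟩
    rw [Nat.card_unique]
    simp
  | succ n ih =>
    let S := {f : Fin n → Y // Function.Injective f ∧ ∀ k, f k ∈ A k.castSucc}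
    -- An injection is its restriction to the first `n` arguments together with a last value not yet
    -- used.
    let e : {f : Fin (n + 1) → Y // Function.Injective f ∧ ∀ k, f k ∈ A k} ≃
        Σ f : S, {y // y ∈ A (Fin.last n) \ Finset.univ.image f.1} :=
      { toFun := fun f => ⟨⟨fun k => f.1 k.castSucc,
            f.2.1.comp (Fin.castSucc_injective n), fun k => f.2.2 _⟩,
          f.1 (Fin.last n), by
            simp only [Finset.mem_sdiff, f.2.2, Finset.mem_image, Finset.mem_univ, true_and,
              not_exists]
            exact fun k hk => (Fin.castSucc_lt_last k).ne (f.2.1 hk)⟩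
        invFun := fun x => ⟨Fin.snoc (α := fun _ => Y) x.1.1 x.2.1, by
            have h2 := x.2.2
            simp only [Finset.mem_sdiff, Finset.mem_image, Finset.mem_univ, true_and,
              not_exists] at h2
            exact Fin.snoc_injective_iff.2 ⟨x.1.2.1, fun ⟨k, hk⟩ => h2.2 k hk⟩, fun k => by
            refine Fin.lastCases ?_ (fun k => ?_) k
            · rw [Fin.snoc_last]
              exact (Finset.mem_sdiff.1 x.2.2).1
            · rw [Fin.snoc_castSucc]
              exact x.1.2.2 k⟩
        left_inv := fun f => by
          apply Subtype.ext
          funext k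
          refine Fin.lastCases ?_ (fun k => ?_) k
          · simp
          · simp
        right_inv := fun x => by
          obtain ⟨⟨f, hf⟩, ⟨y, hy⟩⟩ := x
          refine Sigma.ext (Subtype.ext (funext fun k => by simp)) ?_
          refine (Subtype.heq_iff_coe_eq fun z => ?_).2 (by simp)
          simp }
    -- `Y` itself may be infinite; all values lie in the finite union of the sets `A k`.
    have hS : Finite S := by
      have : Finite {y // y ∈ Finset.univ.biUnion A} := inferInstance
      exact Finite.of_injective
        (fun f : S => fun k => (⟨f.1 k, Finset.mem_biUnion.2 ⟨_, Finset.mem_univ _, f.2.2 k⟩⟩ :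
          {y // y ∈ Finset.univ.biUnion A}))
        fun f g h => Subtype.ext (funext fun k => congrArg Subtype.val (congrFun h k))
    have := Fintype.ofFinite S
    rw [Nat.card_congr e, Nat.card_sigma, Fin.prod_univ_castSucc]
    -- By monotonicity the `n` values used so far all lie in the last set, so the number of choices
    -- left does not depend on `f`.
    have hc : ∀ f : S, Nat.card {y // y ∈ A (Fin.last n) \ Finset.univ.image f.1} =
        (A (Fin.last n)).card - n := fun f => by
      rw [Nat.card_eq_fintype_card, Fintype.card_coe, Finset.card_sdiff_of_subset,
        Finset.card_image_of_injective _ f.2.1, Finset.card_univ, Fintype.card_fin]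
      intro y hy
      obtain ⟨k, -, rfl⟩ := Finset.mem_image.1 hy
      exact hA (Fin.le_last _) (f.2.2 k)
    rw [Finset.sum_congr rfl fun f _ => hc f, Finset.sum_const, Finset.card_univ,
      ← Nat.card_eq_fintype_card, ih _ fun k l h => hA (Fin.castSucc_le_castSucc_iff.2 h)]
    simp

theorem card_nested_injections_of_linearOrder {C Y : Type*} [LinearOrder C] [Fintype C]
    [DecidableEq Y] (A : C → Finset Y) (hA : Monotone A) :
    Nat.card {f : C → Y // Function.Injective f ∧ ∀ c, f c ∈ A c} =
      ∏ c, ((A c).card - (Finset.univ.filter (· < c)).card) := by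
  let e : Fin (Fintype.card C) ≃o C := Fintype.orderIsoFinOfCardEq C rfl
  have h1 : ∀ k, (Finset.univ.filter (· < e k)).card = k := fun k => by
    have h2 : Finset.univ.filter (· < e k) = (Finset.univ.filter (· < k)).map e.toEquiv.toEmbedding := by
      ext c
      obtain ⟨j, rfl⟩ := e.surjective c
      simp
    rw [h2, Finset.card_map]
    rw [show Finset.univ.filter (· < k) = Finset.Iio k by ext; simp, Fin.card_Iio]
  rw [← e.toEquiv.prod_comp]
  refine Eq.trans ?_ ((card_nested_injections (A ∘ e) (hA.comp e.monotone)).trans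
    (Finset.prod_congr rfl fun k _ => congrArg ((A (e k)).card - ·) (h1 k).symm))
  exact Nat.card_congr ((e.symm.toEquiv.arrowCongr (Equiv.refl Y)).subtypeEquiv fun f => by
    refine and_congr ?_ ?_
    · simp [Equiv.arrowCongr]
    · simp only [Equiv.arrowCongr_apply, Function.comp]
      exact ⟨fun h k => by simpa using h (e k), fun h c => by simpa using h (e.symm c)⟩)

/-! ### Weighted matchings encoded as injections. -/

section Closure

variable {Y C : Type*} [LinearOrder Y] [OrderBot Y] [Fintype Y]

/-- A matching of `Y` with `C` and multiplicities adding up to less than `i`, positive at the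
elements `y ≠ ⊥` not related to their partners. -/
structure WeightedMatching (rel : Y → C → Prop) (i : ℕ) where
  partner : Y ≃ C
  mult : Y → ℕ
  mult_ne_zero : ∀ y, y ≠ ⊥ → ¬ rel y (partner y) → mult y ≠ 0
  sum_lt : ∑ y, mult y < i

namespace WeightedMatching

variable {rel : Y → C → Prop} {i : ℕ}

theorem ext' {g g' : WeightedMatching rel i} (h1 : g.partner = g'.partner) (h2 : g.mult = g'.mult) :
    g = g' := by
  cases g; cases g'; cases h1; cases h2; rfl

/-- The sum of the multiplicities up to `y`. -/
def label (g : WeightedMatching rel i) (y : Y) : Fin i :=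
  ⟨∑ z ∈ Finset.univ.filter (· ≤ y), g.mult z,
    (Finset.sum_le_sum_of_subset (Finset.filter_subset _ _)).trans_lt g.sum_lt⟩

theorem label_eq (g : WeightedMatching rel i) (y : Y) :
    (g.label y : ℕ) = (∑ z ∈ Finset.univ.filter (· < y), g.mult z) + g.mult y := by
  have : Finset.univ.filter (· ≤ y) = insert y (Finset.univ.filter (· < y)) := by
    ext z
    simp [le_iff_eq_or_lt]
  simp only [label]
  rw [this, Finset.sum_insert (by simp), add_comm]

theorem label_lt (g : WeightedMatching rel i) {y z : Y} (h : y < z) (hz : g.mult z ≠ 0) :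
    g.label y < g.label z := by
  rw [Fin.lt_def, g.label_eq z]
  have : (g.label y : ℕ) ≤ ∑ x ∈ Finset.univ.filter (· < z), g.mult x :=
    Finset.sum_le_sum_of_subset fun x hx => by
      simp only [Finset.mem_filter, Finset.mem_univ, true_and] at hx ⊢
      exact hx.trans_lt h
  omega

/-- An element is unlabelled if it has multiplicity zero and is not the bottom. -/
abbrev Unlabelled (g : WeightedMatching rel i) (y : Y) : Prop := y ≠ ⊥ ∧ g.mult y = 0

/-- An element above another one is not `⊥`; if it is labelled, its multiplicity is therefore
nonzero and the partial sum jumps there. -/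
theorem label_strictMono (g : WeightedMatching rel i) {y z : Y} (h : y < z)
    (hz : ¬ g.Unlabelled z) : g.label y < g.label z :=
  g.label_lt h fun h0 => hz ⟨(bot_le.trans_lt h).ne', h0⟩

/-- The token of an element: itself if it is unlabelled, its label otherwise. -/
def token (g : WeightedMatching rel i) (y : Y) : Y ⊕ Fin i :=
  if g.Unlabelled y then Sum.inl y else Sum.inr (g.label y)

theorem token_eq_inl (g : WeightedMatching rel i) {y z : Y} :
    g.token y = Sum.inl z ↔ y = z ∧ g.Unlabelled z := by
  unfold token
  split_ifs with h
  · constructor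
    · intro h1
      cases h1
      exact ⟨rfl, h⟩
    · rintro ⟨rfl, -⟩
      rfl
  · constructor
    · intro h1
      cases h1
    · rintro ⟨rfl, h1⟩
      exact absurd h1 h

theorem token_eq_inr (g : WeightedMatching rel i) {y : Y} {l : Fin i} :
    g.token y = Sum.inr l ↔ ¬ g.Unlabelled y ∧ g.label y = l := by
  unfold token
  split_ifs with h <;> simp [h]

/-- Unlabelled elements are their own tokens, and labels increase strictly along the labelled
elements. -/
theorem token_injective (g : WeightedMatching rel i) : Function.Injective g.token := by
  intro y z h
  cases hz : g.token z with
  | inl w =>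
    rw [hz] at h
    exact ((g.token_eq_inl).1 h).1.trans ((g.token_eq_inl).1 hz).1.symm
  | inr l =>
    rw [hz] at h
    obtain ⟨h1, h2⟩ := g.token_eq_inr.1 h
    obtain ⟨h3, h4⟩ := g.token_eq_inr.1 hz
    rcases lt_trichotomy y z with h5 | h5 | h5
    · exact absurd (h2.trans h4.symm) (g.label_strictMono h5 h3).ne
    · exact h5
    · exact absurd (h4.trans h2.symm) (g.label_strictMono h5 h1).ne

/-- The injections that encode weighted matchings. -/
abbrev Injections (rel : Y → C → Prop) (i : ℕ) : Type _ :=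
  {f : C → Y ⊕ Fin i // Function.Injective f ∧ ∀ c y, f c = Sum.inl y → y ≠ ⊥ ∧ rel y c}

/-- The injection encoding a weighted matching. -/
def toInjection (g : WeightedMatching rel i) : Injections rel i :=
  -- An unlabelled `y` has multiplicity `0`, which for `y ≠ ⊥` is permitted only if `y` is related
  -- to its partner.
  ⟨g.token ∘ g.partner.symm, g.token_injective.comp g.partner.symm.injective, fun c y h => by
    obtain ⟨h1, h2⟩ := g.token_eq_inl.1 h
    refine ⟨h2.1, ?_⟩
    by_contra h3
    refine g.mult_ne_zero y h2.1 ?_ h2.2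
    rwa [← h1, Equiv.apply_symm_apply, h1]⟩

theorem toInjection_partner (g : WeightedMatching rel i) (y : Y) :
    g.toInjection.1 (g.partner y) = g.token y := by
  simp [toInjection]

theorem range_toInjection (g : WeightedMatching rel i) :
    Set.range g.toInjection.1 = Set.range g.token :=
  g.partner.symm.surjective.range_comp g.token

/-- The range of the injection shows which elements are unlabelled and which labels occur. Labels
being increasing, the set of labels in use determines the label of each element; this gives all
tokens, hence the partners, and the multiplicities are recovered from the partial sums. -/
theorem toInjection_injective :
    Function.Injective (toInjection (rel := rel) (i := i)) := by
  intro g g' h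
  have hr : Set.range g.token = Set.range g'.token := by
    rw [← range_toInjection, ← range_toInjection, h]
  have hu : ∀ y, g.Unlabelled y ↔ g'.Unlabelled y := fun y => by
    have h1 : ∀ g : WeightedMatching rel i, g.Unlabelled y ↔ Sum.inl y ∈ Set.range g.token := fun g =>
      ⟨fun h => ⟨y, g.token_eq_inl.2 ⟨rfl, h⟩⟩, fun ⟨z, hz⟩ => (g.token_eq_inl.1 hz).2⟩
    rw [h1, h1, hr]
  have hl : ∀ y, ¬ g.Unlabelled y → g.label y = g'.label y := by
    have h1 : StrictMono fun y : {y // ¬ g.Unlabelled y} => g.label y.1 :=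
      fun y z hyz => g.label_strictMono hyz z.2
    have h2 : StrictMono fun y : {y // ¬ g.Unlabelled y} => g'.label y.1 :=
      fun y z hyz => g'.label_strictMono hyz (by rw [← hu]; exact z.2)
    have h3 : (Set.range fun y : {y // ¬ g.Unlabelled y} => g.label y.1) =
        Set.range fun y : {y // ¬ g.Unlabelled y} => g'.label y.1 := by
      have h4 : ∀ l, (Sum.inr l ∈ Set.range g.token ↔ Sum.inr l ∈ Set.range g'.token) := fun l => by
        rw [hr]
      ext l
      have h5 := h4 l
      simp only [Set.mem_range, token_eq_inr, ← hu] at h5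
      simpa using h5
    -- Two strictly increasing maps on a well-ordered set with the same range are equal.
    have h6 := (StrictMono.range_inj h1 h2).1 h3
    exact fun y hy => congrFun h6 ⟨y, hy⟩
  have ht : g.token = g'.token := by
    funext y
    by_cases hy : g.Unlabelled y
    · rw [g.token_eq_inl.2 ⟨rfl, hy⟩, g'.token_eq_inl.2 ⟨rfl, (hu y).1 hy⟩]
    · rw [g.token_eq_inr.2 ⟨hy, rfl⟩, g'.token_eq_inr.2 ⟨fun h => hy ((hu y).2 h), (hl y hy).symm⟩]
  apply ext'
  · have h1 : g.token ∘ g.partner.symm = g.token ∘ g'.partner.symm := by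
      have := congrArg Subtype.val h
      simp only [toInjection, ← ht] at this
      exact this
    have h2 := g.token_injective.comp_left h1
    rw [← Equiv.symm_symm g.partner, ← Equiv.symm_symm g'.partner]
    congr 1
    exact Equiv.coe_fn_injective h2
  · funext y
    induction y using WellFoundedLT.induction with
    | ind y ih =>
      by_cases hy : g.Unlabelled y
      · rw [hy.2, ((hu y).1 hy).2]
      · have h1 := congrArg Fin.val (hl y hy)
        rw [label_eq, label_eq, Finset.sum_congr rfl fun z hz => ih z (Finset.mem_filter.1 hz).2] at h1
        exact Nat.add_left_cancel h1

/-- The multiplicity of `y ∈ U` is the gap between `v y` and the preceding value of `v` on `U`, and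
`v ⊥` at `⊥`. It is taken as the cardinality of the interval `R y` of integers in that gap, which
avoids naming a predecessor. The bottom is excluded in the second conclusion because `v ⊥` may be
`0`. -/
theorem exists_gaps (U : Finset Y) (hbot : ⊥ ∈ U) (v : Y → ℕ)
    (hvm : ∀ y ∈ U, ∀ z ∈ U, y < z → v y < v z) (hvi : ∀ y ∈ U, v y < i) :
    ∃ μ : Y → ℕ, (∀ y ∈ U, ∑ z ∈ Finset.univ.filter (· ≤ y), μ z = v y) ∧
      (∀ y, y ≠ ⊥ → (μ y = 0 ↔ y ∉ U)) ∧ ∑ y, μ y < i := by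
  classical
  let R : Y → Finset ℕ := fun y => (Finset.range (v y)).filter fun t =>
    y ∈ U ∧ ∀ z ∈ U, z < y → v z ≤ t
  have hR : ∀ y t, t ∈ R y ↔ t < v y ∧ y ∈ U ∧ ∀ z ∈ U, z < y → v z ≤ t := fun y t => by
    simp [R]
  have hR0 : ∀ y, y ∉ U → (R y).card = 0 := fun y hy => by
    rw [Finset.card_eq_zero, Finset.eq_empty_iff_forall_notMem]
    exact fun t ht => hy ((hR y t).1 ht).2.1
  -- The intervals `R z` with `z ≤ y` partition `{0, …, v y - 1}`.
  have hsum : ∀ y ∈ U, ∑ z ∈ Finset.univ.filter (· ≤ y), (R z).card = v y := fun y hy => by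
    have hdis : ∀ z ∈ Finset.univ.filter (· ≤ y), ∀ w ∈ Finset.univ.filter (· ≤ y), z ≠ w →
        Disjoint (R z) (R w) := by
      intro z _ w _ hzw
      rw [Finset.disjoint_left]
      intro t h1 h2
      rw [hR] at h1 h2
      rcases lt_or_gt_of_ne hzw with h | h
      · exact absurd (h2.2.2 z h1.2.1 h) (not_le.2 h1.1)
      · exact absurd (h1.2.2 w h2.2.1 h) (not_le.2 h2.1)
    rw [← Finset.card_biUnion hdis]
    have : (Finset.univ.filter (· ≤ y)).biUnion R = Finset.range (v y) := by
      ext t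
      simp only [Finset.mem_biUnion, Finset.mem_filter, Finset.mem_univ, true_and, hR,
        Finset.mem_range]
      constructor
      · rintro ⟨z, hzy, htz, hz, -⟩
        rcases hzy.eq_or_lt with rfl | h
        · exact htz
        · exact htz.trans (hvm z hz y hy h)
      · intro ht
        obtain ⟨z, hz, hz'⟩ := Finset.exists_min_image (U.filter fun z => t < v z) id
          ⟨y, Finset.mem_filter.2 ⟨hy, ht⟩⟩
        rw [Finset.mem_filter] at hz
        refine ⟨z, hz' y (Finset.mem_filter.2 ⟨hy, ht⟩), hz.2, hz.1, fun w hw hlt => ?_⟩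
        by_contra h2
        exact absurd (hz' w (Finset.mem_filter.2 ⟨hw, not_le.1 h2⟩)) (not_le.2 hlt)
    rw [this, Finset.card_range]
  refine ⟨fun y => (R y).card, hsum, fun y hy => ⟨fun h1 h2 => ?_, hR0 y⟩, ?_⟩
  · have h3 : v y - 1 ∈ R y := by
      rw [hR]
      have h4 := hvm ⊥ hbot y h2 (bot_lt_iff_ne_bot.2 hy)
      refine ⟨by omega, h2, fun z hz hzy => ?_⟩
      have := hvm z hz y h2 hzy
      omega
    rw [Finset.card_eq_zero.1 h1] at h3
    simp at h3
  -- Nothing is added beyond the greatest element of `U`, so the total is a value of `v`.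
  · obtain ⟨y, hy, hy'⟩ := Finset.exists_max_image U id ⟨⊥, hbot⟩
    have h1 : ∑ z ∈ Finset.univ.filter (· ≤ y), (R z).card = ∑ y, (R y).card := by
      apply Finset.sum_subset (Finset.filter_subset _ _)
      intro z _ hz
      exact hR0 z fun h => hz (Finset.mem_filter.2 ⟨Finset.mem_univ _, hy' z h⟩)
    rw [← h1, hsum y hy]
    exact hvi y hy

/-- The elements that are not values of `f` have to be labelled, and they are as many as the labels
in use since `C` and `Y` have equal size. Pairing them in increasing order gives prescribed partial
sums, which `exists_gaps` turns into multiplicities. -/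
theorem toInjection_surjective [Fintype C] (hc : Fintype.card C = Fintype.card Y) :
    Function.Surjective (toInjection (rel := rel) (i := i)) := by
  classical
  rintro ⟨f, hf, hf'⟩
  -- the labelled elements and the labels in use
  let U : Finset Y := Finset.univ.filter fun y => Sum.inl y ∉ Set.range f
  let A : Finset (Fin i) := Finset.univ.filter fun l => Sum.inr l ∈ Set.range f
  have hUA : A.card = U.card := by
    have h1 : (Finset.univ.image f).card = Fintype.card C := by
      rw [Finset.card_image_of_injective _ hf, Finset.card_univ]
    have h2 : Finset.univ.image f = (Uᶜ).disjSum A := by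
      ext x
      cases x <;> simp [U, A]
    rw [h2, Finset.card_disjSum, Finset.card_compl, hc] at h1
    have := Finset.card_le_univ U
    omega
  let o : U ≃o A := (U.orderIsoOfFin rfl).symm.trans (A.orderIsoOfFin hUA)
  have hbot : ⊥ ∈ U := by
    simp only [U, Finset.mem_filter, Finset.mem_univ, true_and]
    rintro ⟨c, hc⟩
    exact (hf' c _ hc).1 rfl
  let v : Y → ℕ := fun y => if h : y ∈ U then (o ⟨y, h⟩ : Fin i) else 0
  have hv : ∀ y (h : y ∈ U), v y = (o ⟨y, h⟩ : Fin i) := fun y h => dif_pos h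
  have hvm : ∀ y ∈ U, ∀ z ∈ U, y < z → v y < v z := fun y hy z hz h => by
    rw [hv y hy, hv z hz]
    exact o.strictMono (a := ⟨y, hy⟩) (b := ⟨z, hz⟩) h
  have hvi : ∀ y ∈ U, v y < i := fun y hy => by rw [hv y hy]; exact Fin.is_lt _
  obtain ⟨μ, hsum, hzero, hi⟩ := exists_gaps U hbot v hvm hvi
  -- the token of each element
  let tok : Y → Y ⊕ Fin i := fun y => if h : y ∈ U then Sum.inr (o ⟨y, h⟩) else Sum.inl y
  have htok : ∀ y, ∃ c, f c = tok y := fun y => by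
    by_cases h : y ∈ U
    · have h1 := (o ⟨y, h⟩).2
      simp only [tok, dif_pos h]
      exact (Finset.mem_filter.1 h1).2
    · simp only [tok, dif_neg h]
      simpa [U] using h
  choose p hp using htok
  have hpi : Function.Injective p := fun y z h => by
    have h1 : tok y = tok z := by rw [← hp, ← hp, h]
    by_cases hy : y ∈ U <;> by_cases hz : z ∈ U <;> simp [tok, hy, hz] at h1 <;> exact h1
  have hpb : Function.Bijective p :=
    (Fintype.bijective_iff_injective_and_card p).2 ⟨hpi, hc.symm⟩
  let g : WeightedMatching rel i :=
    { partner := Equiv.ofBijective p hpb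
      mult := μ
      mult_ne_zero := fun y hy hrel h0 => by
        rw [hzero y hy] at h0
        apply hrel
        have h1 := hp y
        simp only [tok, dif_neg h0] at h1
        exact (hf' _ _ h1).2
      sum_lt := hi }
  have hg : ∀ y, g.token y = tok y := fun y => by
    by_cases h : y ∈ U
    · simp only [tok, dif_pos h]
      refine g.token_eq_inr.2 ⟨fun h1 => ?_, ?_⟩
      · exact (hzero y h1.1).1 h1.2 h
      · ext
        rw [← hv y h, ← hsum y h]
        rfl
    · simp only [tok, dif_neg h]
      have hne : y ≠ ⊥ := fun h0 => h (h0 ▸ hbot)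
      exact g.token_eq_inl.2 ⟨rfl, hne, (hzero y hne).2 h⟩
  refine ⟨g, Subtype.ext (funext fun c => ?_)⟩
  obtain ⟨y, rfl⟩ := hpb.2 c
  exact (g.toInjection_partner y).trans ((hg y).trans (hp y).symm)

/-- Related elements and the `i` labels form the allowed values of `c`. By `hrel` these sets
increase with `c`, so each earlier argument has used up exactly one of them. -/
theorem card_eq [Fintype C] [LinearOrder C] (hc : Fintype.card C = Fintype.card Y)
    (hrel : ∀ y c c', c ≤ c' → rel y c → rel y c') [∀ y c, Decidable (rel y c)] :
    Finite (WeightedMatching rel i) ∧ Nat.card (WeightedMatching rel i) =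
      ∏ c, ((Finset.univ.filter fun y => y ≠ ⊥ ∧ rel y c).card + i -
        (Finset.univ.filter (· < c)).card) := by
  have e := Equiv.ofBijective _ ⟨toInjection_injective (rel := rel) (i := i),
    toInjection_surjective hc⟩
  refine ⟨Finite.of_equiv _ e.symm, ?_⟩
  rw [Nat.card_congr e]
  let A : C → Finset (Y ⊕ Fin i) := fun c =>
    (Finset.univ.filter fun y => y ≠ ⊥ ∧ rel y c).disjSum Finset.univ
  have h1 := card_nested_injections_of_linearOrder A fun c c' h => by
    apply Finset.disjSum_mono_left
    intro y hy
    simp only [Finset.mem_filter, Finset.mem_univ, true_and] at hy ⊢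
    exact ⟨hy.1, hrel y c c' h hy.2⟩
  simp only [A, Finset.card_disjSum, Finset.card_univ, Fintype.card_fin] at h1
  rw [← h1]
  refine Nat.card_congr (Equiv.subtypeEquivRight fun f => and_congr Iff.rfl ?_)
  refine forall_congr' fun c => ?_
  cases f c <;> simp

end WeightedMatching

end Closure

/-! ### Closing a leaf word -/

/-- The positions of the letter `k` in the word `w`. -/
abbrev LetterPos (w : List LeafKind) (k : LeafKind) : Type := {t : Fin w.length // w.get t = k}

theorem card_letterPos_lt (w : List LeafKind) (k : LeafKind) (n : ℕ) :
    (Finset.univ.filter fun t : Fin w.length => w.get t = k ∧ (t : ℕ) < n).card =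
      (w.take n).count k := by
  induction w generalizing n with
  | nil => simp
  | cons l w ih =>
    change (Finset.univ.filter fun t : Fin (w.length + 1) => _).card = _
    rw [Fin.card_filter_univ_succ]
    cases n with
    | zero => simp
    | succ n =>
      have := ih n
      simp only [List.get_cons_zero, Fin.val_zero, Nat.zero_lt_succ, and_true, List.get_cons_succ',
        Fin.val_succ, Nat.succ_lt_succ_iff, List.take_succ_cons, List.count_cons, this, beq_iff_eq]
      split_ifs <;> rfl

theorem card_letterPos_filter (w : List LeafKind) (k : LeafKind) (n : ℕ) :
    (Finset.univ.filter fun t : LetterPos w k => (t.1 : ℕ) < n).card = (w.take n).count k := by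
  rw [← card_letterPos_lt, ← Finset.card_map (Function.Embedding.subtype _)]
  congr 1
  ext t
  simp [and_comm]

theorem card_letterPos (w : List LeafKind) (k : LeafKind) :
    Fintype.card (LetterPos w k) = w.count k := by
  have := card_letterPos_filter w k w.length
  rw [List.take_length] at this
  rw [← this, ← Finset.card_univ]
  congr 1
  ext t
  simp

/-- The opening position `y` (if it is one) comes before the closing position `c`. -/
def OpensBefore (w : List LeafKind) (y : WithBot (LetterPos w LeafKind.opening))
    (c : LetterPos w LeafKind.closing) : Prop :=
  ∀ x : LetterPos w LeafKind.opening, y = x → x.1 < c.1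

/-- The ways of matching the opening leaves of a word and the root leaf (which is `⊥`) with the
closing leaves, and of marking the edges so obtained with multiplicities, such that all the edges
whose opening leaf comes after the closing leaf are marked. -/
abbrev LeafClosure (w : List LeafKind) (i : ℕ) : Type :=
  WeightedMatching (OpensBefore w) i

/-- Net height `-1` says that closing leaves are as many as opening leaves and root leaf together.
The factor of `c` in the general count is `i`, plus the openings before `c`, minus the closings
before `c`: the height of its down-step. -/
theorem card_leafClosure (w : List LeafKind) (hw : netHeight w = -1) (i : ℕ) :
    Finite (LeafClosure w i) ∧ Nat.card (LeafClosure w i) = heightProd w i := by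
  classical
  have hc : Fintype.card (LetterPos w LeafKind.closing) =
      Fintype.card (WithBot (LetterPos w LeafKind.opening)) := by
    rw [show Fintype.card (WithBot (LetterPos w LeafKind.opening)) = _ from Fintype.card_option,
      card_letterPos, card_letterPos]
    unfold netHeight at hw
    omega
  have h1 := WeightedMatching.card_eq (rel := OpensBefore w) (i := i) hc
    fun y c c' h hy x hx => (hy x hx).trans_le h
  refine ⟨h1.1, ?_⟩
  rw [h1.2, ← prod_closing_eq_heightProd]
  refine Finset.prod_congr rfl fun c _ => ?_
  have h2 : (Finset.univ.filter fun y => y ≠ ⊥ ∧ OpensBefore w y c) =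
      (Finset.univ.filter fun t : LetterPos w LeafKind.opening => (t.1 : ℕ) < c.1).map
        Function.Embedding.coeWithBot := by
    ext y
    induction y with
    | bot => simp
    | coe y =>
      have h1 : (y : WithBot (LetterPos w LeafKind.opening)) ≠ ⊥ ∧ OpensBefore w y c ↔
          (y.1 : ℕ) < c.1 :=
        ⟨fun h => h.2 y rfl, fun h => ⟨WithBot.coe_ne_bot, fun x hx => by
          rwa [← WithBot.coe_inj.1 hx]⟩⟩
      rw [Finset.mem_filter, h1]
      simp
  have h3 : (Finset.univ.filter (· < c)) =
      Finset.univ.filter fun t : LetterPos w LeafKind.closing => (t.1 : ℕ) < c.1 := by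
    ext t
    simp [← Subtype.coe_lt_coe]
  have h4 := congrArg Finset.card h2
  rw [Finset.card_map, card_letterPos_filter] at h4
  rw [h3, card_letterPos_filter]
  have h5 : ∀ a b : ℕ, (i : ℤ) + a - b = ((a + i : ℕ) : ℤ) - b := fun a b => by push_cast; ring
  -- `Int.toNat` of a difference of naturals is their truncated difference, so the two products
  -- agree even where a height is negative.
  rw [h5, ← h4, Int.toNat_sub]
  congr!

/-! ### Rotation around the vertices of a map -/

namespace MarkedMap

variable {m : ℕ} (M : MarkedMap m)

instance : Finite M.D := M.finite

/-- The vertex of a half-edge. -/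
abbrev vtx (h : M.D) : MapVertex M.σ := vertexOf M.σ h

/-- The colour of the vertex of a half-edge. -/
abbrev col (h : M.D) : Color := M.color (M.vtx h)

theorem vtx_eq_iff {h h' : M.D} : M.vtx h = M.vtx h' ↔ M.σ.SameCycle h h' :=
  Quotient.eq (r := Equiv.Perm.SameCycle.setoid M.σ)

theorem vtx_rot_pow (k : ℕ) (h : M.D) : M.vtx ((M.σ ^ k) h) = M.vtx h :=
  M.vtx_eq_iff.2 ⟨-k, by simp⟩

/-- In this form the powers of `M.σ` at a vertex can be computed modulo `m` with the lemmas on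
`IsCycleOn`. -/
theorem exists_finset_cycle (h : M.D) :
    ∃ s : Finset M.D, (∀ x, x ∈ s ↔ M.vtx x = M.vtx h) ∧ s.card = m ∧ M.σ.IsCycleOn s := by
  classical
  have := Fintype.ofFinite M.D
  refine ⟨Finset.univ.filter fun x => M.vtx x = M.vtx h, by simp, ?_, ?_⟩
  · have h1 := M.regular (M.vtx h)
    rw [Nat.card_eq_fintype_card, Fintype.card_subtype] at h1
    exact h1
  · constructor
    · refine ⟨fun x hx => ?_, M.σ.injective.injOn, fun x hx => ⟨M.σ.symm x, ?_, by simp⟩⟩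
      · have := M.vtx_rot_pow 1 x
        simp only [Finset.coe_filter, Finset.mem_univ, true_and, Set.mem_ofPred_eq] at hx ⊢
        rw [pow_one] at this
        rw [this, hx]
      · have := M.vtx_rot_pow 1 (M.σ.symm x)
        simp only [Finset.coe_filter, Finset.mem_univ, true_and, Set.mem_ofPred_eq] at hx ⊢
        rw [pow_one, Equiv.apply_symm_apply] at this
        rw [← this, hx]
    · intro x hx y hy
      simp only [Finset.coe_filter, Finset.mem_univ, true_and, Set.mem_ofPred_eq] at hx hy
      exact M.vtx_eq_iff.1 (hx.trans hy.symm)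

theorem exists_rot_pow {h h' : M.D} (hh : M.vtx h' = M.vtx h) : ∃ k < m, (M.σ ^ k) h = h' := by
  obtain ⟨s, h1, h2, h3⟩ := M.exists_finset_cycle h
  obtain ⟨k, hk, hk'⟩ := h3.exists_pow_eq ((h1 h).2 rfl) ((h1 h').2 hh)
  exact ⟨k, hk.trans_eq h2, hk'⟩

theorem rot_pow_self (h : M.D) : (M.σ ^ m) h = h := by
  obtain ⟨s, h1, h2, h3⟩ := M.exists_finset_cycle h
  exact (h3.pow_apply_eq ((h1 h).2 rfl)).2 (dvd_of_eq h2)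

theorem rot_pow_mod (k : ℕ) (h : M.D) : (M.σ ^ (k % m)) h = (M.σ ^ k) h := by
  obtain ⟨s, h1, h2, h3⟩ := M.exists_finset_cycle h
  refine (h3.pow_apply_eq_pow_apply ((h1 h).2 rfl)).2 ?_
  rw [h2]
  exact Nat.mod_modEq k m

theorem rot_pow_injective {h : M.D} {k l : ℕ} (hk : k < m) (hl : l < m)
    (hh : (M.σ ^ k) h = (M.σ ^ l) h) : k = l := by
  obtain ⟨s, h1, h2, h3⟩ := M.exists_finset_cycle h
  have := (h3.pow_apply_eq_pow_apply ((h1 h).2 rfl)).1 hh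
  rw [h2] at this
  exact Nat.ModEq.eq_of_lt_of_lt this hk hl

theorem col_opp (h : M.D) : M.col (M.opp h) = (M.col h).other := M.bipartite h

theorem opp_injective : Function.Injective M.opp := M.opp.injective

/-- The half-edge at the end of the `(a + 1)`-st edge after `h` clockwise. -/
def blackHalf (h : M.D) (a : ℕ) : M.D := M.opp ((M.σ ^ (a + 1)) h)

/-- The half-edge opposite to the `(j + 1)`-st one after `M.blackHalf h a` clockwise. -/
def childHalf (h : M.D) (a j : ℕ) : M.D := M.opp ((M.σ ^ (j + 1)) (M.blackHalf h a))

end MarkedMap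

theorem Color.eq_white_or_black (c : Color) : c = Color.white ∨ c = Color.black := by
  cases c <;> simp

/-! ### Labels for the half-edges of a tree -/

/-- A half-edge of a tree of white-black pairs: the path from the root to its pair, the colour of its
vertex, and its rank in clockwise order around its vertex, counted from the half-edge of the parent
edge. -/
abbrev HalfLabel (m : ℕ) : Type := List (Fin (m - 1)) × Color × ℕ

namespace PairTree

variable {m : ℕ}

/-- There is a pair at the end of the path. -/
def Occurs : PairTree m → List (Fin (m - 1)) → Prop
  | closing, _ => False
  | node _ _, [] => True
  | node _ child, j :: p => Occurs (child j) p

/-- The position of the black child in the pair at the end of the path. -/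
def branch : PairTree m → List (Fin (m - 1)) → ℕ
  | closing, _ => 0
  | node a _, [] => a
  | node _ child, j :: p => branch (child j) p

theorem occurs_of_append {T : PairTree m} {p q : List (Fin (m - 1))} (h : T.Occurs (p ++ q)) :
    T.Occurs p := by
  induction p generalizing T with
  | nil =>
    cases T with
    | closing => exact h
    | node a child => trivial
  | cons j p ih =>
    cases T with
    | closing => exact h
    | node a child => exact ih h

theorem branch_lt {T : PairTree m} {p : List (Fin (m - 1))} (h : T.Occurs p) :
    T.branch p < m - 1 := by
  induction p generalizing T with
  | nil =>
    cases T with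
    | closing => exact h.elim
    | node a child => exact a.2
  | cons j p ih =>
    cases T with
    | closing => exact h.elim
    | node a child => exact ih h

/-- The half-edges of a tree. -/
def halves (T : PairTree m) : Set (HalfLabel m) := {x | T.Occurs x.1 ∧ x.2.2 < m}

theorem mem_halves {T : PairTree m} {x : HalfLabel m} :
    x ∈ T.halves ↔ T.Occurs x.1 ∧ x.2.2 < m := Iff.rfl

/-- The label of a half-edge of the `j`-th subtree as a half-edge of the tree. -/
def push (j : Fin (m - 1)) (x : HalfLabel m) : HalfLabel m := (j :: x.1, x.2)

/-- The label of a leaf of the `j`-th subtree as a leaf of the tree; a subtree that is a closing leaf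
has no proper label for it. -/
def pushLeaf (j : Fin (m - 1)) : Option (HalfLabel m) → Option (HalfLabel m)
  | none => some ([], Color.black, j + 1)
  | some x => some (push j x)

/-- The leaves in clockwise order. -/
def leafLabels : PairTree m → List (Option (HalfLabel m))
  | closing => [none]
  | node a child =>
      (List.range a).map (fun k => some ([], Color.white, k + 1)) ++
        (List.ofFn fun j => (leafLabels (child j)).map (pushLeaf j)).flatten ++
        -- Rank `0` is the parent edge and rank `a + 1` leads to the black child, so the last
        -- opening leaves have ranks `a + 2, …, m - 1`.
        (List.range (m - 2 - a)).map fun k : ℕ => some ([], Color.white, (a : ℕ) + 2 + k)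

/-- The kind of the leaf with a given label. -/
def labelKind : Option (HalfLabel m) → LeafKind
  | some (_, Color.white, _) => LeafKind.opening
  | _ => LeafKind.closing

theorem labelKind_pushLeaf (j : Fin (m - 1)) (o : Option (HalfLabel m)) :
    labelKind (pushLeaf j o) = labelKind o := by
  rcases o with _ | ⟨p, c, k⟩
  · rfl
  · cases c <;> rfl

theorem map_labelKind_leafLabels (T : PairTree m) : T.leafLabels.map labelKind = T.word := by
  induction T with
  | closing => rfl
  | node a child ih =>
    rw [leafLabels, word, List.map_append, List.map_append, List.map_flatten, List.map_ofFn]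
    congr 1
    · congr 1
      · rw [List.map_map]
        exact (List.map_const' ..).trans (by simp)
      · congr 2
        funext j
        simp only [Function.comp, List.map_map]
        rw [← ih j]
        exact List.map_congr_left fun o _ => labelKind_pushLeaf j o
    · rw [List.map_map]
      exact (List.map_const' ..).trans (by simp)

/-- The label is that of a leaf other than the root leaf. -/
def IsLeafLabel (T : PairTree m) (x : HalfLabel m) : Prop :=
  T.Occurs x.1 ∧ match x.2.1 with
    | Color.white => 1 ≤ x.2.2 ∧ x.2.2 < m ∧ x.2.2 ≠ T.branch x.1 + 1
    | Color.black => ∃ j : Fin (m - 1), x.2.2 = j + 1 ∧ ¬ T.Occurs (x.1 ++ [j])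

theorem none_mem_leafLabels {T : PairTree m} : none ∈ T.leafLabels ↔ T = closing := by
  cases T with
  | closing => simp [leafLabels]
  | node a child =>
    simp only [leafLabels, List.mem_append, List.mem_map, List.mem_flatten, List.mem_ofFn, reduceCtorEq,
      iff_false, and_false, exists_false, false_or, or_false]
    rintro ⟨l, ⟨j, rfl⟩, h⟩
    rw [List.mem_map] at h
    obtain ⟨o, -, ho⟩ := h
    cases o <;> simp [pushLeaf] at ho

theorem occurs_nil_iff {T : PairTree m} : T.Occurs [] ↔ T ≠ closing := by
  cases T <;> simp [Occurs]

/-- This translates the recursive list into a condition on paths and ranks. A closing-leaf child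
enters with a label at its parent, so the empty path collects both the opening leaves of the root
pair and its childless black positions. -/
theorem some_mem_leafLabels {T : PairTree m} {x : HalfLabel m} :
    some x ∈ T.leafLabels ↔ T.IsLeafLabel x := by
  induction T generalizing x with
  | closing => simp [leafLabels, IsLeafLabel, Occurs]
  | node a child ih =>
    obtain ⟨p, c, k⟩ := x
    have ha := a.2
    simp only [leafLabels, List.mem_append, List.mem_map, List.mem_flatten, List.mem_ofFn,
      List.mem_range, Option.some.injEq]
    cases p with
    | nil =>
      have h1 : ∀ j : Fin (m - 1), some (([] : List (Fin (m - 1))), c, k) ∈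
          (leafLabels (child j)).map (pushLeaf j) ↔
          child j = closing ∧ c = Color.black ∧ k = j + 1 := fun j => by
        rw [List.mem_map]
        constructor
        · rintro ⟨o, ho, h⟩
          cases o with
          | none =>
            simp only [pushLeaf, Option.some.injEq, Prod.mk.injEq, true_and] at h
            exact ⟨none_mem_leafLabels.1 ho, h.1.symm, h.2.symm⟩
          | some y => simp [pushLeaf, push] at h
        · rintro ⟨h1, rfl, rfl⟩
          exact ⟨none, none_mem_leafLabels.2 h1, rfl⟩
      have h2 : (∃ l, (∃ j : Fin (m - 1), (leafLabels (child j)).map (pushLeaf j) = l) ∧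
          some (([] : List (Fin (m - 1))), c, k) ∈ l) ↔
          ∃ j, child j = closing ∧ c = Color.black ∧ k = j + 1 := by
        constructor
        · rintro ⟨l, ⟨j, rfl⟩, h⟩
          exact ⟨j, (h1 j).1 h⟩
        · rintro ⟨j, h⟩
          exact ⟨_, ⟨j, rfl⟩, (h1 j).2 h⟩
      rw [h2]
      cases c with
      | white =>
        simp only [IsLeafLabel, Occurs, branch, Prod.mk.injEq, true_and, reduceCtorEq, false_and,
          and_false, exists_false, or_false]
        constructor
        · rintro (⟨l, h, rfl⟩ | ⟨l, h, rfl⟩) <;> omega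
        · rintro ⟨h3, h4, h5⟩
          rcases lt_or_ge k (a + 1) with h6 | h6
          · exact Or.inl ⟨k - 1, by omega, by omega⟩
          · exact Or.inr ⟨k - a - 2, by omega, by omega⟩
      | black =>
        simp only [IsLeafLabel, Occurs, Prod.mk.injEq, true_and, reduceCtorEq, false_and, and_false,
          exists_false, or_false, false_or, List.nil_append]
        refine exists_congr fun j => ?_
        rw [occurs_nil_iff, not_not, and_comm]
    | cons j p =>
      have h1 : ∀ j' : Fin (m - 1), some (j :: p, c, k) ∈
          (leafLabels (child j')).map (pushLeaf j') ↔
          j' = j ∧ IsLeafLabel (child j') (p, c, k) := fun j' => by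
        rw [List.mem_map]
        constructor
        · rintro ⟨o, ho, h⟩
          cases o with
          | none => simp [pushLeaf] at h
          | some y =>
            obtain ⟨p', c', k'⟩ := y
            simp only [pushLeaf, push, Option.some.injEq, Prod.mk.injEq, List.cons.injEq] at h
            obtain ⟨⟨rfl, rfl⟩, rfl, rfl⟩ := h
            exact ⟨rfl, (ih _).1 ho⟩
        · rintro ⟨rfl, h⟩
          exact ⟨some (p, c, k), (ih _).2 h, rfl⟩
      have h2 : (∃ l, (∃ j' : Fin (m - 1), (leafLabels (child j')).map (pushLeaf j') = l) ∧
          some (j :: p, c, k) ∈ l) ↔ IsLeafLabel (child j) (p, c, k) := by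
        constructor
        · rintro ⟨l, ⟨j', rfl⟩, h⟩
          obtain ⟨rfl, h'⟩ := (h1 j').1 h
          exact h'
        · intro h
          exact ⟨_, ⟨j, rfl⟩, (h1 j).2 ⟨rfl, h⟩⟩
      rw [h2]
      simp only [Prod.mk.injEq, reduceCtorEq, false_and, and_false, exists_false, or_false, false_or]
      rfl

theorem push_injective (j : Fin (m - 1)) : Function.Injective (push j) := by
  rintro ⟨p, c, k⟩ ⟨p', c', k'⟩ h
  simpa [push] using h

theorem pushLeaf_injective (j : Fin (m - 1)) : Function.Injective (pushLeaf j) := by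
  rintro (_ | x) (_ | y) h
  · rfl
  · simp [pushLeaf, push] at h
  · simp [pushLeaf, push] at h
  · rw [push_injective j (Option.some.inj h)]

theorem pushLeaf_ne {j j' : Fin (m - 1)} (h : j ≠ j') (o o' : Option (HalfLabel m)) :
    pushLeaf j o ≠ pushLeaf j' o' := by
  intro hh
  rcases o with _ | x <;> rcases o' with _ | y <;> simp [pushLeaf, push] at hh
  · exact h (Fin.ext hh)
  · exact h hh.1.1

theorem pushLeaf_ne_white (j : Fin (m - 1)) (o : Option (HalfLabel m)) (k : ℕ) :
    pushLeaf j o ≠ some ([], Color.white, k) := by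
  rcases o with _ | x <;> simp [pushLeaf, push]

theorem nodup_leafLabels (T : PairTree m) : T.leafLabels.Nodup := by
  induction T with
  | closing => simp [leafLabels]
  | node a child ih =>
    rw [leafLabels, List.nodup_append, List.nodup_append]
    have hflat : ∀ x k, x ∈ (List.ofFn fun j => (leafLabels (child j)).map (pushLeaf j)).flatten →
        x ≠ some ([], Color.white, k) := by
      intro x k hx
      rw [List.mem_flatten] at hx
      obtain ⟨l, hl, hx⟩ := hx
      obtain ⟨j, rfl⟩ := (List.mem_ofFn' _ _).1 hl
      obtain ⟨o, -, rfl⟩ := List.mem_map.1 hx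
      exact pushLeaf_ne_white j o k
    refine ⟨⟨?_, ?_, ?_⟩, ?_, ?_⟩
    · exact List.nodup_range.map fun k l h => by simpa using h
    · rw [List.nodup_flatten]
      constructor
      · intro l hl
        obtain ⟨j, rfl⟩ := (List.mem_ofFn' _ _).1 hl
        exact (ih j).map (pushLeaf_injective j)
      · rw [List.pairwise_ofFn]
        intro j j' h
        rw [List.disjoint_left]
        intro x hx hx'
        obtain ⟨o, -, rfl⟩ := List.mem_map.1 hx
        obtain ⟨o', -, h'⟩ := List.mem_map.1 hx'
        exact pushLeaf_ne h.ne' _ _ h'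
    · intro x hx y hy hxy
      obtain ⟨k, -, rfl⟩ := List.mem_map.1 hx
      exact hflat y _ hy hxy.symm
    · exact List.nodup_range.map fun k l h => by simpa using h
    · intro x hx y hy hxy
      obtain ⟨k, -, rfl⟩ := List.mem_map.1 hy
      rcases List.mem_append.1 hx with hx | hx
      · obtain ⟨l, hl, rfl⟩ := List.mem_map.1 hx
        rw [List.mem_range] at hl
        simp at hxy
        omega
      · exact hflat x _ hx hxy

end PairTree

/-! ### Placing a tree in a map -/

namespace MarkedMap

open PairTree

variable {m : ℕ} (M : MarkedMap m)

/-- The half-edge of rank `0` at a vertex of the tree placed at `h`. -/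
def base : PairTree m → M.D → List (Fin (m - 1)) → Color → M.D
  | closing, h, _, _ => h
  | node _ _, h, [], Color.white => h
  | node a _, h, [], Color.black => M.blackHalf h a
  | node a child, h, j :: p, c => base (child j) (M.childHalf h a j) p c

/-- The half-edge with a given label, when the tree is placed at `h`. -/
def place (T : PairTree m) (h : M.D) (x : HalfLabel m) : M.D :=
  (M.σ ^ x.2.2) (M.base T h x.1 x.2.1)

/-- The half-edge of a given leaf, when the tree is placed at `h`. -/
def placeLeaf (T : PairTree m) (h : M.D) : Option (HalfLabel m) → M.D
  -- The half-edge `h` is at the far end of the parent edge, whereas a closing leaf belongs to the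
  -- black vertex at its near end.
  | none => M.opp h
  | some x => M.place T h x

/-- The half-edges of the leaves, in clockwise order. -/
def leafList (T : PairTree m) (h : M.D) : List M.D := T.leafLabels.map (M.placeLeaf T h)

theorem placeLeaf_pushLeaf (a : Fin (m - 1)) (child : Fin (m - 1) → PairTree m) (h : M.D)
    (j : Fin (m - 1)) (o : Option (HalfLabel m)) :
    M.placeLeaf (node a child) h (pushLeaf j o) = M.placeLeaf (child j) (M.childHalf h a j) o := by
  cases o with
  | none => exact (M.opp_opp _).symm
  | some x => rfl

theorem leafList_closing (h : M.D) : M.leafList closing h = [M.opp h] := rfl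

theorem leafList_node (a : Fin (m - 1)) (child : Fin (m - 1) → PairTree m) (h : M.D) :
    M.leafList (node a child) h =
      (List.range a).map (fun k => (M.σ ^ (k + 1)) h) ++
        (List.ofFn fun j => M.leafList (child j) (M.childHalf h a j)).flatten ++
        (List.range (m - 2 - a)).map fun k => (M.σ ^ (a + 2 + k)) h := by
  rw [leafList, leafLabels, List.map_append, List.map_append, List.map_flatten, List.map_ofFn,
    List.map_map, List.map_map]
  congr 4
  funext j
  simp only [Function.comp, List.map_map, leafList]
  exact List.map_congr_left fun o _ => M.placeLeaf_pushLeaf a child h j o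

/-- `base` recurses from the front of the path; this lemma and `base_append_singleton` describe the
last step instead, as needed to follow the edges of the tree. -/
theorem base_black {T : PairTree m} {h : M.D} {p : List (Fin (m - 1))} (hp : T.Occurs p) :
    M.base T h p Color.black = M.opp ((M.σ ^ (T.branch p + 1)) (M.base T h p Color.white)) := by
  induction p generalizing T h with
  | nil =>
    cases T with
    | closing => exact hp.elim
    | node a child => rfl
  | cons j p ih =>
    cases T with
    | closing => exact hp.elim
    | node a child => exact ih hp

theorem base_append_singleton {T : PairTree m} {h : M.D} {p : List (Fin (m - 1))} {j : Fin (m - 1)}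
    (hp : T.Occurs (p ++ [j])) :
    M.base T h (p ++ [j]) Color.white = M.opp ((M.σ ^ (j + 1 : ℕ)) (M.base T h p Color.black)) := by
  induction p generalizing T h with
  | nil =>
    cases T with
    | closing => exact hp.elim
    | node a child =>
      cases hc : child j with
      | closing => simp [Occurs, hc] at hp
      | node a' child' => simp only [base, hc, List.nil_append]; rfl
  | cons j' p ih =>
    cases T with
    | closing => exact hp.elim
    | node a child => exact ih hp

theorem vtx_place (T : PairTree m) (h : M.D) (x : HalfLabel m) :
    M.vtx (M.place T h x) = M.vtx (M.base T h x.1 x.2.1) := M.vtx_rot_pow _ _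

theorem col_blackHalf {h : M.D} (hh : M.col h = Color.white) (a : ℕ) :
    M.col (M.blackHalf h a) = Color.black := by
  rw [blackHalf, col_opp, col, vtx_rot_pow, ← col, hh]
  rfl

theorem col_childHalf {h : M.D} (hh : M.col h = Color.white) (a j : ℕ) :
    M.col (M.childHalf h a j) = Color.white := by
  rw [childHalf, col_opp, col, vtx_rot_pow, ← col, M.col_blackHalf hh]
  rfl

theorem col_base {T : PairTree m} {h : M.D} (hh : M.col h = Color.white)
    {p : List (Fin (m - 1))} (hp : T.Occurs p) (c : Color) : M.col (M.base T h p c) = c := by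
  induction p generalizing T h with
  | nil =>
    cases T with
    | closing => exact hp.elim
    | node a child =>
      cases c with
      | white => exact hh
      | black => exact M.col_blackHalf hh a
  | cons j p ih =>
    cases T with
    | closing => exact hp.elim
    | node a child => exact ih (M.col_childHalf hh a j) hp

theorem col_place {T : PairTree m} {h : M.D} (hh : M.col h = Color.white)
    {x : HalfLabel m} (hp : T.Occurs x.1) : M.col (M.place T h x) = x.2.1 := by
  rw [col, vtx_place, ← col, M.col_base hh hp]

end MarkedMap

/-! ### Regions of a bipartite graph that are accessible to a vertex -/

section Region

variable {V : Type*} (adj : V → V → Prop)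

open Classical in
/-- The vertices of `C` adjacent to some vertex of `A`. -/
noncomputable def neighbours (A C : Finset V) : Finset V := C.filter fun b => ∃ w ∈ A, adj w b

variable {adj}

theorem mem_neighbours {A C : Finset V} {b : V} :
    b ∈ neighbours adj A C ↔ b ∈ C ∧ ∃ w ∈ A, adj w b := by
  classical
  simp [neighbours]

variable (adj) in
/-- The sets `S` and `C` of white and of black vertices satisfy Hall's condition, strictly for the
sets of white vertices that avoid the root `w`. -/
structure IsRegion (S C : Finset V) (w : V) : Prop where
  mem : w ∈ S
  card_eq : S.card = C.card
  exists_adj : ∃ b ∈ C, adj w b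
  hall : ∀ A ⊆ S, A.Nonempty → w ∉ A → A.card < (neighbours adj A C).card

/-- A region hanging from a further black vertex, whose half-edges lead to the white vertices `o j`
(if any), can be cut into regions rooted at some of these vertices, in such a way that no vertex of
a region is adjacent to a vertex of an earlier one. -/
theorem exists_regions {k : ℕ} (o : Fin k → Option V) (S C : Finset V) (hcard : S.card = C.card)
    (hall : ∀ A ⊆ S, A.Nonempty → A.card ≤ (neighbours adj A C).card ∧
      ((∀ j w, o j = some w → w ∉ A) → A.card < (neighbours adj A C).card)) :
    ∃ A D : Fin k → Finset V,
      (∀ v, v ∈ S ↔ ∃ j, v ∈ A j) ∧ (∀ v, v ∈ C ↔ ∃ j, v ∈ D j) ∧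
      (∀ j j', j ≠ j' → Disjoint (A j) (A j')) ∧ (∀ j j', j ≠ j' → Disjoint (D j) (D j')) ∧
      (∀ j, (A j = ∅ ∧ D j = ∅ ∧ ∀ w, o j = some w → ∀ j', j ≤ j' → w ∉ A j') ∨
        ∃ w, o j = some w ∧ IsRegion adj (A j) (D j) w) ∧
      ∀ j j', j < j' → ∀ w ∈ A j', ∀ b ∈ D j, ¬ adj w b := by
  classical
  induction k generalizing S C with
  | zero =>
    -- With no possible root left, the strict condition would hold for `S` itself and contradict
    -- `S.card = C.card`.
    have hS : S = ∅ := by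
      by_contra h
      have h1 := (hall S subset_rfl (Finset.nonempty_iff_ne_empty.2 h)).2 fun j => j.elim0
      have h2 : (neighbours adj S C).card ≤ C.card :=
        Finset.card_le_card fun b hb => (mem_neighbours.1 hb).1
      omega
    subst hS
    have hC : C = ∅ := Finset.card_eq_zero.1 (hcard.symm.trans Finset.card_empty)
    subst hC
    exact ⟨fun j => j.elim0, fun j => j.elim0, by simp, by simp, fun j => j.elim0, fun j => j.elim0,
      fun j => j.elim0, fun j => j.elim0⟩
  | succ k ih =>
    by_cases h0 : ∃ w, o 0 = some w ∧ w ∈ S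
    · obtain ⟨w, hw, hwS⟩ := h0
      have hweak : ∀ A ⊆ S, A.card ≤ (neighbours adj A C).card := fun A hA => by
        rcases A.eq_empty_or_nonempty with rfl | h
        · simp
        · exact (hall A hA h).1
      -- `X` is a largest tight set avoiding `w`. It is left, with all its neighbours, to the later
      -- half-edges, and the first region takes the rest.
      obtain ⟨X, hX, hmax⟩ := Finset.exists_max_image
        (S.powerset.filter fun X => w ∉ X ∧ (neighbours adj X C).card = X.card) Finset.card
        ⟨∅, Finset.mem_filter.2 ⟨Finset.empty_mem_powerset S, Finset.notMem_empty w, by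
          rw [show neighbours adj ∅ C = ∅ by ext; simp [mem_neighbours]]⟩⟩
      simp only [Finset.mem_filter, Finset.mem_powerset] at hX hmax
      obtain ⟨hXS, hwX, hXc⟩ := hX
      have hNC : neighbours adj X C ⊆ C := fun b hb => (mem_neighbours.1 hb).1
      -- Neighbours of `X ∪ A` are neighbours of `X`, of which there are `X.card`, or neighbours of
      -- `A` outside that set; so Hall's inequality for `X ∪ A` descends to `A` in the remainder.
      have hunion : ∀ A : Finset V, (neighbours adj (X ∪ A) C).card ≤
          X.card + (neighbours adj A (C \ neighbours adj X C)).card := fun A => by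
        rw [← hXc]
        refine (Finset.card_le_card fun b hb => ?_).trans (Finset.card_union_le _ _)
        obtain ⟨h1, v, h2, h3⟩ := mem_neighbours.1 hb
        by_cases hbX : b ∈ neighbours adj X C
        · exact Finset.mem_union_left _ hbX
        · refine Finset.mem_union_right _ (mem_neighbours.2
            ⟨Finset.mem_sdiff.2 ⟨h1, hbX⟩, v, ?_, h3⟩)
          rcases Finset.mem_union.1 h2 with h | h
          · exact absurd (mem_neighbours.2 ⟨h1, v, h, h3⟩) hbX
          · exact h
      have hreg : IsRegion adj (S \ X) (C \ neighbours adj X C) w := by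
        refine ⟨Finset.mem_sdiff.2 ⟨hwS, hwX⟩, ?_, ?_, fun A hA hne hwA => ?_⟩
        · rw [Finset.card_sdiff_of_subset hXS, Finset.card_sdiff_of_subset hNC, hXc, hcard]
        -- The weak inequality for `X ∪ {w}` forces `w` to have a neighbour outside those of `X`.
        · have h1 := hweak (X ∪ {w})
            (Finset.union_subset hXS (Finset.singleton_subset_iff.2 hwS))
          have h2 := hunion {w}
          rw [Finset.card_union_of_disjoint (Finset.disjoint_singleton_right.2 hwX),
            Finset.card_singleton] at h1
          obtain ⟨b, hb⟩ := Finset.card_pos.1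
            (show 0 < (neighbours adj {w} (C \ neighbours adj X C)).card by omega)
          obtain ⟨h3, v, h4, h5⟩ := mem_neighbours.1 hb
          rw [Finset.mem_singleton] at h4
          subst h4
          exact ⟨b, h3, h5⟩
        · have hd : Disjoint X A := by
            rw [Finset.disjoint_left]
            exact fun v h1 h2 => (Finset.mem_sdiff.1 (hA h2)).2 h1
          have hsub : X ∪ A ⊆ S := Finset.union_subset hXS fun v hv => (Finset.mem_sdiff.1 (hA hv)).1
          have h1 := hweak (X ∪ A) hsub
          have h2 := hunion A
          -- A tight `X ∪ A` would be a larger tight set avoiding `w`; this makes the inequality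
          -- strict.
          have h3 : (neighbours adj (X ∪ A) C).card ≠ (X ∪ A).card := fun h => by
            have h4 := hmax (X ∪ A) ⟨hsub, by simp [hwX, hwA], h⟩
            rw [Finset.card_union_of_disjoint hd] at h4
            have := Finset.card_pos.2 hne
            omega
          rw [Finset.card_union_of_disjoint hd] at h1 h3
          omega
      -- Since `X` avoids `w`, a subset of `X` avoiding the remaining roots avoids all of them, so
      -- the hypothesis survives for the remaining half-edges.
      obtain ⟨A, D, h1, h2, h3, h4, h5, h6⟩ := ih (fun j => o j.succ) X (neighbours adj X C)
        hXc.symm fun A hA hne => by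
          have h7 : neighbours adj A (neighbours adj X C) = neighbours adj A C := by
            ext b
            simp only [mem_neighbours]
            exact ⟨fun h => ⟨h.1.1, h.2⟩, fun h =>
              ⟨⟨h.1, h.2.imp fun v hv => ⟨hA hv.1, hv.2⟩⟩, h.2⟩⟩
          rw [h7]
          refine ⟨hweak A (hA.trans hXS), fun h => (hall A (hA.trans hXS) hne).2 fun j => ?_⟩
          refine Fin.cases (fun v hv => ?_) (fun j => h j) j
          rw [hw] at hv
          cases hv
          exact fun hwA => hwX (hA hwA)
      have hAX : ∀ j, A j ⊆ X := fun j v hv => (h1 v).2 ⟨j, hv⟩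
      have hDX : ∀ j, D j ⊆ neighbours adj X C := fun j v hv => (h2 v).2 ⟨j, hv⟩
      refine ⟨Fin.cons (S \ X) A, Fin.cons (C \ neighbours adj X C) D, fun v => ?_, fun v => ?_,
        ?_, ?_, ?_, ?_⟩
      · rw [Fin.exists_fin_succ]
        simp only [Fin.cons_zero, Fin.cons_succ, ← h1, Finset.mem_sdiff]
        by_cases hv : v ∈ X
        · simp [hv, hXS hv]
        · simp [hv]
      · rw [Fin.exists_fin_succ]
        simp only [Fin.cons_zero, Fin.cons_succ, ← h2, Finset.mem_sdiff]
        by_cases hv : v ∈ neighbours adj X C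
        · simp [hv, hNC hv]
        · simp [hv]
      · intro j j'
        refine Fin.cases ?_ (fun j => ?_) j <;> refine Fin.cases ?_ (fun j' => ?_) j' <;> intro h
        · exact absurd rfl h
        · exact Finset.sdiff_disjoint.mono_right (hAX j')
        · exact (Finset.sdiff_disjoint.mono_right (hAX j)).symm
        · exact h3 j j' fun hh => h (congrArg Fin.succ hh)
      · intro j j'
        refine Fin.cases ?_ (fun j => ?_) j <;> refine Fin.cases ?_ (fun j' => ?_) j' <;> intro h
        · exact absurd rfl h
        · exact Finset.sdiff_disjoint.mono_right (hDX j')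
        · exact (Finset.sdiff_disjoint.mono_right (hDX j)).symm
        · exact h4 j j' fun hh => h (congrArg Fin.succ hh)
      · refine Fin.cases (Or.inr ⟨w, hw, hreg⟩) fun j => ?_
        refine (h5 j).imp (fun h => ⟨h.1, h.2.1, fun v hv j' => ?_⟩) id
        refine Fin.cases (fun hj => ?_) (fun j' hj => ?_) j'
        · exact absurd hj (not_le.2 (Fin.succ_pos j))
        · exact h.2.2 v hv j' (Fin.succ_le_succ_iff.1 hj)
      · intro j j'
        refine Fin.cases (fun h => absurd h (Fin.not_lt_zero _)) (fun j' => ?_) j'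
        refine Fin.cases (fun _ v hv b hb hvb => ?_) (fun j h => ?_) j
        -- All neighbours of `X` were withheld from the first region, so no later white vertex is
        -- adjacent to it.
        · have h7 := Finset.mem_sdiff.1 hb
          exact h7.2 (mem_neighbours.2 ⟨h7.1, v, hAX j' hv, hvb⟩)
        · exact h6 j j' (Fin.succ_lt_succ_iff.1 h)
    -- The first half-edge leads to no available vertex: its region is empty and the others share
    -- everything.
    · obtain ⟨A, D, h1, h2, h3, h4, h5, h6⟩ := ih (fun j => o j.succ) S C hcard fun A hA hne =>
        ⟨(hall A hA hne).1, fun h => (hall A hA hne).2 fun j => by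
          refine Fin.cases (fun v hv hvA => h0 ⟨v, hv, hA hvA⟩) (fun j => h j) j⟩
      refine ⟨Fin.cons ∅ A, Fin.cons ∅ D, fun v => ?_, fun v => ?_, ?_, ?_, ?_, ?_⟩
      · rw [Fin.exists_fin_succ]
        simp [← h1]
      · rw [Fin.exists_fin_succ]
        simp [← h2]
      · intro j j'
        refine Fin.cases ?_ (fun j => ?_) j <;> refine Fin.cases ?_ (fun j' => ?_) j' <;> intro h
        · exact absurd rfl h
        · exact Finset.disjoint_empty_left _
        · exact Finset.disjoint_empty_right _
        · exact h3 j j' fun hh => h (congrArg Fin.succ hh)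
      · intro j j'
        refine Fin.cases ?_ (fun j => ?_) j <;> refine Fin.cases ?_ (fun j' => ?_) j' <;> intro h
        · exact absurd rfl h
        · exact Finset.disjoint_empty_left _
        · exact Finset.disjoint_empty_right _
        · exact h4 j j' fun hh => h (congrArg Fin.succ hh)
      · refine Fin.cases (Or.inl ⟨rfl, rfl, fun v hv j' => ?_⟩) fun j => ?_
        · refine Fin.cases (fun _ => ?_) (fun j' _ hv' => ?_) j'
          · simp
          · exact h0 ⟨v, hv, (h1 v).2 ⟨j', hv'⟩⟩
        · refine (h5 j).imp (fun h => ⟨h.1, h.2.1, fun v hv j' => ?_⟩) id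
          refine Fin.cases (fun hj => ?_) (fun j' hj => ?_) j'
          · exact absurd hj (not_le.2 (Fin.succ_pos j))
          · exact h.2.2 v hv j' (Fin.succ_le_succ_iff.1 hj)
      · intro j j'
        refine Fin.cases (fun h => absurd h (Fin.not_lt_zero _)) (fun j' => ?_) j'
        refine Fin.cases (fun _ v hv b hb => ?_) (fun j h => ?_) j
        · simp at hb
        · exact h6 j j' (Fin.succ_lt_succ_iff.1 h)

end Region

/-! ### Existence of a tree that explores a region of a map -/

namespace PairTree

variable {m : ℕ}

theorem IsLeafLabel.mem_halves {T : PairTree m} {x : HalfLabel m} (h : T.IsLeafLabel x) :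
    x ∈ T.halves := by
  obtain ⟨p, c, k⟩ := x
  cases c with
  | white => exact ⟨h.1, h.2.2.1⟩
  | black =>
    obtain ⟨h1, j, h2, -⟩ := h
    refine ⟨h1, ?_⟩
    dsimp only at h2 ⊢
    omega

end PairTree

namespace MarkedMap

open PairTree

variable {m : ℕ} (M : MarkedMap m)

/-- White and black vertices joined by an unmarked edge. -/
def Adj (v b : MapVertex M.σ) : Prop :=
  ∃ x, M.col x = Color.white ∧ M.vtx x = v ∧ M.vtx (M.opp x) = b ∧ M.mult x = 0

/-- If `y` is opposite to the white half-edge `x`, then `x` is marked. -/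
def MarkedPair (y x : M.D) : Prop := M.opp x = y → M.col x = Color.white → M.mult x ≠ 0

/-- The tree, placed at `h`, explores the white vertices in `S` and the black ones in `C` along
unmarked edges, meeting the unmarked edges that it cuts first at their white end. -/
structure Explores (T : PairTree m) (h : M.D) (S C : Set (MapVertex M.σ)) : Prop where
  bijOn : Set.BijOn (M.place T h) T.halves {x | M.vtx x ∈ S ∪ C}
  unmarked_pair : ∀ p, T.Occurs p →
    M.mult ((M.σ ^ (T.branch p + 1)) (M.base T h p Color.white)) = 0
  unmarked_child : ∀ p j, T.Occurs (p ++ [j]) → M.mult (M.base T h (p ++ [j]) Color.white) = 0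
  pairwise : (M.leafList T h).Pairwise M.MarkedPair

variable {M}

theorem mem_leafList {T : PairTree m} {h x : M.D} (hx : x ∈ M.leafList T h) :
    (T = closing ∧ x = M.opp h) ∨ ∃ l, T.IsLeafLabel l ∧ x = M.place T h l := by
  obtain ⟨o, ho, rfl⟩ := List.mem_map.1 hx
  cases o with
  | none => exact Or.inl ⟨none_mem_leafLabels.1 ho, rfl⟩
  | some l => exact Or.inr ⟨l, some_mem_leafLabels.1 ho, rfl⟩

theorem place_mem_leafList {T : PairTree m} {l : HalfLabel m} (hl : T.IsLeafLabel l) (h : M.D) :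
    M.place T h l ∈ M.leafList T h :=
  List.mem_map.2 ⟨some l, some_mem_leafLabels.2 hl, rfl⟩

theorem Explores.mem_leafList {T : PairTree m} {h x : M.D} {S C : Set (MapVertex M.σ)}
    (hT : M.Explores T h S C) (hx : x ∈ M.leafList T h) :
    (T = closing ∧ x = M.opp h) ∨ M.vtx x ∈ S ∪ C := by
  refine (MarkedMap.mem_leafList hx).imp id ?_
  rintro ⟨l, hl, rfl⟩
  exact hT.bijOn.mapsTo hl.mem_halves

theorem explores_closing (h : M.D) : M.Explores closing h ∅ ∅ where
  bijOn := by
    rw [show (closing : PairTree m).halves = ∅ from Set.eq_empty_iff_forall_notMem.2 fun x hx => hx.1,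
      show {x | M.vtx x ∈ (∅ ∪ ∅ : Set (MapVertex M.σ))} = ∅ by simp]
    exact Set.bijOn_empty _
  unmarked_pair := fun p hp => hp.elim
  unmarked_child := fun p j hp => hp.elim
  pairwise := List.pairwise_singleton _ _

theorem opp_childHalf (h : M.D) (a j : ℕ) :
    M.opp (M.childHalf h a j) = (M.σ ^ (j + 1)) (M.blackHalf h a) := M.opp_opp _

/-- Trees exploring disjoint regions can be grafted. -/
theorem explores_node {h : M.D} (hh : M.col h = Color.white) {S C : Set (MapVertex M.σ)}
    (hS : ∀ v ∈ S, M.color v = Color.white) (hC : ∀ v ∈ C, M.color v = Color.black)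
    (a : Fin (m - 1)) (child : Fin (m - 1) → PairTree m)
    (A D : Fin (m - 1) → Set (MapVertex M.σ))
    (hSA : ∀ v, v ∈ S ↔ v = M.vtx h ∨ ∃ j, v ∈ A j)
    (hCD : ∀ v, v ∈ C ↔ v = M.vtx (M.blackHalf h a) ∨ ∃ j, v ∈ D j)
    (hA : ∀ j j', j ≠ j' → Disjoint (A j) (A j')) (hD : ∀ j j', j ≠ j' → Disjoint (D j) (D j'))
    (hhA : ∀ j, M.vtx h ∉ A j) (hbD : ∀ j, M.vtx (M.blackHalf h a) ∉ D j)
    (hpair : M.mult ((M.σ ^ (a + 1 : ℕ)) h) = 0)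
    (hlast : ∀ k, (a : ℕ) + 1 < k → k < m → M.mult ((M.σ ^ k) h) = 0 →
      M.vtx (M.opp ((M.σ ^ k) h)) ∉ C)
    (hchild : ∀ j, M.Explores (child j) (M.childHalf h a j) (A j) (D j))
    (hclosing : ∀ j, child j = closing → M.mult (M.childHalf h a j) = 0 →
      ∀ j', j ≤ j' → M.vtx (M.childHalf h a j) ∉ A j')
    (hnode : ∀ j, child j ≠ closing → M.mult (M.childHalf h a j) = 0)
    (hcross : ∀ j j', j < j' → ∀ v ∈ A j', ∀ b ∈ D j, ¬ M.Adj v b) :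
    M.Explores (node a child) h S C := by
  have hb : M.col (M.blackHalf h a) = Color.black := M.col_blackHalf hh a
  have hAS : ∀ j, A j ⊆ S := fun j v hv => (hSA v).2 (Or.inr ⟨j, hv⟩)
  have hDC : ∀ j, D j ⊆ C := fun j v hv => (hCD v).2 (Or.inr ⟨j, hv⟩)
  have hhS : M.vtx h ∈ S := (hSA _).2 (Or.inl rfl)
  have hbC : M.vtx (M.blackHalf h a) ∈ C := (hCD _).2 (Or.inl rfl)
  have hSC : ∀ v, v ∈ S → v ∉ C := fun v h1 h2 => by
    have := (hS v h1).symm.trans (hC v h2)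
    cases this
  have hmaps : ∀ j x, x ∈ (child j).halves →
      M.vtx (M.place (child j) (M.childHalf h a j) x) ∈ A j ∪ D j :=
    fun j x hx => (hchild j).bijOn.mapsTo hx
  have htop : ∀ c k, M.vtx (M.place (node a child) h ([], c, k)) =
      match c with
      | Color.white => M.vtx h
      | Color.black => M.vtx (M.blackHalf h a) := fun c k => by
    cases c <;> exact M.vtx_rot_pow _ _
  have htopnot : ∀ c k j, M.vtx (M.place (node a child) h ([], c, k)) ∉ A j ∪ D j := by
    intro c k j hmem
    rw [htop] at hmem
    cases c with
    | white =>
      rcases hmem with h1 | h1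
      · exact hhA j h1
      · exact hSC _ hhS (hDC j h1)
    | black =>
      rcases hmem with h1 | h1
      · exact hSC _ (hAS j h1) hbC
      · exact hbD j h1
  have hmemleaf : ∀ j x, x ∈ M.leafList (child j) (M.childHalf h a j) →
      (child j = closing ∧ x = (M.σ ^ (j + 1 : ℕ)) (M.blackHalf h a)) ∨ M.vtx x ∈ A j ∪ D j :=
    fun j x hx => by
      refine ((hchild j).mem_leafList hx).imp (fun h1 => ⟨h1.1, ?_⟩) id
      rw [h1.2, opp_childHalf]
  -- The condition on a pair of leaves is vacuous unless the earlier one is black and the later one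
  -- white.
  have hwhite : ∀ y x, M.col y = Color.white → M.MarkedPair y x := by
    rintro y x hy rfl hx
    rw [col_opp, hx] at hy
    cases hy
  constructor
  · refine ⟨?_, ?_, ?_⟩
    · rintro ⟨_ | ⟨j, p⟩, c, k⟩ hx
      · change M.vtx _ ∈ S ∪ C
        rw [htop]
        cases c with
        | white => exact Or.inl hhS
        | black => exact Or.inr hbC
      · exact (hmaps j (p, c, k) hx).imp (fun h => hAS j h) (fun h => hDC j h)
    · rintro ⟨_ | ⟨j, p⟩, c, k⟩ hx ⟨_ | ⟨j', p'⟩, c', k'⟩ hy hxy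
      · have h1 := congrArg M.col hxy
        rw [M.col_place hh hx.1, M.col_place hh hy.1] at h1
        dsimp only at h1
        subst h1
        rw [show k = k' from M.rot_pow_injective hx.2 hy.2 hxy]
      · exact absurd (hmaps j' (p', c', k') hy) (by
          have := htopnot c k j'
          rw [hxy] at this
          exact this)
      · exact absurd (hmaps j (p, c, k) hx) (by
          have := htopnot c' k' j
          rw [← hxy] at this
          exact this)
      · have h1 := hmaps j (p, c, k) hx
        have h2 := hmaps j' (p', c', k') hy
        have hxy' : M.place (child j) (M.childHalf h a j) (p, c, k) =
          M.place (child j') (M.childHalf h a j') (p', c', k') := hxy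
        rw [hxy'] at h1
        by_cases hj : j = j'
        · subst hj
          have := (hchild j).bijOn.injOn hx hy hxy'
          simp_all
        · exfalso
          rcases h1 with h1 | h1 <;> rcases h2 with h2 | h2
          · exact Set.disjoint_left.1 (hA j j' hj) h1 h2
          · exact hSC _ (hAS j h1) (hDC j' h2)
          · exact hSC _ (hAS j' h2) (hDC j h1)
          · exact Set.disjoint_left.1 (hD j j' hj) h1 h2
    · intro x hx
      have hsub : ∀ j, M.vtx x ∈ A j ∪ D j → x ∈ M.place (node a child) h '' (node a child).halves := by
        intro j hj
        obtain ⟨l, hl, rfl⟩ := (hchild j).bijOn.surjOn hj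
        exact ⟨push j l, hl, rfl⟩
      rcases hx with hx | hx
      · rcases (hSA _).1 hx with h1 | ⟨j, h1⟩
        · obtain ⟨k, hk, rfl⟩ := M.exists_rot_pow h1
          exact ⟨([], Color.white, k), ⟨trivial, hk⟩, rfl⟩
        · exact hsub j (Or.inl h1)
      · rcases (hCD _).1 hx with h1 | ⟨j, h1⟩
        · obtain ⟨k, hk, rfl⟩ := M.exists_rot_pow h1
          exact ⟨([], Color.black, k), ⟨trivial, hk⟩, rfl⟩
        · exact hsub j (Or.inr h1)
  · rintro (_ | ⟨j, p⟩) hp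
    · exact hpair
    · exact (hchild j).unmarked_pair p hp
  · rintro (_ | ⟨j, p⟩) j' hp
    · have h1 : child j' ≠ closing := occurs_nil_iff.1 hp
      rw [M.base_append_singleton hp]
      exact hnode j' h1
    · exact (hchild j).unmarked_child p j' hp
  -- The walk meets the first opening leaves, the subtrees and the last opening leaves. The relevant
  -- pairs are those inside a subtree (`hchild`), those across two subtrees (`hclosing`, `hcross`),
  -- and those of a subtree and a last opening leaf (`hlast`).
  · rw [leafList_node, List.pairwise_append, List.pairwise_append]
    have hflat : ∀ x, x ∈ (List.ofFn fun j => M.leafList (child j) (M.childHalf h a j)).flatten →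
        ∃ j, x ∈ M.leafList (child j) (M.childHalf h a j) := by
      intro x hx
      obtain ⟨l, hl, hx⟩ := List.mem_flatten.1 hx
      obtain ⟨j, rfl⟩ := (List.mem_ofFn' _ _).1 hl
      exact ⟨j, hx⟩
    refine ⟨⟨?_, ?_, ?_⟩, ?_, ?_⟩
    · refine List.pairwise_of_forall_mem_list fun y hy x hx => ?_
      obtain ⟨k, -, rfl⟩ := List.mem_map.1 hy
      exact hwhite _ _ (by rw [col, vtx_rot_pow]; exact hh)
    · rw [List.pairwise_flatten]
      constructor
      · intro l hl
        obtain ⟨j, rfl⟩ := (List.mem_ofFn' _ _).1 hl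
        exact (hchild j).pairwise
      · rw [List.pairwise_ofFn]
        intro j j' hjj y hy x hx hxy hxw hx0
        have hxA : M.vtx x ∈ A j' := by
          rcases hmemleaf j' x hx with ⟨-, h1⟩ | h1 | h1
          · rw [h1, col, vtx_rot_pow, ← col, hb] at hxw
            cases hxw
          · exact h1
          · rw [col, hC _ (hDC j' h1)] at hxw
            cases hxw
        have hyb : M.col y = Color.black := by
          rw [← hxy, col_opp, hxw]
          rfl
        rcases hmemleaf j y hy with ⟨h1, h2⟩ | h1 | h1
        · have h3 : x = M.childHalf h a j := by
            apply M.opp_injective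
            rw [hxy, h2, opp_childHalf]
          subst h3
          exact hclosing j h1 hx0 j' hjj.le hxA
        · rw [col, hS _ (hAS j h1)] at hyb
          cases hyb
        · exact hcross j j' hjj _ hxA _ h1 ⟨x, hxw, rfl, by rw [hxy], hx0⟩
    · intro y hy x hx
      obtain ⟨k, -, rfl⟩ := List.mem_map.1 hy
      exact hwhite _ _ (by rw [col, vtx_rot_pow]; exact hh)
    · refine List.pairwise_of_forall_mem_list fun y hy x hx => ?_
      obtain ⟨k, -, rfl⟩ := List.mem_map.1 hy
      exact hwhite _ _ (by rw [col, vtx_rot_pow]; exact hh)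
    · intro y hy x hx hxy hxw hx0
      obtain ⟨k, hk, rfl⟩ := List.mem_map.1 hx
      rw [List.mem_range] at hk
      rcases List.mem_append.1 hy with hy | hy
      · obtain ⟨l, -, rfl⟩ := List.mem_map.1 hy
        exact hwhite _ _ (by rw [col, vtx_rot_pow]; exact hh) hxy hxw hx0
      · refine hlast _ (by omega) (by omega) hx0 ?_
        rw [hxy]
        obtain ⟨j, hy⟩ := hflat y hy
        rcases hmemleaf j y hy with ⟨-, h1⟩ | h1 | h1
        · rw [h1, vtx_rot_pow]
          exact hbC
        · exfalso
          have h2 := M.col_opp ((M.σ ^ ((a : ℕ) + 2 + k)) h)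
          rw [hxw, hxy, col, hS _ (hAS j h1)] at h2
          cases h2
        · exact hDC j h1

/-- A region accessible to the vertex of `h` can be explored from `h`, by a tree that goes to a black
vertex along the last unmarked edge from the vertex of `h` to the region. -/
theorem exists_explores (S C : Finset (MapVertex M.σ))
    (hS : ∀ v ∈ S, M.color v = Color.white) (hC : ∀ v ∈ C, M.color v = Color.black)
    (h : M.D) (hreg : IsRegion M.Adj S C (M.vtx h))
    (hk : ∃ k, 1 ≤ k ∧ k < m ∧ M.mult ((M.σ ^ k) h) = 0 ∧ M.vtx (M.opp ((M.σ ^ k) h)) ∈ C) :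
    ∃ a child, M.Explores (node a child) h S C ∧
      ∀ k, (a : ℕ) + 1 < k → k < m → M.mult ((M.σ ^ k) h) = 0 →
        M.vtx (M.opp ((M.σ ^ k) h)) ∉ C := by
  classical
  induction hn : S.card using Nat.strong_induction_on generalizing S C h with
  | _ n ih =>
  subst hn
  have hh : M.col h = Color.white := hS _ hreg.mem
  -- The last rank is imposed by the order condition: an unmarked edge to the region after the black
  -- child would be met at its black end first.
  obtain ⟨k, hk, hkmax⟩ := Finset.exists_max_image
    ((Finset.range m).filter fun k => 1 ≤ k ∧ M.mult ((M.σ ^ k) h) = 0 ∧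
      M.vtx (M.opp ((M.σ ^ k) h)) ∈ C) id (by
        obtain ⟨k, h1, h2, h3⟩ := hk
        exact ⟨k, Finset.mem_filter.2 ⟨Finset.mem_range.2 h2, h1, h3⟩⟩)
  simp only [Finset.mem_filter, Finset.mem_range, id] at hk hkmax
  obtain ⟨hkm, hk1, hk0, hkC⟩ := hk
  obtain ⟨a, rfl⟩ : ∃ a : Fin (m - 1), (a : ℕ) + 1 = k := ⟨⟨k - 1, by omega⟩, by simp; omega⟩
  have hlast : ∀ k, (a : ℕ) + 1 < k → k < m → M.mult ((M.σ ^ k) h) = 0 →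
      M.vtx (M.opp ((M.σ ^ k) h)) ∉ C := fun k h1 h2 h3 h4 => by
    have := hkmax k ⟨h2, by omega, h3, h4⟩
    omega
  set b := M.vtx (M.blackHalf h a) with hbdef
  have hbC : b ∈ C := hkC
  let o : Fin (m - 1) → Option (MapVertex M.σ) := fun j =>
    if M.mult (M.childHalf h a j) = 0 then some (M.vtx (M.childHalf h a j)) else none
  have ho : ∀ j v, o j = some v ↔ M.mult (M.childHalf h a j) = 0 ∧ M.vtx (M.childHalf h a j) = v := by
    intro j v
    simp only [o]
    split_ifs with h1 <;> simp [h1]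
  obtain ⟨A, D, h1, h2, h3, h4, h5, h6⟩ := exists_regions (adj := M.Adj) o (S.erase (M.vtx h))
    (C.erase b) (by rw [Finset.card_erase_of_mem hreg.mem, Finset.card_erase_of_mem hbC, hreg.card_eq])
    -- Removing `b` costs at most one neighbour, so the strict inequality of the region becomes the
    -- weak one. It stays strict if `X` contains no vertex joined to `b` by an unmarked edge, that
    -- is, none of the possible roots of children.
    (fun X hX hne => by
      have h1 := hreg.hall X (hX.trans (Finset.erase_subset _ _)) hne
        fun hw => Finset.notMem_erase _ _ (hX hw)
      have h2 : neighbours M.Adj X C ⊆ insert b (neighbours M.Adj X (C.erase b)) := fun v hv => by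
        obtain ⟨h3, h4⟩ := mem_neighbours.1 hv
        by_cases hvb : v = b
        · exact Finset.mem_insert.2 (Or.inl hvb)
        · exact Finset.mem_insert_of_mem (mem_neighbours.2 ⟨Finset.mem_erase.2 ⟨hvb, h3⟩, h4⟩)
      refine ⟨?_, fun hno => ?_⟩
      · have := (Finset.card_le_card h2).trans (Finset.card_insert_le _ _)
        omega
      · refine h1.trans_le (Finset.card_le_card fun v hv => ?_)
        rcases Finset.mem_insert.1 (h2 hv) with rfl | h3
        · exfalso
          obtain ⟨-, w, hw, y, hy1, hy2, hy3, hy4⟩ := mem_neighbours.1 hv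
          obtain ⟨k, hk, hk'⟩ := M.exists_rot_pow hy3
          have hwne : w ≠ M.vtx h := fun h5 => Finset.notMem_erase _ _ (hX (h5 ▸ hw))
          cases k with
          -- Rank `0` at `b` is the edge by which it was reached; it leads back to the vertex of
          -- `h`, which has been erased.
          | zero =>
            apply hwne
            have h5 : (M.σ ^ ((a : ℕ) + 1)) h = y := M.opp_injective hk'
            rw [← hy2, ← h5, vtx_rot_pow]
          | succ j =>
            have h5 : M.childHalf h a j = y := by
              rw [childHalf, hk', M.opp_opp]
            exact hno ⟨j, by omega⟩ w ((ho _ _).2 ⟨by rw [h5, hy4], by rw [h5, hy2]⟩) hw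
        · exact h3)
  have hAS : ∀ j, A j ⊆ S.erase (M.vtx h) := fun j v hv => (h1 v).2 ⟨j, hv⟩
  have hDC : ∀ j, D j ⊆ C.erase b := fun j v hv => (h2 v).2 ⟨j, hv⟩
  have hbD : ∀ j, b ∉ D j := fun j hj => Finset.notMem_erase _ _ (hDC j hj)
  have hchild : ∀ j : Fin (m - 1), ∃ T : PairTree m, M.Explores T (M.childHalf h a j) (A j) (D j) ∧
      (T = closing → M.mult (M.childHalf h a j) = 0 →
        ∀ j', j ≤ j' → M.vtx (M.childHalf h a j) ∉ A j') ∧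
      (T ≠ closing → M.mult (M.childHalf h a j) = 0) := by
    intro j
    rcases h5 j with ⟨hA, hD, hcl⟩ | ⟨w, hw, hr⟩
    · refine ⟨closing, ?_, fun _ h0 => hcl _ ((ho _ _).2 ⟨h0, rfl⟩), fun hne => absurd rfl hne⟩
      rw [hA, hD, Finset.coe_empty]
      exact explores_closing _
    · obtain ⟨h0, rfl⟩ := (ho _ _).1 hw
      have hlt : (A j).card < S.card := (Finset.card_le_card (hAS j)).trans_lt
        (Finset.card_erase_lt_of_mem hreg.mem)
      obtain ⟨a', ch, hex, -⟩ := ih _ hlt (A j) (D j)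
        (fun v hv => hS v (Finset.erase_subset _ _ (hAS j hv)))
        (fun v hv => hC v (Finset.erase_subset _ _ (hDC j hv))) _ hr (by
          obtain ⟨b', hb', y, hy1, hy2, hy3, hy4⟩ := hr.exists_adj
          obtain ⟨k, hk, rfl⟩ := M.exists_rot_pow hy2
          refine ⟨k, ?_, hk, hy4, by rw [hy3]; exact hb'⟩
          -- Rank `0` leads back to the parent `b`, which does not belong to `D j`; hence the rank
          -- is at least `1`, as the recursion requires.
          by_contra hk0
          obtain rfl : k = 0 := by omega
          apply hbD j
          rw [pow_zero, Equiv.Perm.coe_one, id, opp_childHalf, vtx_rot_pow] at hy3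
          rw [hbdef, hy3]
          exact hb') rfl
      exact ⟨_, hex, (fun hc => by simp at hc), fun _ => h0⟩
  choose child hc1 hc2 hc3 using hchild
  refine ⟨a, child, ?_, hlast⟩
  refine explores_node hh hS hC a child (fun j => A j) (fun j => D j) (fun v => ?_) (fun v => ?_)
    (fun j j' hj => Finset.disjoint_coe.2 (h3 j j' hj)) (fun j j' hj => Finset.disjoint_coe.2 (h4 j j' hj))
    (fun j hj => Finset.notMem_erase _ _ (hAS j hj)) hbD hk0 hlast hc1 hc2 hc3 h6
  · simp only [Finset.mem_coe, ← h1, Finset.mem_erase]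
    by_cases hv : v = M.vtx h
    · simp [hv, hreg.mem]
    · simp [hv]
  · simp only [Finset.mem_coe, ← h2, Finset.mem_erase, ← hbdef]
    by_cases hv : v = b
    · simp [hv, hbC]
    · simp [hv]

end MarkedMap

/-! ### The tree of an admissible map -/

namespace MarkedMap

open PairTree

variable {m : ℕ}

/-- The tree of pairs with root pair of rightmost type explores the whole map from its root. -/
structure IsTreeOf (hm : 3 ≤ m) (M : MarkedMap m) (child : Fin (m - 1) → PairTree m) : Prop where
  mult_black : ∀ x, M.col x = Color.black → M.mult x = 0
  explores : M.Explores (node (lastPos hm) child) M.root {v | M.color v = Color.white}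
    {v | M.color v = Color.black}

/-! ### Local consequences of a 1-orientation. -/

section Orientation

variable {M : MarkedMap m} {O : Set M.D}

theorem existsUnique_of_outdegree_eq_one {v : MapVertex M.σ} (h : M.outdegree O v = 1) :
    ∃ x, (M.vtx x = v ∧ x ∈ O) ∧ ∀ y, M.vtx y = v → y ∈ O → y = x := by
  obtain ⟨⟨x, hx⟩, hu⟩ := Nat.card_eq_one_iff_unique.1 h |>.2 |> fun ⟨x⟩ =>
    (⟨x, fun y => (Nat.card_eq_one_iff_unique.1 h).1.elim y x⟩ : ∃ x : {h : M.D // vertexOf M.σ h = v ∧ h ∈ O},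
      ∀ y, y = x)
  exact ⟨x, hx, fun y h1 h2 => congrArg Subtype.val (hu ⟨y, h1, h2⟩)⟩

theorem outdegree_add_indegree (v : MapVertex M.σ) :
    M.outdegree O v + M.outdegree Oᶜ v = m := by
  classical
  have := Fintype.ofFinite M.D
  have h1 := M.regular v
  rw [Nat.card_eq_fintype_card, Fintype.card_subtype] at h1
  unfold outdegree
  rw [Nat.card_eq_fintype_card, Nat.card_eq_fintype_card, Fintype.card_subtype, Fintype.card_subtype,
    ← Finset.filter_filter, ← Finset.filter_filter]
  refine Eq.trans ?_ h1
  exact Finset.card_filter_add_card_filter_not _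

/-- In a 1-orientation, each black vertex has one outgoing half-edge. -/
theorem IsOneOrientation.exists_out (hO : M.IsOneOrientation O) {v : MapVertex M.σ}
    (hv : M.color v = Color.black) :
    ∃ x, (M.vtx x = v ∧ x ∈ O) ∧ ∀ y, M.vtx y = v → y ∈ O → y = x := by
  apply existsUnique_of_outdegree_eq_one
  rw [hO.2 v, hv]

/-- In a 1-orientation, each white vertex has one ingoing half-edge. -/
theorem IsOneOrientation.exists_in (hm : 3 ≤ m) (hO : M.IsOneOrientation O) {v : MapVertex M.σ}
    (hv : M.color v = Color.white) :
    ∃ x, (M.vtx x = v ∧ x ∉ O) ∧ ∀ y, M.vtx y = v → y ∉ O → y = x := by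
  refine existsUnique_of_outdegree_eq_one (O := Oᶜ) ?_
  have h1 := outdegree_add_indegree (M := M) (O := O) v
  have h2 : M.outdegree O v = m - 1 := by
    rw [hO.2 v, hv]
  rw [h2] at h1
  generalize M.outdegree Oᶜ v = d at h1 ⊢
  omega

/-- In an admissible map, the outgoing half-edges of black vertices are unmarked. -/
theorem not_isMarked_of_black (hO : M.IsOneOrientation O) (hacc : M.IsRootAccessible O) {y : M.D}
    (hy : y ∈ O) (hcol : M.col y = Color.black) : ¬ M.IsMarked y := by
  have h1 := hacc (M.vtx y)
  -- The root is white, so the unmarked path from this black vertex has a first step, which must use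
  -- its only outgoing half-edge.
  rcases Relation.ReflTransGen.cases_head h1 with h2 | ⟨w, ⟨x, hx, hx', hxv, -⟩, -⟩
  · have h3 := M.root_white
    have h4 : M.col y = M.color M.rootVertex := congrArg M.color h2
    rw [h4] at hcol
    exact absurd (hcol.symm.trans h3) (by decide)
  · obtain ⟨z, -, hz⟩ := hO.exists_out hcol
    rwa [hz y rfl hy, ← hz x hxv hx]

theorem IsAdmissible.mult_black (hM : M.IsAdmissible) {x : M.D} (hx : M.col x = Color.black) :
    M.mult x = 0 := by
  obtain ⟨O, hO, hcomp, hacc, -⟩ := hM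
  by_contra h
  exact not_isMarked_of_black hO hacc (hcomp x h) hx (Or.inl h)

theorem rot_pow_pred (hm : 3 ≤ m) (h : M.D) : (M.σ ^ (m - 1)) h = M.σ.symm h := by
  rw [Equiv.eq_symm_apply, ← Equiv.Perm.mul_apply, ← pow_succ', show m - 1 + 1 = m by omega,
    rot_pow_self]

end Orientation

/-- The unique ingoing edges of the white vertices are unmarked and match white with black vertices,
whence Hall's condition. A tight set avoiding the root would form, with its partners, a set that no
unmarked oriented path leaves; so the whole map is a region. The ingoing edge at the root is the
last one clockwise, which puts the root's black child in rightmost position. -/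
theorem IsAdmissible.exists_isTreeOf (hm : 3 ≤ m) {M : MarkedMap m} (hM : M.IsAdmissible) :
    ∃ child, IsTreeOf hm M child := by
  classical
  have hblack : ∀ x, M.col x = Color.black → M.mult x = 0 := fun x => hM.mult_black
  obtain ⟨O, hO, hcomp, hacc, hroot⟩ := hM
  have hfin : Finite (MapVertex M.σ) := Quotient.finite _
  have := Fintype.ofFinite (MapVertex M.σ)
  have hin : ∀ v, ∃ x, M.color v = Color.white → (M.vtx x = v ∧ x ∉ O) ∧
      ∀ y, M.vtx y = v → y ∉ O → y = x := fun v => by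
    by_cases hv : M.color v = Color.white
    · obtain ⟨x, hx⟩ := hO.exists_in hm hv
      exact ⟨x, fun _ => hx⟩
    -- A dummy value: `e` is used at white vertices only.
    · exact ⟨M.root, fun h => absurd h hv⟩
  choose e he using hin
  have hopp : ∀ x, M.opp x ∈ O ↔ x ∉ O := hO.1
  have hecol : ∀ v, M.color v = Color.white → M.col (M.opp (e v)) = Color.black := fun v hv => by
    rw [col_opp, col, (he v hv).1.1, hv]
    rfl
  have heunm : ∀ v, M.color v = Color.white → M.mult (e v) = 0 := fun v hv => by
    have h1 := not_isMarked_of_black hO hacc ((hopp _).2 (he v hv).1.2) (hecol v hv)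
    unfold IsMarked at h1
    rw [M.opp_opp] at h1
    by_contra h2
    exact h1 (Or.inr h2)
  have hinj : ∀ v w, M.color v = Color.white → M.color w = Color.white →
      M.vtx (M.opp (e v)) = M.vtx (M.opp (e w)) → v = w := fun v w hv hw h => by
    obtain ⟨z, -, hz⟩ := hO.exists_out (hecol v hv)
    have h1 := (hz _ rfl ((hopp _).2 (he v hv).1.2)).trans
      (hz _ h.symm ((hopp _).2 (he w hw).1.2)).symm
    rw [← (he v hv).1.1, ← (he w hw).1.1, M.opp_injective h1]
  let S : Finset (MapVertex M.σ) := Finset.univ.filter fun v => M.color v = Color.white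
  let C : Finset (MapVertex M.σ) := Finset.univ.filter fun v => M.color v = Color.black
  have hS : ∀ v, v ∈ S ↔ M.color v = Color.white := fun v => by simp [S]
  have hC : ∀ v, v ∈ C ↔ M.color v = Color.black := fun v => by simp [C]
  have hcard : S.card = C.card := by
    refine Finset.card_bij (fun v _ => M.vtx (M.opp (e v))) (fun v hv => ?_) (fun v hv w hw h => ?_)
      fun b hb => ?_
    · exact (hC _).2 (hecol v ((hS v).1 hv))
    · exact hinj v w ((hS v).1 hv) ((hS w).1 hw) h
    · obtain ⟨y, ⟨hy, hyO⟩, -⟩ := hO.exists_out ((hC b).1 hb)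
      have hw : M.col (M.opp y) = Color.white := by
        rw [col_opp, col, hy, (hC b).1 hb]
        rfl
      refine ⟨M.vtx (M.opp y), (hS _).2 hw, ?_⟩
      have h1 := (he _ hw).2 (M.opp y) rfl (by
        rw [← hopp, M.opp_opp]
        exact hyO)
      rw [← h1, M.opp_opp, hy]
  have hadj : ∀ v, M.color v = Color.white → M.Adj v (M.vtx (M.opp (e v))) := fun v hv =>
    ⟨e v, by rw [col, (he v hv).1.1, hv], (he v hv).1.1, rfl, heunm v hv⟩
  have hrw : M.color (M.vtx M.root) = Color.white := M.root_white
  have hreg : IsRegion M.Adj S C (M.vtx M.root) := by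
    refine ⟨(hS _).2 hrw, hcard, ⟨_, (hC _).2 (hecol _ hrw), hadj _ hrw⟩, fun A hA hne hrA => ?_⟩
    have hAw : ∀ v ∈ A, M.color v = Color.white := fun v hv => (hS v).1 (hA hv)
    have hsub : A.image (fun v => M.vtx (M.opp (e v))) ⊆ neighbours M.Adj A C := fun b hb => by
      obtain ⟨v, hv, rfl⟩ := Finset.mem_image.1 hb
      exact mem_neighbours.2 ⟨(hC _).2 (hecol v (hAw v hv)), v, hv, hadj v (hAw v hv)⟩
    have hcA : (A.image fun v => M.vtx (M.opp (e v))).card = A.card :=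
      Finset.card_image_of_injOn fun v hv w hw h => hinj v w (hAw v hv) (hAw w hw) h
    rw [← hcA]
    refine Finset.card_lt_card (Finset.ssubset_iff_subset_ne.2 ⟨hsub, fun heq => ?_⟩)
    -- otherwise the root vertex cannot be reached from `A`
    obtain ⟨v, hv⟩ := hne
    have key : ∀ w, Relation.ReflTransGen (M.UnmarkedStep O) v w →
        w ∈ A ∨ w ∈ A.image fun v => M.vtx (M.opp (e v)) := by
      intro w hw
      induction hw with
      | refl => exact Or.inl hv
      | tail _ hstep ih =>
        obtain ⟨x, hxO, hxm, rfl, rfl⟩ := hstep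
        rcases ih with h1 | h1
        · right
          rw [heq]
          refine mem_neighbours.2 ⟨(hC _).2 ?_, M.vtx x, h1, x, hAw _ h1, rfl, rfl, ?_⟩
          · have hxw : M.col x = Color.white := hAw _ h1
            change M.col _ = _
            rw [col_opp, hxw]
            rfl
          · by_contra h2
            exact hxm (Or.inl h2)
        · left
          -- The only outgoing edge of the partner of `u` is the matching edge, which leads back to
          -- `u`.
          obtain ⟨u, hu, hux⟩ := Finset.mem_image.1 h1
          obtain ⟨z, -, hz⟩ := hO.exists_out (hecol u (hAw u hu))
          have h2 := (hz x hux.symm hxO).trans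
            (hz _ rfl ((hopp _).2 (he u (hAw u hu)).1.2)).symm
          rw [h2, M.opp_opp]
          change M.vtx _ ∈ A
          rw [(he u (hAw u hu)).1.1]
          exact hu
    rcases key _ (hacc v) with h1 | h1
    · exact hrA h1
    · obtain ⟨u, hu, hux⟩ := Finset.mem_image.1 h1
      have h2 := hecol u (hAw u hu)
      rw [col, hux] at h2
      exact absurd (h2.symm.trans M.root_white) (by decide)
  have hlast : M.mult ((M.σ ^ (m - 1)) M.root) = 0 ∧
      M.vtx (M.opp ((M.σ ^ (m - 1)) M.root)) ∈ C := by
    have h1 : (M.σ ^ (m - 1)) M.root = e (M.vtx M.root) := by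
      refine (he _ hrw).2 _ (M.vtx_rot_pow _ _) ?_
      rw [hroot _ (M.vtx_rot_pow _ _), rot_pow_pred hm]
    rw [h1]
    exact ⟨heunm _ hrw, (hC _).2 (hecol _ hrw)⟩
  obtain ⟨a, child, hex, ha⟩ := exists_explores S C (fun v hv => (hS v).1 hv)
    (fun v hv => (hC v).1 hv) M.root hreg ⟨m - 1, by omega, by omega, hlast⟩
  have ha' : a = lastPos hm := by
    have h1 := a.2
    ext
    simp only [lastPos]
    by_contra h2
    exact ha (m - 1) (by omega) (by omega) hlast.1 hlast.2
  subst ha'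
  refine ⟨child, hblack, ?_⟩
  convert hex using 1
  · ext v
    exact (hS v).symm
  · ext v
    exact (hC v).symm

end MarkedMap

/-! ### Edges of a tree -/

namespace PairTree

variable {m : ℕ}

/-- The white label `x` and the black label `y` are those of the two halves of an edge of the tree. -/
def TreeEdge (T : PairTree m) (x y : HalfLabel m) : Prop :=
  (∃ p, T.Occurs p ∧ x = (p, Color.white, T.branch p + 1) ∧ y = (p, Color.black, 0)) ∨
  ∃ p, ∃ j : Fin (m - 1), T.Occurs (p ++ [j]) ∧ x = (p ++ [j], Color.white, 0) ∧
    y = (p, Color.black, (j : ℕ) + 1)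

/-- The label of the root leaf. -/
def rootLabel : HalfLabel m := ([], Color.white, 0)

theorem halves_cases {T : PairTree m} {x : HalfLabel m} (hx : x ∈ T.halves) :
    T.IsLeafLabel x ∨ x = rootLabel ∨ (∃ y, T.TreeEdge x y) ∨ ∃ y, T.TreeEdge y x := by
  obtain ⟨p, c, k⟩ := x
  obtain ⟨hp, hk⟩ := hx
  dsimp only at hp hk
  cases c with
  | white =>
    rcases Nat.eq_zero_or_pos k with rfl | hk0
    · rcases List.eq_nil_or_concat' p with rfl | ⟨q, j, rfl⟩
      · exact Or.inr (Or.inl rfl)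
      · exact Or.inr (Or.inr (Or.inl ⟨_, Or.inr ⟨q, j, hp, rfl, rfl⟩⟩))
    · by_cases hb : k = T.branch p + 1
      · subst hb
        exact Or.inr (Or.inr (Or.inl ⟨_, Or.inl ⟨p, hp, rfl, rfl⟩⟩))
      · exact Or.inl ⟨hp, hk0, hk, hb⟩
  | black =>
    cases k with
    | zero => exact Or.inr (Or.inr (Or.inr ⟨_, Or.inl ⟨p, hp, rfl, rfl⟩⟩))
    | succ j =>
      by_cases hj : T.Occurs (p ++ [⟨j, by omega⟩])
      · exact Or.inr (Or.inr (Or.inr ⟨_, Or.inr ⟨p, ⟨j, by omega⟩, hj, rfl, rfl⟩⟩))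
      · exact Or.inl ⟨hp, ⟨j, by omega⟩, rfl, hj⟩

theorem TreeEdge.mem_halves {T : PairTree m} {x y : HalfLabel m} (h : T.TreeEdge x y) :
    x ∈ T.halves ∧ y ∈ T.halves := by
  rcases h with ⟨p, hp, rfl, rfl⟩ | ⟨p, j, hp, rfl, rfl⟩
  · have := branch_lt hp
    exact ⟨⟨hp, by dsimp only; omega⟩, ⟨hp, by dsimp only; omega⟩⟩
  · have := j.2
    exact ⟨⟨hp, by dsimp only; omega⟩, ⟨occurs_of_append hp, by dsimp only; omega⟩⟩

theorem TreeEdge.color {T : PairTree m} {x y : HalfLabel m} (h : T.TreeEdge x y) :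
    x.2.1 = Color.white ∧ y.2.1 = Color.black := by
  rcases h with ⟨p, hp, rfl, rfl⟩ | ⟨p, j, hp, rfl, rfl⟩ <;> exact ⟨rfl, rfl⟩

theorem TreeEdge.not_isLeafLabel {T : PairTree m} {x y : HalfLabel m} (h : T.TreeEdge x y) :
    ¬ T.IsLeafLabel x ∧ ¬ T.IsLeafLabel y := by
  rcases h with ⟨p, hp, rfl, rfl⟩ | ⟨p, j, hp, rfl, rfl⟩
  · exact ⟨fun h => h.2.2.2 rfl, fun ⟨_, j, hj, _⟩ => by simp at hj⟩
  · refine ⟨fun h => by simpa using h.2.1, fun ⟨_, j', hj, h⟩ => h ?_⟩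
    have : j' = j := by
      ext
      dsimp only at hj
      omega
    rw [this]
    exact hp

theorem TreeEdge.ne_rootLabel {T : PairTree m} {x y : HalfLabel m} (h : T.TreeEdge x y) :
    x ≠ rootLabel ∧ y ≠ rootLabel := by
  rcases h with ⟨p, hp, rfl, rfl⟩ | ⟨p, j, hp, rfl, rfl⟩ <;> simp [rootLabel]

theorem not_isLeafLabel_rootLabel (T : PairTree m) : ¬ T.IsLeafLabel rootLabel := fun h => by
  simpa [rootLabel] using h.2.1

theorem finite_occurs (T : PairTree m) : {p | T.Occurs p}.Finite := by
  induction T with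
  | closing => exact Set.finite_empty
  | node a child ih =>
    have h1 : ({[]} ∪ ⋃ j, (fun p => j :: p) '' {p | (child j).Occurs p}).Finite :=
      (Set.finite_singleton _).union (Set.finite_iUnion fun j => (ih j).image _)
    refine h1.subset ?_
    rintro (_ | ⟨j, p⟩) hp
    · exact Or.inl rfl
    · exact Or.inr (Set.mem_iUnion.2 ⟨j, p, hp, rfl⟩)

end PairTree

namespace MarkedMap

open PairTree

variable {m : ℕ} {M : MarkedMap m}

theorem opp_place_of_treeEdge {T : PairTree m} {x y : HalfLabel m} (h : T.TreeEdge x y) (h0 : M.D) :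
    M.opp (M.place T h0 x) = M.place T h0 y := by
  rcases h with ⟨p, hp, rfl, rfl⟩ | ⟨p, j, hp, rfl, rfl⟩
  · exact (M.base_black hp).symm
  · change M.opp (M.base T h0 (p ++ [j]) Color.white) = _
    rw [M.base_append_singleton hp, M.opp_opp]
    rfl

variable (M) in
/-- The tree explores the whole map from its root. -/
abbrev ExploresAll (T : PairTree m) : Prop :=
  M.Explores T M.root {v | M.color v = Color.white} {v | M.color v = Color.black}

namespace Explores

variable {T : PairTree m}

theorem exists_place (hT : M.ExploresAll T) (x : M.D) : ∃ l ∈ T.halves, M.place T M.root l = x :=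
  hT.bijOn.surjOn (Color.eq_white_or_black (M.color (M.vtx x)))

theorem place_injective (hT : M.ExploresAll T) {l l' : HalfLabel m} (hl : l ∈ T.halves)
    (hl' : l' ∈ T.halves) (h : M.place T M.root l = M.place T M.root l') : l = l' :=
  hT.bijOn.injOn hl hl' h

theorem not_mem_leafList (hT : M.ExploresAll T) (hne : T ≠ closing) {l : HalfLabel m}
    (hl : l ∈ T.halves) (h : ¬ T.IsLeafLabel l) : M.place T M.root l ∉ M.leafList T M.root :=
  fun hmem => by
    rcases MarkedMap.mem_leafList hmem with ⟨h1, -⟩ | ⟨l', h1, h2⟩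
    · exact hne h1
    · rw [hT.place_injective hl h1.mem_halves h2] at h
      exact h h1

/-- A half-edge opposite to a leaf is a leaf, or is the root. -/
theorem mem_leafList_or_eq_root (hT : M.ExploresAll T) (hne : T ≠ closing) {x : M.D}
    (hx : M.opp x ∈ M.leafList T M.root) : x ∈ M.leafList T M.root ∨ x = M.root := by
  obtain ⟨l, hl, rfl⟩ := hT.exists_place x
  rcases halves_cases hl with h1 | rfl | ⟨y, h1⟩ | ⟨y, h1⟩
  · exact Or.inl (place_mem_leafList h1 _)
  · right
    cases T with
    | closing => exact absurd rfl hne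
    | node a child => rfl
  · rw [opp_place_of_treeEdge h1] at hx
    exact absurd hx (hT.not_mem_leafList hne h1.mem_halves.2 h1.not_isLeafLabel.2)
  · rw [← opp_place_of_treeEdge h1, M.opp_opp] at hx
    exact absurd hx (hT.not_mem_leafList hne h1.mem_halves.1 h1.not_isLeafLabel.1)

theorem path_eq_of_vtx_eq (hT : M.ExploresAll T) {p q : List (Fin (m - 1))} {c : Color}
    (hm : 3 ≤ m) (hp : T.Occurs p) (hq : T.Occurs q)
    (h : M.vtx (M.base T M.root p c) = M.vtx (M.base T M.root q c)) : p = q := by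
  obtain ⟨k, hk, hk'⟩ := M.exists_rot_pow h
  have := hT.place_injective (l := (q, c, k)) (l' := (p, c, 0)) ⟨hq, hk⟩
    ⟨hp, by dsimp only; omega⟩ hk'
  simp only [Prod.mk.injEq] at this
  exact this.1.symm

end Explores

variable (M) in
/-- In the tree `T₀` placed at the root, the tree `T` appears at the end of the path `p`, placed at
`h`, and the leaves before it are those in `pre`. -/
inductive OccursAt (T₀ : PairTree m) :
    List (Fin (m - 1)) → PairTree m → M.D → List M.D → Prop
  | root : OccursAt T₀ [] T₀ M.root []
  | child {p : List (Fin (m - 1))} {a : Fin (m - 1)} {child : Fin (m - 1) → PairTree m} {h : M.D}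
      {pre : List M.D} (j : Fin (m - 1)) (hp : OccursAt T₀ p (node a child) h pre) :
      OccursAt T₀ (p ++ [j]) (child j) (M.childHalf h a j)
        (pre ++ (List.range a).map (fun k => (M.σ ^ (k + 1)) h) ++
          ((List.ofFn fun j => M.leafList (child j) (M.childHalf h a j)).take j).flatten)

namespace OccursAt

variable {T₀ T : PairTree m} {p : List (Fin (m - 1))} {h : M.D} {pre : List M.D}

theorem eq_of_nil (H : M.OccursAt T₀ p T h pre) (hp : p = []) : T = T₀ := by
  cases H with
  | root => rfl
  | child j H => simp at hp

theorem col_eq (H : M.OccursAt T₀ p T h pre) : M.col h = Color.white := by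
  induction H with
  | root => exact M.root_white
  | child j _ ih => exact M.col_childHalf ih _ _

theorem exists_leafList_eq (H : M.OccursAt T₀ p T h pre) :
    ∃ post, M.leafList T₀ M.root = pre ++ M.leafList T h ++ post := by
  induction H with
  | root => exact ⟨[], by simp⟩
  | @child p a child h pre j _ ih =>
    obtain ⟨post, hpost⟩ := ih
    have h1 : (List.ofFn fun j => M.leafList (child j) (M.childHalf h a j)) =
        (List.ofFn fun j => M.leafList (child j) (M.childHalf h a j)).take j ++
          [M.leafList (child j) (M.childHalf h a j)] ++
          (List.ofFn fun j => M.leafList (child j) (M.childHalf h a j)).drop (j + 1) := by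
      have h2 : (j : ℕ) < (List.ofFn fun j => M.leafList (child j) (M.childHalf h a j)).length := by simp
      conv_lhs => rw [← List.take_append_drop j (List.ofFn _), List.drop_eq_getElem_cons h2]
      simp
    have h3 := congrArg List.flatten h1
    rw [List.flatten_append, List.flatten_append, List.flatten_singleton] at h3
    refine ⟨((List.ofFn fun j => M.leafList (child j) (M.childHalf h a j)).drop (j + 1)).flatten ++
      (List.range (m - 2 - a)).map (fun k => (M.σ ^ (a + 2 + k)) h) ++ post, ?_⟩
    rw [hpost, leafList_node, h3]
    simp only [List.append_assoc]

theorem occurs_append (H : M.OccursAt T₀ p T h pre) (q : List (Fin (m - 1))) :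
    (T.Occurs q ↔ T₀.Occurs (p ++ q)) ∧ T.branch q = T₀.branch (p ++ q) ∧
      (T.Occurs q → ∀ c, M.base T h q c = M.base T₀ M.root (p ++ q) c) := by
  induction H generalizing q with
  | root => simp
  | child j _ ih =>
    rw [List.append_assoc]
    exact ih (j :: q)

theorem place_eq (H : M.OccursAt T₀ p T h pre) {l : HalfLabel m} (hl : T.Occurs l.1) :
    M.place T h l = M.place T₀ M.root (p ++ l.1, l.2) := by
  rw [place, place, (H.occurs_append l.1).2.2 hl]

theorem isLeafLabel (H : M.OccursAt T₀ p T h pre) {l : HalfLabel m} (hl : T.IsLeafLabel l) :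
    T₀.IsLeafLabel (p ++ l.1, l.2) := by
  obtain ⟨q, c, k⟩ := l
  obtain ⟨h1, h2⟩ := hl
  refine ⟨(H.occurs_append q).1.1 h1, ?_⟩
  cases c with
  | white =>
    refine ⟨h2.1, h2.2.1, ?_⟩
    dsimp only
    rw [← (H.occurs_append q).2.1]
    exact h2.2.2
  | black =>
    obtain ⟨j, h3, h4⟩ := h2
    refine ⟨j, h3, ?_⟩
    dsimp only
    rwa [List.append_assoc, ← (H.occurs_append (q ++ [j])).1]

end OccursAt

/-! ### Uniqueness of the tree -/

section Uniqueness

variable {T₀ T₀' : PairTree m} {p p' : List (Fin (m - 1))} {h : M.D} {pre : List M.D}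

theorem Explores.unmarked_of_treeEdge {T : PairTree m} (hT : M.ExploresAll T) {x y : HalfLabel m}
    (hxy : T.TreeEdge x y) : M.mult (M.place T M.root x) = 0 := by
  rcases hxy with ⟨p, hp, rfl, rfl⟩ | ⟨p, j, hp, rfl, rfl⟩
  · exact hT.unmarked_pair p hp
  · exact hT.unmarked_child p j hp

/-- A closing leaf of one tree cannot be replaced by a pair in another tree with the same past. -/
theorem not_closing_of_node (hm : 3 ≤ m) (hT : M.ExploresAll T₀) (hT' : M.ExploresAll T₀')
    (hne : T₀ ≠ closing) (hne' : T₀' ≠ closing)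
    (H : M.OccursAt T₀ p closing h pre) {T' : PairTree m} (H' : M.OccursAt T₀' p' T' h pre)
    (hp' : p' ≠ []) : T' = closing := by
  by_contra hT'ne
  obtain ⟨q, j, rfl⟩ := (List.eq_nil_or_concat' p').resolve_left hp'
  have hocc : T₀'.Occurs (q ++ [j]) := by
    have := (H'.occurs_append []).1.1 (occurs_nil_iff.2 hT'ne)
    rwa [List.append_nil] at this
  have hedge : T₀'.TreeEdge (q ++ [j], Color.white, 0) (q, Color.black, (j : ℕ) + 1) :=
    Or.inr ⟨q, j, hocc, rfl, rfl⟩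
  have hplace : M.place T₀' M.root (q ++ [j], Color.white, 0) = h := by
    have h1 := H'.place_eq (l := rootLabel) (occurs_nil_iff.2 hT'ne)
    simp only [rootLabel, List.append_nil] at h1
    rw [← h1]
    cases T' with
    | closing => exact absurd rfl hT'ne
    | node a child => rfl
  have h0 : M.mult h = 0 := hplace ▸ hT'.unmarked_of_treeEdge hedge
  have hleaf' : h ∉ M.leafList T₀' M.root :=
    hplace ▸ hT'.not_mem_leafList hne' hedge.mem_halves.1 hedge.not_isLeafLabel.1
  have hroot : h ≠ M.root := fun h1 => by
    have h2 : M.place T₀' M.root rootLabel = M.root := by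
      cases T₀' with
      | closing => exact absurd rfl hne'
      | node a child => rfl
    exact hedge.ne_rootLabel.1 (hT'.place_injective hedge.mem_halves.1
      ⟨occurs_nil_iff.2 hne', by simp only [rootLabel]; omega⟩ (hplace.trans (h1.trans h2.symm)))
  obtain ⟨post, hpost⟩ := H.exists_leafList_eq
  obtain ⟨post', hpost'⟩ := H'.exists_leafList_eq
  rw [leafList_closing] at hpost
  have hpw := hT.pairwise
  rw [hpost] at hpw
  -- The first tree cuts the edge of `h`, so `h` is one of its leaves or the root. A leaf in the
  -- common past would be a leaf of the second tree, where `h` lies on a tree edge. A later leaf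
  -- would be met after its black end and hence be marked, but tree edges are unmarked.
  rcases hT.mem_leafList_or_eq_root hne (x := h) (by rw [hpost]; simp) with h1 | h1
  · rw [hpost] at h1
    rcases List.mem_append.1 h1 with h2 | h2
    · rcases List.mem_append.1 h2 with h3 | h3
      · exact hleaf' (by rw [hpost']; simp [h3])
      · exact M.opp_ne h (List.mem_singleton.1 h3).symm
    · exact (List.pairwise_append.1 hpw).2.2 (M.opp h) (by simp) h h2 rfl H.col_eq h0
  · exact hroot h1

/-- The position of the black child in a pair cannot be greater in another tree with the same
past. -/
theorem not_lt_of_node (hm : 3 ≤ m) (hT : M.ExploresAll T₀) (hT' : M.ExploresAll T₀')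
    (hne : T₀ ≠ closing) (hne' : T₀' ≠ closing) {a a' : Fin (m - 1)}
    {child child' : Fin (m - 1) → PairTree m} (H : M.OccursAt T₀ p (node a child) h pre)
    (H' : M.OccursAt T₀' p' (node a' child') h pre) : ¬ a < a' := by
  intro haa
  rw [Fin.lt_def] at haa
  set T := node a child with hTdef
  have hcol := H.col_eq
  obtain ⟨post, hpost⟩ := H.exists_leafList_eq
  obtain ⟨post', hpost'⟩ := H'.exists_leafList_eq
  have hpw := hT.pairwise
  rw [hpost, hTdef, leafList_node] at hpw
  have ha' := a'.2
  -- each black vertex of the subtree is matched, in the other tree, with a white one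
  have key : ∀ q, T.Occurs q → ∃ q' r, T₀'.Occurs q' ∧ T.Occurs r ∧ r ≠ [] ∧
      M.vtx (M.base T₀' M.root q' Color.black) = M.vtx (M.base T h q Color.black) ∧
      M.vtx (M.base T₀' M.root q' Color.white) = M.vtx (M.base T h r Color.white) := by
    intro q hq
    obtain ⟨⟨q', c, k⟩, ⟨hq', hk⟩, hl⟩ := hT'.exists_place (M.base T h q Color.black)
    obtain rfl : c = Color.black := by
      rw [← M.col_base hcol hq Color.black, ← hl, M.col_place M.root_white hq']
    have hvb : M.vtx (M.base T₀' M.root q' Color.black) = M.vtx (M.base T h q Color.black) := by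
      rw [← hl, vtx_place]
    refine ⟨q', ?_⟩
    have hedge : T₀'.TreeEdge (q', Color.white, T₀'.branch q' + 1) (q', Color.black, 0) :=
      Or.inl ⟨q', hq', rfl, rfl⟩
    obtain ⟨y, hy⟩ : ∃ y, y = M.place T₀' M.root (q', Color.white, T₀'.branch q' + 1) := ⟨_, rfl⟩
    have hyv : M.vtx y = M.vtx (M.base T₀' M.root q' Color.white) := by rw [hy, vtx_place]
    have hyc : M.col y = Color.white := by
      rw [hy]
      exact M.col_place M.root_white (x := (q', Color.white, T₀'.branch q' + 1)) hq'
    have hy0 : M.mult y = 0 := by rw [hy]; exact hT'.unmarked_of_treeEdge hedge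
    have hynot : ∀ l, T₀'.IsLeafLabel l → y ≠ M.place T₀' M.root l := fun l hl' h1 => by
      rw [hy] at h1
      rw [← hT'.place_injective hedge.mem_halves.1 hl'.mem_halves h1] at hl'
      exact hedge.not_isLeafLabel.1 hl'
    have hyleaf : y ∉ M.leafList T₀' M.root := by
      rw [hy]
      exact hT'.not_mem_leafList hne' hedge.mem_halves.1 hedge.not_isLeafLabel.1
    -- Since `a < a'`, the half-edges of ranks `1, …, a + 1` at `h` are opening leaves in the second
    -- tree, and `y` is not a leaf there.
    have hyopens : ∀ k, k < (a : ℕ) + 1 → y ≠ (M.σ ^ (k + 1)) h := fun k hk h1 => by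
      have h2 : (node a' child').IsLeafLabel ([], Color.white, k + 1) :=
        ⟨trivial, by dsimp only; omega, by dsimp only; omega, by simp only [branch]; omega⟩
      refine hynot _ (H'.isLeafLabel h2) ?_
      rw [h1, ← H'.place_eq h2.1]
      rfl
    have hyz : M.vtx (M.opp y) = M.vtx (M.base T h q Color.black) := by
      rw [hy, opp_place_of_treeEdge hedge, vtx_place]
      exact hvb
    have hyroot : y ≠ M.root := fun h1 => by
      have h2 : M.place T₀' M.root rootLabel = M.root := by
        cases T₀' with
        | closing => exact absurd rfl hne'
        | node a child => rfl
      exact hedge.ne_rootLabel.1 (hT'.place_injective hedge.mem_halves.1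
        ⟨occurs_nil_iff.2 hne', by simp only [rootLabel]; omega⟩ (hy.symm.trans (h1.trans h2.symm)))
    rw [← hyv]
    obtain ⟨k, hk, hk'⟩ := M.exists_rot_pow hyz
    have hyk : y = M.opp ((M.σ ^ k) (M.base T h q Color.black)) := by rw [hk', M.opp_opp]
    cases k with
    -- In this case `y` joins the pair at `q` in the first tree as well; for `q = []` it would have
    -- rank `a + 1` at `h`.
    | zero =>
      rw [pow_zero, Equiv.Perm.coe_one, id, M.base_black hq, M.opp_opp] at hyk
      refine ⟨q, hq', hq, ?_, hvb, by rw [hyk, vtx_rot_pow]⟩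
      rintro rfl
      exact hyopens a (by omega) hyk
    | succ j =>
      by_cases hocc : T.Occurs (q ++ [⟨j, by omega⟩])
      · refine ⟨q ++ [⟨j, by omega⟩], hq', hocc, by simp, hvb, ?_⟩
        rw [M.base_append_singleton hocc, hyk]
      · have hleaf : T.IsLeafLabel (q, Color.black, j + 1) := ⟨hq, ⟨j, by omega⟩, rfl, hocc⟩
        have hz : M.opp y ∈ M.leafList T h := by
          rw [← hk']
          exact place_mem_leafList hleaf h
        have hzc : M.col (M.opp y) = Color.black := by
          rw [col_opp, hyc]
          rfl
        -- The edge of `y` is cut by the first tree at a closing leaf of `T`; being unmarked, it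
        -- must have been met earlier at `y`. Leaves of the past and the first opening leaves of `T`
        -- are excluded, so `y` lies in one of the child subtrees.
        have hyl : y ∈ M.leafList T₀ M.root := by
          refine (hT.mem_leafList_or_eq_root hne (x := y) ?_).resolve_right hyroot
          rw [hpost]
          simp [hz]
        rw [hpost, hTdef, leafList_node] at hyl
        rw [hTdef, leafList_node] at hz
        have hwhite : ∀ k, M.opp y ≠ (M.σ ^ k) h := fun k hk => by
          rw [hk, col, vtx_rot_pow, ← col, hcol] at hzc
          cases hzc
        have hzmid : M.opp y ∈ (List.ofFn fun j => M.leafList (child j) (M.childHalf h a j)).flatten := by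
          rcases List.mem_append.1 hz with h1 | h1
          · rcases List.mem_append.1 h1 with h2 | h2
            · obtain ⟨k, -, h3⟩ := List.mem_map.1 h2
              exact absurd h3.symm (hwhite _)
            · exact h2
          · obtain ⟨k, -, h3⟩ := List.mem_map.1 h1
            exact absurd h3.symm (hwhite _)
        rcases List.mem_append.1 hyl with h1 | h1
        · rcases List.mem_append.1 h1 with h2 | h2
          · exact absurd (by rw [hpost']; simp [h2]) hyleaf
          · rcases List.mem_append.1 h2 with h3 | h3
            · rcases List.mem_append.1 h3 with h4 | h4
              · obtain ⟨k, hk, h5⟩ := List.mem_map.1 h4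
                exact absurd h5.symm (hyopens k (by rw [List.mem_range] at hk; omega))
              · obtain ⟨l, hl, h5⟩ := List.mem_flatten.1 h4
                obtain ⟨j', rfl⟩ := (List.mem_ofFn' _ _).1 hl
                rcases mem_leafList h5 with ⟨-, h6⟩ | ⟨⟨r, c, k⟩, h6, h7⟩
                · rw [h6, col_opp, M.col_childHalf hcol] at hyc
                  cases hyc
                · have h8 := M.col_place (M.col_childHalf hcol a j') h6.1
                  rw [← h7, hyc] at h8
                  dsimp only at h8
                  subst h8
                  refine ⟨j' :: r, hq', h6.1, by simp, hvb, ?_⟩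
                  rw [h7, vtx_place]
                  rfl
            -- An opening leaf after the black child of `T` comes after the closing leaf `M.opp y`,
            -- so it would be marked.
            · exact absurd hy0 ((List.pairwise_append.1 (List.pairwise_append.1
                (List.pairwise_append.1 hpw).1).2.1).2.2 _ (List.mem_append_right _ hzmid) _ h3 rfl hyc)
        · exact absurd hy0 ((List.pairwise_append.1 hpw).2.2 _
            (by simp only [List.mem_append]; exact Or.inr (Or.inl (Or.inr hzmid))) _ h1 rfl hyc)
  -- The white partner determines the pair of the second tree and hence its black vertex, so `q ↦ r`
  -- is an injection of the finite set of pairs of `T` into itself. It misses the root pair, a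
  -- contradiction.
  choose f r hf hr hrne hfb hfw using key
  have hfin : Finite {q // T.Occurs q} := (finite_occurs T).to_subtype
  let g : {q // T.Occurs q} → {q // T.Occurs q} := fun q => ⟨r q.1 q.2, hr q.1 q.2⟩
  have hg : Function.Injective g := by
    rintro ⟨q₁, h₁⟩ ⟨q₂, h₂⟩ h3
    have h4 : r q₁ h₁ = r q₂ h₂ := congrArg Subtype.val h3
    have h5 : f q₁ h₁ = f q₂ h₂ := hT'.path_eq_of_vtx_eq hm (hf _ _) (hf _ _)
      (by rw [hfw, hfw, h4])
    have h6 : M.vtx (M.base T h q₁ Color.black) = M.vtx (M.base T h q₂ Color.black) := by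
      rw [← hfb q₁ h₁, ← hfb q₂ h₂, h5]
    rw [(H.occurs_append q₁).2.2 h₁, (H.occurs_append q₂).2.2 h₂] at h6
    exact Subtype.ext (List.append_cancel_left (hT.path_eq_of_vtx_eq hm
      ((H.occurs_append q₁).1.1 h₁) ((H.occurs_append q₂).1.1 h₂) h6))
  obtain ⟨⟨q, hq⟩, hq'⟩ := Finite.injective_iff_surjective.1 hg ⟨[], trivial⟩
  exact hrne q hq (congrArg Subtype.val hq')

/-- Subtrees with the same position and past are compared by induction. The hypothesis on the paths
keeps the two roots together, since a closing leaf can be excluded only below the root or by `hne`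
and `hne'`. -/
theorem eq_of_occursAt (hm : 3 ≤ m) (hT : M.ExploresAll T₀) (hT' : M.ExploresAll T₀')
    (hne : T₀ ≠ closing) (hne' : T₀' ≠ closing) {T T' : PairTree m}
    (H : M.OccursAt T₀ p T h pre) (H' : M.OccursAt T₀' p' T' h pre) (hpp : p = [] ↔ p' = []) :
    T = T' := by
  induction T generalizing T' p p' h pre with
  | closing =>
    refine (not_closing_of_node hm hT hT' hne hne' H H' fun h1 => ?_).symm
    exact hne (H.eq_of_nil (hpp.2 h1)).symm
  | node a child ih =>
    cases T' with
    | closing =>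
      refine not_closing_of_node hm hT' hT hne' hne H' H fun h1 => ?_
      exact hne' (H'.eq_of_nil (hpp.1 h1)).symm
    | node a' child' =>
      obtain rfl : a = a' := le_antisymm (not_lt.1 (not_lt_of_node hm hT' hT hne' hne H' H))
        (not_lt.1 (not_lt_of_node hm hT hT' hne hne' H H'))
      -- Children are compared from left to right, because the past of the `j`-th one contains the
      -- leaves of all earlier ones.
      have key : ∀ n, ∀ j : Fin (m - 1), (j : ℕ) = n → child j = child' j := by
        intro n
        induction n using Nat.strong_induction_on with
        | _ n ihn =>
        rintro j rfl
        have h1 := OccursAt.child j H'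
        have h2 : (List.ofFn fun j => M.leafList (child' j) (M.childHalf h a j)).take j =
            (List.ofFn fun j => M.leafList (child j) (M.childHalf h a j)).take j := by
          apply List.ext_getElem
          · simp
          · intro k hk hk'
            simp only [List.length_take, List.length_ofFn] at hk
            simp only [List.getElem_take, List.getElem_ofFn]
            rw [ihn k (by omega) ⟨k, by omega⟩ rfl]
        rw [h2] at h1
        exact ih j (OccursAt.child j H) h1 (by simp)
      rw [show child = child' from funext fun j => key j j rfl]

theorem IsTreeOf.unique {hm : 3 ≤ m} {child child' : Fin (m - 1) → PairTree m}
    (h : IsTreeOf hm M child) (h' : IsTreeOf hm M child') : child = child' := by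
  have := eq_of_occursAt hm h.explores h'.explores (by simp) (by simp) OccursAt.root OccursAt.root
    Iff.rfl
  simpa using this

end Uniqueness

end MarkedMap

/-! ### Matching the half-edges of a tree -/

namespace PairTree

variable {m : ℕ} {T : PairTree m}

theorem length_leafLabels (T : PairTree m) : T.leafLabels.length = T.word.length := by
  rw [← map_labelKind_leafLabels, List.length_map]

/-- The label of the leaf at a given position. -/
def labelAt (T : PairTree m) (t : Fin T.word.length) : HalfLabel m :=
  -- The default occurs only for `closing`, whose single leaf has no label.
  (T.leafLabels[(t : ℕ)]'(by rw [length_leafLabels]; exact t.2)).getD rootLabel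

theorem ofFn_labelAt (hT : T ≠ closing) :
    List.ofFn (fun t => some (T.labelAt t)) = T.leafLabels := by
  apply List.ext_getElem
  · rw [List.length_ofFn, length_leafLabels]
  · intro n h1 h2
    rw [List.getElem_ofFn, labelAt]
    cases h : T.leafLabels[n] with
    | none => exact absurd (none_mem_leafLabels.1 (h ▸ List.getElem_mem h2)) hT
    | some x => rfl

theorem labelAt_injective (hT : T ≠ closing) : Function.Injective T.labelAt := by
  have h1 := T.nodup_leafLabels
  rw [← ofFn_labelAt hT, List.nodup_ofFn] at h1
  exact fun s t h => h1 (congrArg some h)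

theorem isLeafLabel_labelAt (hT : T ≠ closing) (t : Fin T.word.length) :
    T.IsLeafLabel (T.labelAt t) := by
  rw [← some_mem_leafLabels, ← ofFn_labelAt hT, List.mem_ofFn]
  exact ⟨t, rfl⟩

theorem IsLeafLabel.exists_labelAt {x : HalfLabel m} (hx : T.IsLeafLabel x) :
    ∃ t, T.labelAt t = x := by
  have hT : T ≠ closing := by
    rintro rfl
    exact hx.1
  rw [← some_mem_leafLabels, ← ofFn_labelAt hT, List.mem_ofFn] at hx
  obtain ⟨t, ht⟩ := hx
  exact ⟨t, Option.some.inj ht⟩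

theorem labelKind_some_eq_opening {x : HalfLabel m} :
    labelKind (some x) = LeafKind.opening ↔ x.2.1 = Color.white := by
  obtain ⟨p, c, k⟩ := x
  cases c <;> simp [labelKind]

theorem labelKind_some_eq_closing {x : HalfLabel m} :
    labelKind (some x) = LeafKind.closing ↔ x.2.1 = Color.black := by
  obtain ⟨p, c, k⟩ := x
  cases c <;> simp [labelKind]

theorem word_get (hT : T ≠ closing) (t : Fin T.word.length) :
    T.word.get t = labelKind (some (T.labelAt t)) := by
  have h1 : ∀ (l : List (Option (HalfLabel m))) (hl : l = T.leafLabels) (h : (t : ℕ) < l.length),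
      T.word.get t = labelKind l[(t : ℕ)] := by
    rintro l rfl h
    simp [← map_labelKind_leafLabels]
  have := h1 _ (ofFn_labelAt hT) (by simp)
  rwa [List.getElem_ofFn] at this

variable (T) in
/-- The label of an opening leaf, or of the root leaf. -/
def openAt : WithBot (LetterPos T.word LeafKind.opening) → HalfLabel m :=
  WithBot.recBotCoe rootLabel fun t => T.labelAt t.1

variable (T) in
/-- The label of a closing leaf. -/
def closeAt (t : LetterPos T.word LeafKind.closing) : HalfLabel m := T.labelAt t.1

theorem closeAt_injective (hT : T ≠ closing) : Function.Injective T.closeAt :=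
  fun _ _ h => Subtype.ext (labelAt_injective hT h)

theorem openAt_injective (hT : T ≠ closing) : Function.Injective T.openAt := by
  intro s t h
  induction s with
  | bot =>
    induction t with
    | bot => rfl
    | coe t =>
      have h' : rootLabel = T.labelAt t.1 := h
      exact absurd (h' ▸ isLeafLabel_labelAt hT t.1) T.not_isLeafLabel_rootLabel
  | coe s =>
    induction t with
    | bot =>
      have h' : T.labelAt s.1 = rootLabel := h
      exact absurd (h' ▸ isLeafLabel_labelAt hT s.1) T.not_isLeafLabel_rootLabel
    | coe t => rw [Subtype.ext (labelAt_injective hT h)]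

theorem color_openAt (hT : T ≠ closing) (s) : (T.openAt s).2.1 = Color.white := by
  induction s with
  | bot => rfl
  | coe s => exact labelKind_some_eq_opening.1 ((word_get hT s.1).symm.trans s.2)

theorem color_closeAt (hT : T ≠ closing) (t) : (T.closeAt t).2.1 = Color.black :=
  labelKind_some_eq_closing.1 ((word_get hT t.1).symm.trans t.2)

theorem rootLabel_mem_halves (hm : 3 ≤ m) (hT : T ≠ closing) : rootLabel ∈ T.halves :=
  ⟨occurs_nil_iff.2 hT, by simp only [rootLabel]; omega⟩

theorem openAt_mem_halves (hm : 3 ≤ m) (hT : T ≠ closing) (s) : T.openAt s ∈ T.halves := by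
  induction s with
  | bot => exact rootLabel_mem_halves hm hT
  | coe s => exact (isLeafLabel_labelAt hT s.1).mem_halves

theorem closeAt_mem_halves (hT : T ≠ closing) (t) : T.closeAt t ∈ T.halves :=
  (isLeafLabel_labelAt hT t.1).mem_halves

theorem not_treeEdge_openAt (hT : T ≠ closing) (s) (y : HalfLabel m) :
    ¬ T.TreeEdge (T.openAt s) y := by
  intro h
  induction s with
  | bot => exact h.ne_rootLabel.1 rfl
  | coe s => exact h.not_isLeafLabel.1 (isLeafLabel_labelAt hT s.1)

theorem not_treeEdge_closeAt (hT : T ≠ closing) (t) (x : HalfLabel m) :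
    ¬ T.TreeEdge x (T.closeAt t) := fun h =>
  h.not_isLeafLabel.2 (isLeafLabel_labelAt hT t.1)

theorem IsLeafLabel.exists_openAt {x : HalfLabel m} (hx : T.IsLeafLabel x)
    (hc : x.2.1 = Color.white) : ∃ t : LetterPos T.word LeafKind.opening, T.openAt t = x := by
  have hT : T ≠ closing := by
    rintro rfl
    exact hx.1
  obtain ⟨t, rfl⟩ := hx.exists_labelAt
  exact ⟨⟨t, (word_get hT t).trans (labelKind_some_eq_opening.2 hc)⟩, rfl⟩

theorem IsLeafLabel.exists_closeAt {x : HalfLabel m} (hx : T.IsLeafLabel x)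
    (hc : x.2.1 = Color.black) : ∃ t, T.closeAt t = x := by
  have hT : T ≠ closing := by
    rintro rfl
    exact hx.1
  obtain ⟨t, rfl⟩ := hx.exists_labelAt
  exact ⟨⟨t, (word_get hT t).trans (labelKind_some_eq_closing.2 hc)⟩, rfl⟩

theorem exists_openAt_or_treeEdge {x : HalfLabel m} (hx : x ∈ T.halves)
    (hc : x.2.1 = Color.white) : (∃ s, T.openAt s = x) ∨ ∃ y, T.TreeEdge x y := by
  rcases halves_cases hx with h | rfl | h | ⟨y, h⟩
  · obtain ⟨t, ht⟩ := h.exists_openAt hc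
    exact Or.inl ⟨t, ht⟩
  · exact Or.inl ⟨⊥, rfl⟩
  · exact Or.inr h
  · rw [h.color.2] at hc
    cases hc

theorem exists_closeAt_or_treeEdge {x : HalfLabel m} (hx : x ∈ T.halves)
    (hc : x.2.1 = Color.black) : (∃ t, T.closeAt t = x) ∨ ∃ y, T.TreeEdge y x := by
  rcases halves_cases hx with h | rfl | ⟨y, h⟩ | h
  · exact Or.inl (h.exists_closeAt hc)
  · cases hc
  · rw [h.color.1] at hc
    cases hc
  · exact Or.inr h

theorem TreeEdge.right_unique {x y y' : HalfLabel m} (h : T.TreeEdge x y) (h' : T.TreeEdge x y') :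
    y = y' := by
  rcases h with ⟨p, hp, rfl, rfl⟩ | ⟨p, j, hp, rfl, rfl⟩ <;>
    rcases h' with ⟨p', hp', h, rfl⟩ | ⟨p', j', hp', h, rfl⟩ <;>
    simp_all

theorem TreeEdge.left_unique {x x' y : HalfLabel m} (h : T.TreeEdge x y) (h' : T.TreeEdge x' y) :
    x = x' := by
  rcases h with ⟨p, hp, rfl, rfl⟩ | ⟨p, j, hp, rfl, rfl⟩ <;>
    rcases h' with ⟨p', hp', rfl, h⟩ | ⟨p', j', hp', rfl, h⟩ <;>
    simp_all [Fin.ext_iff]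

variable (T) in
/-- The labels of the white and the black half of an edge obtained from the tree by matching the
leaves. -/
def Joined (f : WithBot (LetterPos T.word LeafKind.opening) ≃ LetterPos T.word LeafKind.closing)
    (x y : HalfLabel m) : Prop :=
  T.TreeEdge x y ∨ ∃ s, x = T.openAt s ∧ y = T.closeAt (f s)

section Joined

variable {f : WithBot (LetterPos T.word LeafKind.opening) ≃ LetterPos T.word LeafKind.closing}
  {x x' y y' : HalfLabel m}

theorem Joined.mem_halves (hm : 3 ≤ m) (hT : T ≠ closing) (h : T.Joined f x y) :
    x ∈ T.halves ∧ y ∈ T.halves := by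
  rcases h with h | ⟨s, rfl, rfl⟩
  · exact h.mem_halves
  · exact ⟨openAt_mem_halves hm hT s, closeAt_mem_halves hT _⟩

theorem Joined.color (hT : T ≠ closing) (h : T.Joined f x y) :
    x.2.1 = Color.white ∧ y.2.1 = Color.black := by
  rcases h with h | ⟨s, rfl, rfl⟩
  · exact h.color
  · exact ⟨color_openAt hT s, color_closeAt hT _⟩

theorem Joined.right_unique (hT : T ≠ closing) (h : T.Joined f x y) (h' : T.Joined f x y') :
    y = y' := by
  rcases h with h | ⟨s, rfl, rfl⟩ <;> rcases h' with h' | ⟨s', h1, rfl⟩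
  · exact h.right_unique h'
  · subst h1
    exact absurd h (not_treeEdge_openAt hT _ _)
  · exact absurd h' (not_treeEdge_openAt hT _ _)
  · rw [openAt_injective hT h1]

theorem Joined.left_unique (hT : T ≠ closing) (h : T.Joined f x y) (h' : T.Joined f x' y) :
    x = x' := by
  rcases h with h | ⟨s, rfl, rfl⟩ <;> rcases h' with h' | ⟨s', rfl, h1⟩
  · exact h.left_unique h'
  · subst h1
    exact absurd h (not_treeEdge_closeAt hT _ _)
  · exact absurd h' (not_treeEdge_closeAt hT _ _)
  · rw [f.injective (closeAt_injective hT h1)]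

theorem exists_joined (f : WithBot (LetterPos T.word LeafKind.opening) ≃
    LetterPos T.word LeafKind.closing) (hx : x ∈ T.halves) :
    ∃ y, T.Joined f x y ∨ T.Joined f y x := by
  rcases x.2.1.eq_white_or_black with hc | hc
  · rcases exists_openAt_or_treeEdge hx hc with ⟨s, rfl⟩ | ⟨y, h⟩
    · exact ⟨_, Or.inl (Or.inr ⟨s, rfl, rfl⟩)⟩
    · exact ⟨y, Or.inl (Or.inl h)⟩
  · rcases exists_closeAt_or_treeEdge hx hc with ⟨t, rfl⟩ | ⟨y, h⟩
    · exact ⟨_, Or.inr (Or.inr ⟨f.symm t, rfl, by rw [f.apply_symm_apply]⟩)⟩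
    · exact ⟨y, Or.inr (Or.inl h)⟩

theorem joined_unique (hT : T ≠ closing) (h : T.Joined f x y ∨ T.Joined f y x)
    (h' : T.Joined f x y' ∨ T.Joined f y' x) : y = y' := by
  rcases h with h | h <;> rcases h' with h' | h'
  · exact h.right_unique hT h'
  · exact absurd ((h.color hT).1.symm.trans (h'.color hT).2) (by decide)
  · exact absurd ((h'.color hT).1.symm.trans (h.color hT).2) (by decide)
  · exact h.left_unique hT h'

end Joined

/-- The vertices of the tree are reached from the root along the edges. -/
theorem Occurs.induction {P : List (Fin (m - 1)) → Color → Prop} (h0 : P [] Color.white)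
    (h1 : ∀ p, T.Occurs p → P p Color.white → P p Color.black)
    (h2 : ∀ p j, T.Occurs (p ++ [j]) → P p Color.black → P (p ++ [j]) Color.white)
    {p : List (Fin (m - 1))} (hp : T.Occurs p) (c : Color) : P p c := by
  have h3 : ∀ p, T.Occurs p → P p Color.white := by
    intro p
    induction p using List.reverseRecOn with
    | nil => exact fun _ => h0
    | append_singleton p j ih =>
      exact fun hp => h2 p j hp (h1 p (occurs_of_append hp) (ih (occurs_of_append hp)))
  cases c with
  | white => exact h3 p hp
  | black => exact h1 p hp (h3 p hp)

theorem card_occurs (T : PairTree m) : Nat.card {p // T.Occurs p} = T.size := by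
  induction T with
  | closing =>
    have : IsEmpty {p // (closing : PairTree m).Occurs p} := ⟨fun p => p.2⟩
    rw [Nat.card_of_isEmpty]
    rfl
  | node a child ih =>
    have hfin : ∀ j, Finite {p // (child j).Occurs p} := fun j => (finite_occurs _).to_subtype
    let e : {p // (node a child).Occurs p} ≃ Option (Σ j, {p // (child j).Occurs p}) :=
      { toFun := fun
          | ⟨[], _⟩ => none
          | ⟨j :: p, h⟩ => some ⟨j, p, h⟩
        invFun := fun
          | none => ⟨[], trivial⟩
          | some ⟨j, p, h⟩ => ⟨j :: p, h⟩
        left_inv := by rintro ⟨_ | ⟨j, p⟩, h⟩ <;> rfl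
        right_inv := by rintro (_ | ⟨j, p, h⟩) <;> rfl }
    rw [Nat.card_congr e, Finite.card_option, Nat.card_sigma, size]
    simp only [ih]

end PairTree

/-! ### The map obtained by matching the leaves of a tree -/

namespace PairTree

variable {m i : ℕ} {T : PairTree m}

theorem finite_halves (T : PairTree m) : T.halves.Finite := by
  have h1 : (Set.univ : Set Color).Finite :=
    (Set.toFinite {Color.white, Color.black}).subset fun c _ => c.eq_white_or_black
  refine (T.finite_occurs.prod (h1.prod (Set.finite_lt_nat m))).subset ?_
  rintro ⟨p, c, k⟩ ⟨hp, hk⟩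
  exact ⟨hp, trivial, hk⟩

theorem mk_mem_halves {p : List (Fin (m - 1))} {c : Color} {k : ℕ} (hp : T.Occurs p) (hk : k < m) :
    (p, c, k) ∈ T.halves := ⟨hp, hk⟩

variable (T) in
/-- The next half-edge clockwise around the vertex. -/
def rotation (hm : 3 ≤ m) : Equiv.Perm T.halves where
  toFun x := ⟨(x.1.1, x.1.2.1, (x.1.2.2 + 1) % m),
    mk_mem_halves (mem_halves.1 x.2).1 (Nat.mod_lt _ (by omega))⟩
  invFun x := ⟨(x.1.1, x.1.2.1, (x.1.2.2 + (m - 1)) % m),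
    mk_mem_halves (mem_halves.1 x.2).1 (Nat.mod_lt _ (by omega))⟩
  left_inv x := by
    have h1 : ((x.1.2.2 + 1) % m + (m - 1)) % m = x.1.2.2 := by
      rw [Nat.mod_add_mod, show x.1.2.2 + 1 + (m - 1) = x.1.2.2 + m by omega, Nat.add_mod_right,
        Nat.mod_eq_of_lt (mem_halves.1 x.2).2]
    exact Subtype.ext (Prod.ext rfl (Prod.ext rfl h1))
  right_inv x := by
    have h1 : ((x.1.2.2 + (m - 1)) % m + 1) % m = x.1.2.2 := by
      rw [Nat.mod_add_mod, show x.1.2.2 + (m - 1) + 1 = x.1.2.2 + m by omega, Nat.add_mod_right,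
        Nat.mod_eq_of_lt (mem_halves.1 x.2).2]
    exact Subtype.ext (Prod.ext rfl (Prod.ext rfl h1))

theorem rotation_apply (hm : 3 ≤ m) (x : T.halves) :
    (T.rotation hm x).1 = (x.1.1, x.1.2.1, (x.1.2.2 + 1) % m) := rfl

theorem rotation_pow (hm : 3 ≤ m) (k : ℕ) (x : T.halves) :
    ((T.rotation hm ^ k) x).1 = (x.1.1, x.1.2.1, (x.1.2.2 + k) % m) := by
  induction k with
  | zero =>
    obtain ⟨⟨p, c, l⟩, hp, hl⟩ := x
    simp [Nat.mod_eq_of_lt hl]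
  | succ k ih =>
    rw [pow_succ', Equiv.Perm.mul_apply, rotation_apply, ih, Nat.mod_add_mod, add_assoc]

theorem rotation_pow_of_zero (hm : 3 ≤ m) {p : List (Fin (m - 1))} {c : Color} {k : ℕ}
    (hp : (p, c, k) ∈ T.halves) (h0 : (p, c, 0) ∈ T.halves) :
    (T.rotation hm ^ k) ⟨(p, c, 0), h0⟩ = ⟨(p, c, k), hp⟩ := by
  ext1
  rw [rotation_pow, zero_add, Nat.mod_eq_of_lt hp.2]

theorem sameCycle_rotation_iff (hm : 3 ≤ m) {x y : T.halves} :
    (T.rotation hm).SameCycle x y ↔ x.1.1 = y.1.1 ∧ x.1.2.1 = y.1.2.1 := by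
  have := T.finite_halves.to_subtype
  constructor
  · intro h
    obtain ⟨k, -, rfl⟩ := h.exists_pow_eq'
    rw [rotation_pow]
    exact ⟨rfl, rfl⟩
  · obtain ⟨⟨p, c, k⟩, hp, hk⟩ := x
    obtain ⟨⟨p', c', l⟩, hp', hl⟩ := y
    rintro ⟨h1, h2⟩
    dsimp only at h1 h2
    subst h1 h2
    have h0 : (p, c, 0) ∈ T.halves := mk_mem_halves hp (by omega)
    rw [← rotation_pow_of_zero hm (mk_mem_halves hp hk) h0,
      ← rotation_pow_of_zero hm (mk_mem_halves hp' hl) h0, Equiv.Perm.sameCycle_pow_left, Equiv.Perm.sameCycle_pow_right]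

section Matching

variable (hm : 3 ≤ m) (hT : T ≠ closing)
  (f : WithBot (LetterPos T.word LeafKind.opening) ≃ LetterPos T.word LeafKind.closing)

theorem exists_opposite (hm : 3 ≤ m) (hT : T ≠ closing)
    (f : WithBot (LetterPos T.word LeafKind.opening) ≃ LetterPos T.word LeafKind.closing) (x : T.halves) :
    ∃ y : T.halves, T.Joined f x y ∨ T.Joined f y x := by
  obtain ⟨y, h⟩ := exists_joined f x.2
  exact ⟨⟨y, h.elim (fun h => (h.mem_halves hm hT).2) fun h => (h.mem_halves hm hT).1⟩, h⟩

/-- The other half of an edge, when the leaves are matched. -/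
noncomputable def opposite (x : T.halves) : T.halves := (exists_opposite hm hT f x).choose

theorem opposite_spec (x : T.halves) :
    T.Joined f x (opposite hm hT f x) ∨ T.Joined f (opposite hm hT f x) x :=
  (exists_opposite hm hT f x).choose_spec

theorem opposite_eq {x y : T.halves} (h : T.Joined f x y ∨ T.Joined f y x) :
    opposite hm hT f x = y :=
  Subtype.ext (joined_unique hT (opposite_spec hm hT f x) h)

theorem opposite_involutive : Function.Involutive (opposite hm hT f) := fun x =>
  opposite_eq hm hT f (opposite_spec hm hT f x).symm

theorem color_opposite (x : T.halves) : (opposite hm hT f x).1.2.1 = x.1.2.1.other := by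
  rcases opposite_spec hm hT f x with h | h <;> rw [(h.color hT).1, (h.color hT).2] <;> rfl

theorem opposite_ne (x : T.halves) : opposite hm hT f x ≠ x := fun h => by
  have h1 := color_opposite hm hT f x
  rw [h] at h1
  cases hc : x.1.2.1 <;> rw [hc] at h1 <;> cases h1

/-- The edges of the tree alone connect the map: each vertex is reached from its parent by rotating
around the parent and crossing one edge. -/
theorem mem_closure_rotation_opposite (x : T.halves) :
    ∃ p ∈ Subgroup.closure {T.rotation hm, (opposite_involutive hm hT f).toPerm},
      p ⟨rootLabel, rootLabel_mem_halves hm hT⟩ = x := by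
  set G := Subgroup.closure {T.rotation hm, (opposite_involutive hm hT f).toPerm} with hG
  have hrot : ∀ k : ℕ, T.rotation hm ^ k ∈ G := fun k =>
    pow_mem (Subgroup.subset_closure (by simp)) k
  have hopp : (opposite_involutive hm hT f).toPerm ∈ G := Subgroup.subset_closure (by simp)
  have hstep : ∀ {p : List (Fin (m - 1))} {c : Color} {k : ℕ} (hp : T.Occurs p) (hk : k < m),
      (∃ q ∈ G, q ⟨rootLabel, rootLabel_mem_halves hm hT⟩ = ⟨(p, c, 0), mk_mem_halves hp (by omega)⟩) →
      ∃ q ∈ G, q ⟨rootLabel, rootLabel_mem_halves hm hT⟩ = ⟨(p, c, k), mk_mem_halves hp hk⟩ := by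
    rintro p c k hp hk ⟨q, hq, h⟩
    refine ⟨T.rotation hm ^ k * q, mul_mem (hrot k) hq, ?_⟩
    rw [Equiv.Perm.mul_apply, h, rotation_pow_of_zero]
  have hcross : ∀ {y z : T.halves}, T.Joined f y z ∨ T.Joined f z y →
      (∃ q ∈ G, q ⟨rootLabel, rootLabel_mem_halves hm hT⟩ = y) →
      ∃ q ∈ G, q ⟨rootLabel, rootLabel_mem_halves hm hT⟩ = z := by
    rintro y z h ⟨q, hq, rfl⟩
    exact ⟨_ * q, mul_mem hopp hq, opposite_eq hm hT f h⟩
  obtain ⟨⟨p, c, k⟩, hp, hk⟩ := x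
  dsimp only at hp hk
  refine hstep hp hk ?_
  refine Occurs.induction (T := T) (P := fun p c => ∀ hp : T.Occurs p,
    ∃ q ∈ G, q ⟨rootLabel, rootLabel_mem_halves hm hT⟩ = ⟨(p, c, 0), mk_mem_halves hp (by omega)⟩)
    ?_ ?_ ?_ hp c hp
  · exact fun _ => ⟨1, one_mem _, rfl⟩
  · intro p hp ih _
    have := branch_lt hp
    exact hcross (y := ⟨(p, Color.white, T.branch p + 1), mk_mem_halves hp (by omega)⟩)
      (Or.inl (Or.inl (Or.inl ⟨p, hp, rfl, rfl⟩))) (hstep hp (by omega) (ih hp))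
  · intro p j hp ih _
    exact hcross (y := ⟨(p, Color.black, (j : ℕ) + 1), mk_mem_halves (occurs_of_append hp) (by omega)⟩)
      (Or.inr (Or.inl (Or.inr ⟨p, j, hp, rfl, rfl⟩)))
      (hstep (occurs_of_append hp) (by omega) (ih (occurs_of_append hp)))

end Matching

/-! ### Multiplicities of the half-edges. -/

section Multiplicity

variable (g : LeafClosure T.word i)

/-- The multiplicity of a half-edge. -/
def multOf (x : HalfLabel m) : ℕ := ∑ s, if T.openAt s = x then g.mult s else 0

theorem multOf_openAt (hT : T ≠ closing) (s) : multOf g (T.openAt s) = g.mult s := by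
  rw [multOf, Finset.sum_eq_single s (fun t _ ht => if_neg fun h => ht (openAt_injective hT h))
    (fun h => absurd (Finset.mem_univ s) h), if_pos rfl]

theorem multOf_eq_zero {x : HalfLabel m} (h : ∀ s, T.openAt s ≠ x) : multOf g x = 0 :=
  Finset.sum_eq_zero fun s _ => if_neg (h s)

theorem multOf_black (hT : T ≠ closing) {x : HalfLabel m} (hx : x.2.1 = Color.black) :
    multOf g x = 0 := multOf_eq_zero g fun s h => by
  rw [← h, color_openAt hT] at hx
  cases hx

theorem multOf_of_treeEdge (hT : T ≠ closing) {x y : HalfLabel m} (h : T.TreeEdge x y) :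
    multOf g x = 0 := multOf_eq_zero g fun s hs =>
  not_treeEdge_openAt hT s y (hs ▸ h)

end Multiplicity

/-- The map obtained by matching the leaves of the tree, the root leaf included. -/
noncomputable def glue (hm : 3 ≤ m) (hT : T ≠ closing) (g : LeafClosure T.word i) : MarkedMap m where
  D := T.halves
  finite := T.finite_halves.to_subtype
  σ := T.rotation hm
  opp := (opposite_involutive hm hT g.partner).toPerm
  opp_opp := opposite_involutive hm hT g.partner
  opp_ne := opposite_ne hm hT g.partner
  connected := fun x y => by
    obtain ⟨p, hp, rfl⟩ := mem_closure_rotation_opposite hm hT g.partner x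
    obtain ⟨q, hq, rfl⟩ := mem_closure_rotation_opposite hm hT g.partner y
    exact ⟨q * p⁻¹, mul_mem hq (inv_mem hp), by simp⟩
  regular := fun v => by
    induction v using Quotient.inductionOn with
    | h x =>
      obtain ⟨⟨p, c, k⟩, hp, hk⟩ := x
      have e : {h : T.halves // vertexOf (T.rotation hm) h =
          vertexOf (T.rotation hm) ⟨(p, c, k), mk_mem_halves hp hk⟩} ≃ Fin m :=
        { toFun := fun h => ⟨h.1.1.2.2, (mem_halves.1 h.1.2).2⟩
          invFun := fun l => ⟨⟨(p, c, l), mk_mem_halves hp l.2⟩,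
            (Quotient.eq (r := Equiv.Perm.SameCycle.setoid _)).2
              ((sameCycle_rotation_iff hm).2 ⟨rfl, rfl⟩)⟩
          left_inv := by
            rintro ⟨⟨⟨p', c', l⟩, hp', hl⟩, h⟩
            obtain ⟨h1, h2⟩ := (sameCycle_rotation_iff hm).1
              ((Quotient.eq (r := Equiv.Perm.SameCycle.setoid _)).1 h)
            dsimp only at h1 h2
            subst h1 h2
            rfl
          right_inv := fun l => rfl }
      exact (Nat.card_congr e).trans (by simp)
  color := Quotient.lift (fun x => x.1.2.1) fun x y h => ((sameCycle_rotation_iff hm).1 h).2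
  bipartite := color_opposite hm hT g.partner
  root := ⟨rootLabel, rootLabel_mem_halves hm hT⟩
  root_white := rfl
  mult := fun x => multOf g x.1
  mult_opp := fun x hx => by
    refine multOf_black g hT ?_
    rcases x.1.2.1.eq_white_or_black with h | h
    · refine (color_opposite hm hT g.partner x).trans ?_
      rw [h]
      rfl
    · exact absurd (multOf_black g hT h) hx

end PairTree

/-! ### The tree of a map obtained by matching leaves -/

namespace MarkedMap

open PairTree

variable {m : ℕ} {T : PairTree m}

theorem leafList_eq_ofFn (M : MarkedMap m) (hT : T ≠ closing) (h : M.D) :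
    M.leafList T h = List.ofFn fun t => M.place T h (T.labelAt t) := by
  rw [leafList, ← ofFn_labelAt hT, List.map_ofFn]
  rfl

end MarkedMap

namespace PairTree

open MarkedMap

variable {m i : ℕ} {T : PairTree m} {hm : 3 ≤ m} {hT : T ≠ closing} {g : LeafClosure T.word i}

/-- A half-edge of the map obtained by matching the leaves of a tree. -/
def glueHalf (hm : 3 ≤ m) (hT : T ≠ closing) (g : LeafClosure T.word i) {x : HalfLabel m}
    (hx : x ∈ T.halves) : (glue hm hT g).D := ⟨x, hx⟩

theorem exists_glueHalf (h : (glue hm hT g).D) : ∃ x, ∃ hx : x ∈ T.halves, h = glueHalf hm hT g hx :=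
  ⟨h.1, h.2, rfl⟩

theorem glueHalf_inj {x y : HalfLabel m} {hx : x ∈ T.halves} {hy : y ∈ T.halves} :
    glueHalf hm hT g hx = glueHalf hm hT g hy ↔ x = y := Subtype.ext_iff

theorem vtx_glueHalf_eq_iff {x y : HalfLabel m} {hx : x ∈ T.halves} {hy : y ∈ T.halves} :
    (glue hm hT g).vtx (glueHalf hm hT g hx) = (glue hm hT g).vtx (glueHalf hm hT g hy) ↔
      x.1 = y.1 ∧ x.2.1 = y.2.1 :=
  (vtx_eq_iff _).trans (sameCycle_rotation_iff hm)

theorem col_glueHalf {x : HalfLabel m} (hx : x ∈ T.halves) :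
    (glue hm hT g).col (glueHalf hm hT g hx) = x.2.1 := rfl

theorem mult_glueHalf {x : HalfLabel m} (hx : x ∈ T.halves) :
    (glue hm hT g).mult (glueHalf hm hT g hx) = multOf g x := rfl

theorem root_glue : (glue hm hT g).root = glueHalf hm hT g (rootLabel_mem_halves hm hT) := rfl

theorem opp_glueHalf {x y : HalfLabel m} {hx : x ∈ T.halves} {hy : y ∈ T.halves}
    (h : T.Joined g.partner x y ∨ T.Joined g.partner y x) :
    (glue hm hT g).opp (glueHalf hm hT g hx) = glueHalf hm hT g hy :=
  opposite_eq hm hT g.partner h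

theorem rot_pow_glueHalf {p : List (Fin (m - 1))} {c : Color} {k : ℕ}
    (hp : (p, c, k) ∈ T.halves) (h0 : (p, c, 0) ∈ T.halves) :
    ((glue hm hT g).σ ^ k) (glueHalf hm hT g h0) = glueHalf hm hT g hp :=
  rotation_pow_of_zero hm hp h0

theorem base_glue {p : List (Fin (m - 1))} (hp : T.Occurs p) (c : Color) :
    (glue hm hT g).base T (glue hm hT g).root p c =
      glueHalf hm hT g (mk_mem_halves hp (by omega) : (p, c, 0) ∈ T.halves) := by
  refine Occurs.induction (T := T) (P := fun p c => ∀ hp : T.Occurs p,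
    (glue hm hT g).base T (glue hm hT g).root p c =
      glueHalf hm hT g (mk_mem_halves hp (by omega) : (p, c, 0) ∈ T.halves)) ?_ ?_ ?_ hp c hp
  · intro _
    cases T with
    | closing => exact absurd rfl hT
    | node a child => rfl
  · intro p hp ih _
    have := branch_lt hp
    rw [base_black _ hp, ih hp,
      rot_pow_glueHalf (mk_mem_halves hp (by omega) : (p, Color.white, T.branch p + 1) ∈ T.halves)]
    exact opp_glueHalf (Or.inl (Or.inl (Or.inl ⟨p, hp, rfl, rfl⟩)))
  · intro p j hp ih _
    rw [base_append_singleton _ hp, ih (occurs_of_append hp), rot_pow_glueHalf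
      (mk_mem_halves (occurs_of_append hp) (by omega) : (p, Color.black, (j : ℕ) + 1) ∈ T.halves)]
    exact opp_glueHalf (Or.inr (Or.inl (Or.inr ⟨p, j, hp, rfl, rfl⟩)))

/-- Placing a tree in its own glued map gives each label back, so the tree explores that map
tautologically. -/
theorem place_glue {x : HalfLabel m} (hx : x ∈ T.halves) :
    (glue hm hT g).place T (glue hm hT g).root x = glueHalf hm hT g hx := by
  rw [place, base_glue (mem_halves.1 hx).1]
  exact rot_pow_glueHalf (p := x.1) (c := x.2.1) (k := x.2.2) hx _

variable (hm hT g) in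
theorem exploresAll_glue : (glue hm hT g).ExploresAll T where
  bijOn := by
    refine ⟨fun x hx => Color.eq_white_or_black _, fun x hx y hy h => ?_, fun h _ => ?_⟩
    · rwa [place_glue hx, place_glue hy, glueHalf_inj] at h
    · obtain ⟨x, hx, rfl⟩ := exists_glueHalf h
      exact ⟨x, hx, place_glue hx⟩
  unmarked_pair := fun p hp => by
    have := branch_lt hp
    have h1 : (p, Color.white, T.branch p + 1) ∈ T.halves := mk_mem_halves hp (by omega)
    have h2 := place_glue (hm := hm) (hT := hT) (g := g) h1
    rw [place] at h2
    rw [h2, mult_glueHalf]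
    exact multOf_of_treeEdge g hT (Or.inl ⟨p, hp, rfl, rfl⟩)
  unmarked_child := fun p j hp => by
    rw [base_glue hp, mult_glueHalf]
    exact multOf_of_treeEdge g hT (Or.inr ⟨p, j, hp, rfl, rfl⟩)
  pairwise := by
    rw [leafList_eq_ofFn _ hT, List.pairwise_ofFn]
    intro t s hts hopp hcol
    have ht := (isLeafLabel_labelAt hT t).mem_halves
    have hs := (isLeafLabel_labelAt hT s).mem_halves
    simp only [place_glue ht, place_glue hs] at hopp hcol ⊢
    rw [col_glueHalf] at hcol
    obtain ⟨y, hy⟩ := (isLeafLabel_labelAt hT s).exists_openAt hcol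
    have h1 : (glue hm hT g).opp (glueHalf hm hT g hs) =
        glueHalf hm hT g (closeAt_mem_halves hT (g.partner y)) :=
      opp_glueHalf (Or.inl (Or.inr ⟨y, hy.symm, rfl⟩))
    rw [h1, glueHalf_inj] at hopp
    have h2 : t = (g.partner y).1 := labelAt_injective hT hopp.symm
    have h3 : s = y.1 := labelAt_injective hT hy.symm
    rw [mult_glueHalf, ← hy, multOf_openAt g hT]
    -- The closing leaf comes before its opening partner, which is exactly where a weighted matching
    -- must have nonzero multiplicity.
    refine g.mult_ne_zero _ WithBot.coe_ne_bot fun h => ?_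
    have h4 := h y rfl
    rw [← h2, ← h3] at h4
    exact lt_asymm h4 hts

theorem totalMult_glue : (glue hm hT g).totalMult = ∑ s, g.mult s := by
  have := Fintype.ofFinite (glue hm hT g).D
  have h1 : (glue hm hT g).totalMult = ∑ x : (glue hm hT g).D, multOf g x.1 :=
    finsum_eq_sum_of_fintype _
  rw [h1]
  simp only [multOf]
  -- After exchanging the sums, each opening or root leaf contributes at its own half-edge only.
  rw [Finset.sum_comm]
  refine Finset.sum_congr rfl fun s _ => ?_
  rw [Finset.sum_eq_single (glueHalf hm hT g (openAt_mem_halves hm hT s))]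
  · exact if_pos rfl
  · exact fun x _ hx => if_neg fun h => hx (Subtype.ext h.symm)
  · exact fun h => absurd (Finset.mem_univ _) h

theorem blackVertices_glue : (glue hm hT g).blackVertices = T.size := by
  rw [← card_occurs]
  have hmem : ∀ {p : List (Fin (m - 1))}, T.Occurs p → (p, Color.black, 0) ∈ T.halves :=
    fun hp => mk_mem_halves hp (by omega)
  refine (Nat.card_congr (Equiv.ofBijective
    (fun p : {p // T.Occurs p} => (⟨(glue hm hT g).vtx (glueHalf hm hT g (hmem p.2)), rfl⟩ :
      {v : MapVertex (glue hm hT g).σ // (glue hm hT g).color v = Color.black})) ⟨?_, ?_⟩)).symm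
  · rintro ⟨p, hp⟩ ⟨q, hq⟩ h
    exact Subtype.ext (vtx_glueHalf_eq_iff.1 (congrArg Subtype.val h)).1
  · rintro ⟨v, hv⟩
    induction v using Quotient.inductionOn with
    | h x =>
      obtain ⟨x, hx, rfl⟩ := exists_glueHalf x
      exact ⟨⟨x.1, (mem_halves.1 hx).1⟩, Subtype.ext (vtx_glueHalf_eq_iff.2 ⟨rfl, hv.symm⟩)⟩

theorem outdegree_eq_one {M : MarkedMap m} {O : Set M.D} {v : MapVertex M.σ} {x : M.D}
    (hx : M.vtx x = v) (hxO : x ∈ O) (h : ∀ y, M.vtx y = v → y ∈ O → y = x) :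
    M.outdegree O v = 1 :=
  Nat.card_eq_one_iff_unique.2
    ⟨⟨fun y z => Subtype.ext ((h y.1 y.2.1 y.2.2).trans (h z.1 z.2.1 z.2.2).symm)⟩, ⟨x, hx, hxO⟩⟩

variable (hm hT g) in
/-- The orientation of the map from the tree: the edges of the tree are oriented towards the root,
and a white half-edge is outgoing unless it leads to the black child. -/
def glueOrientation : Set (glue hm hT g).D :=
  {h | (h.1.2.1 = Color.white ∧ h.1.2.2 ≠ T.branch h.1.1 + 1) ∨
    (h.1.2.1 = Color.black ∧ h.1.2.2 = 0)}

theorem mem_glueOrientation {x : HalfLabel m} {hx : x ∈ T.halves} :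
    glueHalf hm hT g hx ∈ glueOrientation hm hT g ↔
      (x.2.1 = Color.white ∧ x.2.2 ≠ T.branch x.1 + 1) ∨ (x.2.1 = Color.black ∧ x.2.2 = 0) := Iff.rfl

/-- Rank `0` at the black end and rank `branch + 1` at the white end are the two ends of the edge
inside a pair; these edges alone go from black to white. -/
theorem glueOrientation_of_joined {x y : HalfLabel m} {hx : x ∈ T.halves} {hy : y ∈ T.halves}
    (h : T.Joined g.partner x y) :
    glueHalf hm hT g hy ∈ glueOrientation hm hT g ↔ glueHalf hm hT g hx ∉ glueOrientation hm hT g := by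
  rw [mem_glueOrientation, mem_glueOrientation]
  obtain ⟨hxc, hyc⟩ := h.color hT
  have key : y.2.2 = 0 ↔ x.2.2 = T.branch x.1 + 1 := by
    rcases h with (⟨p, hp, rfl, rfl⟩ | ⟨p, j, hp, rfl, rfl⟩) | ⟨s, rfl, rfl⟩
    · simp
    · simp
    · have h1 : (T.closeAt (g.partner s)).2.2 ≠ 0 := by
        have h2 := (isLeafLabel_labelAt hT (g.partner s).1).2
        rw [show (T.labelAt (g.partner s).1).2.1 = Color.black from hyc] at h2
        obtain ⟨j, h3, -⟩ := h2
        intro h4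
        rw [closeAt] at h4
        omega
      have h5 : (T.openAt s).2.2 ≠ T.branch (T.openAt s).1 + 1 := by
        induction s with
        | bot => exact fun h => by simp [openAt, rootLabel] at h
        | coe s =>
          have h2 := (isLeafLabel_labelAt hT s.1).2
          rw [show (T.labelAt s.1).2.1 = Color.white from hxc] at h2
          exact h2.2.2
      exact iff_of_false h1 h5
  rw [hxc, hyc, key]
  simp

theorem isOneOrientation_glue : (glue hm hT g).IsOneOrientation (glueOrientation hm hT g) := by
  constructor
  · intro h
    obtain ⟨x, hx, rfl⟩ := exists_glueHalf h
    obtain ⟨y, hy⟩ := exists_joined g.partner hx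
    rcases hy with hy | hy
    · rw [opp_glueHalf (hy := (hy.mem_halves hm hT).2) (Or.inl hy)]
      exact glueOrientation_of_joined hy
    · rw [opp_glueHalf (hy := (hy.mem_halves hm hT).1) (Or.inr hy), ← not_iff_not, not_not]
      exact (glueOrientation_of_joined hy).symm
  · intro v
    induction v using Quotient.inductionOn with
    | h x =>
      obtain ⟨⟨p, c, k⟩, hx, rfl⟩ := exists_glueHalf x
      have hp : T.Occurs p := hx.1
      have hb := branch_lt hp
      change (glue hm hT g).outdegree _ ((glue hm hT g).vtx (glueHalf hm hT g hx)) =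
        match (glue hm hT g).col (glueHalf hm hT g hx) with
          | Color.white => m - 1
          | Color.black => 1
      rw [col_glueHalf]
      cases c with
      | white =>
        have h1 := outdegree_add_indegree (M := glue hm hT g) (O := glueOrientation hm hT g)
          ((glue hm hT g).vtx (glueHalf hm hT g hx))
        have h2 : (glue hm hT g).outdegree (glueOrientation hm hT g)ᶜ
            ((glue hm hT g).vtx (glueHalf hm hT g hx)) = 1 := by
          refine outdegree_eq_one (x := glueHalf hm hT g
              (mk_mem_halves hp (by omega) : (p, Color.white, T.branch p + 1) ∈ T.halves))
            (vtx_glueHalf_eq_iff.2 ⟨rfl, rfl⟩)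
            (by rw [Set.mem_compl_iff, mem_glueOrientation]; simp) ?_
          intro y hy hyO
          obtain ⟨⟨p', c', k'⟩, hy', rfl⟩ := exists_glueHalf y
          obtain ⟨h2, h3⟩ := vtx_glueHalf_eq_iff.1 hy
          dsimp only at h2 h3
          subst h2 h3
          rw [Set.mem_compl_iff, mem_glueOrientation] at hyO
          rw [glueHalf_inj]
          simpa using hyO
        rw [h2] at h1
        dsimp only
        omega
      | black =>
        refine outdegree_eq_one (x := glueHalf hm hT g
            (mk_mem_halves hp (by omega) : (p, Color.black, 0) ∈ T.halves))
          (vtx_glueHalf_eq_iff.2 ⟨rfl, rfl⟩) (Or.inr ⟨rfl, rfl⟩) ?_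
        intro y hy hyO
        obtain ⟨⟨p', c', k'⟩, hy', rfl⟩ := exists_glueHalf y
        obtain ⟨h2, h3⟩ := vtx_glueHalf_eq_iff.1 hy
        dsimp only at h2 h3
        subst h2 h3
        rw [mem_glueOrientation] at hyO
        rw [glueHalf_inj]
        simpa using hyO

theorem isCompatible_glue : (glue hm hT g).IsCompatible (glueOrientation hm hT g) := by
  intro h hmult
  obtain ⟨x, hx, rfl⟩ := exists_glueHalf h
  rw [mult_glueHalf] at hmult
  rw [mem_glueOrientation]
  rcases x.2.1.eq_white_or_black with hc | hc
  · refine Or.inl ⟨hc, fun hb => hmult ?_⟩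
    exact multOf_of_treeEdge g hT (y := (x.1, Color.black, 0))
      (Or.inl ⟨x.1, (mem_halves.1 hx).1, Prod.ext rfl (Prod.ext hc hb), rfl⟩)
  · exact absurd (multOf_black g hT hc) hmult

theorem not_isMarked_glue {x y : HalfLabel m} (hx : x ∈ T.halves) (hy : y ∈ T.halves)
    (h : T.TreeEdge x y) :
    ¬ (glue hm hT g).IsMarked (glueHalf hm hT g hx) ∧
      ¬ (glue hm hT g).IsMarked (glueHalf hm hT g hy) := by
  unfold IsMarked
  rw [opp_glueHalf (hy := hy) (Or.inl (Or.inl h)), opp_glueHalf (hy := hx) (Or.inr (Or.inl h)),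
    mult_glueHalf, mult_glueHalf, multOf_of_treeEdge g hT h, multOf_black g hT h.color.2]
  simp

/-- Tree edges are unmarked and oriented towards the root, so climbing the tree gives the paths. -/
theorem isRootAccessible_glue : (glue hm hT g).IsRootAccessible (glueOrientation hm hT g) := by
  intro v
  induction v using Quotient.inductionOn with
  | h x =>
    obtain ⟨⟨p, c, k⟩, hx, rfl⟩ := exists_glueHalf x
    have hp : T.Occurs p := hx.1
    have hmem : ∀ {p : List (Fin (m - 1))} {c : Color}, T.Occurs p → (p, c, 0) ∈ T.halves :=
      fun hp => mk_mem_halves hp (by omega)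
    have h1 : (glue hm hT g).vtx (glueHalf hm hT g hx) =
      (glue hm hT g).vtx (glueHalf hm hT g (hmem hp)) := vtx_glueHalf_eq_iff.2 ⟨rfl, rfl⟩
    change Relation.ReflTransGen _ ((glue hm hT g).vtx (glueHalf hm hT g hx)) _
    rw [h1]
    refine Occurs.induction (T := T) (P := fun p c => ∀ hp : T.Occurs p,
      Relation.ReflTransGen ((glue hm hT g).UnmarkedStep (glueOrientation hm hT g))
        ((glue hm hT g).vtx (glueHalf hm hT g (hmem hp : (p, c, 0) ∈ T.halves)))
        (glue hm hT g).rootVertex) ?_ ?_ ?_ hp c hp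
    · exact fun _ => Relation.ReflTransGen.refl
    · intro p hp ih _
      have := branch_lt hp
      have h2 : (p, Color.white, T.branch p + 1) ∈ T.halves := mk_mem_halves hp (by omega)
      have h3 : T.TreeEdge (p, Color.white, T.branch p + 1) (p, Color.black, 0) :=
        Or.inl ⟨p, hp, rfl, rfl⟩
      refine Relation.ReflTransGen.head ⟨glueHalf hm hT g (hmem hp), Or.inr ⟨rfl, rfl⟩,
        (not_isMarked_glue h2 _ h3).2, rfl, ?_⟩ (ih hp)
      rw [opp_glueHalf (hy := h2) (Or.inr (Or.inl h3))]
      exact vtx_glueHalf_eq_iff.2 ⟨rfl, rfl⟩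
    · intro p j hp ih _
      have hq := occurs_of_append hp
      have h2 : (p, Color.black, (j : ℕ) + 1) ∈ T.halves := mk_mem_halves hq (by omega)
      have h3 : T.TreeEdge (p ++ [j], Color.white, 0) (p, Color.black, (j : ℕ) + 1) :=
        Or.inr ⟨p, j, hp, rfl, rfl⟩
      refine Relation.ReflTransGen.head ⟨glueHalf hm hT g (hmem hp), Or.inl ⟨rfl, ?_⟩,
        (not_isMarked_glue _ h2 h3).1, rfl, ?_⟩ (ih hq)
      · exact (Nat.succ_ne_zero _).symm
      · rw [opp_glueHalf (hy := h2) (Or.inl (Or.inl h3))]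
        exact vtx_glueHalf_eq_iff.2 ⟨rfl, rfl⟩

section Rightmost

variable {child : Fin (m - 1) → PairTree m}

/-- The root's black child is rightmost, so the ingoing half-edge at the root vertex has rank `(m -
2) + 1 = m - 1`, just before the root half-edge. -/
theorem isAdmissible_glue (hm : 3 ≤ m) (g : LeafClosure (node (lastPos hm) child).word i) :
    (glue hm (by simp) g).IsAdmissible := by
  refine ⟨glueOrientation hm (by simp) g, isOneOrientation_glue, isCompatible_glue,
    isRootAccessible_glue, fun h hh => ?_⟩
  obtain ⟨⟨p, c, k⟩, hx, rfl⟩ := exists_glueHalf h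
  obtain ⟨h1, h2⟩ := vtx_glueHalf_eq_iff.1 (hh.trans (congrArg _ root_glue))
  dsimp only [rootLabel] at h1 h2
  subst h1 h2
  have h3 : (([], Color.white, m - 1) : HalfLabel m) ∈ (node (lastPos hm) child).halves :=
    mk_mem_halves trivial (by omega)
  rw [← rot_pow_pred hm, root_glue]
  have h4 := rot_pow_glueHalf (hm := hm) (hT := by simp) (g := g) h3 (rootLabel_mem_halves hm (by simp))
  change _ ↔ _ = (((glue hm _ g).σ ^ (m - 1)) (glueHalf hm _ g _) : (glue hm _ g).D)
  refine Iff.trans ?_ (Eq.congr_right h4.symm)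
  rw [glueHalf_inj, mem_glueOrientation]
  simp only [branch, lastPos, Prod.mk.injEq, true_and, reduceCtorEq, false_and, or_false, not_not]
  omega

theorem isTreeOf_glue (hm : 3 ≤ m) (g : LeafClosure (node (lastPos hm) child).word i) :
    IsTreeOf hm (glue hm (by simp) g) child where
  mult_black := fun x hx => multOf_black g (by simp) hx
  explores := exploresAll_glue hm (by simp) g

end Rightmost

end PairTree

/-! ### Classification of the admissible maps -/

namespace MarkedMap

open PairTree

variable {m i : ℕ}

/-! ### Transport of trees along isomorphisms of maps. -/

section Iso

variable {M M' : MarkedMap m} {e : M.D ≃ M'.D}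

theorem rot_pow_comm (h1 : ∀ h, e (M.σ h) = M'.σ (e h)) (k : ℕ) (h : M.D) :
    e ((M.σ ^ k) h) = (M'.σ ^ k) (e h) := by
  induction k with
  | zero => rfl
  | succ k ih => rw [pow_succ', pow_succ', Equiv.Perm.mul_apply, h1, ih, Equiv.Perm.mul_apply]

theorem base_comm (h1 : ∀ h, e (M.σ h) = M'.σ (e h)) (h2 : ∀ h, e (M.opp h) = M'.opp (e h))
    (T : PairTree m) (h : M.D) (p : List (Fin (m - 1))) (c : Color) :
    e (M.base T h p c) = M'.base T (e h) p c := by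
  have hb : ∀ h a, e (M.blackHalf h a) = M'.blackHalf (e h) a := fun h a => by
    rw [blackHalf, h2, rot_pow_comm h1]
    rfl
  induction T generalizing h p with
  | closing => rfl
  | node a child ih =>
    cases p with
    | nil =>
      cases c with
      | white => rfl
      | black => exact hb h a
    | cons j p =>
      refine (ih j (M.childHalf h a j) p).trans ?_
      rw [childHalf, h2, rot_pow_comm h1, hb]
      rfl

theorem place_comm (h1 : ∀ h, e (M.σ h) = M'.σ (e h)) (h2 : ∀ h, e (M.opp h) = M'.opp (e h))
    (T : PairTree m) (h : M.D) (x : HalfLabel m) : e (M.place T h x) = M'.place T (e h) x := by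
  rw [place, rot_pow_comm h1, base_comm h1 h2, place]

theorem Iso.isTreeOf {hm : 3 ≤ m} {child : Fin (m - 1) → PairTree m} (h : Iso M M')
    (hM : IsTreeOf hm M child) : IsTreeOf hm M' child := by
  obtain ⟨e, h1, h2, h3, h4, h5⟩ := h
  have hcol : ∀ x, M'.col (e x) = M.col x := h4
  refine ⟨fun x hx => ?_, ⟨?_, fun p hp => ?_, fun p j hp => ?_, ?_⟩⟩
  · rw [← e.apply_symm_apply x, h5]
    apply hM.mult_black
    rw [← hcol, e.apply_symm_apply, hx]
  · refine ⟨fun x _ => Color.eq_white_or_black _, fun x hx y hy h => ?_, fun x _ => ?_⟩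
    · rw [← h3, ← place_comm h1 h2, ← place_comm h1 h2] at h
      exact hM.explores.bijOn.injOn hx hy (e.injective h)
    · obtain ⟨l, hl, h⟩ := hM.explores.bijOn.surjOn
        (Color.eq_white_or_black (M.color (M.vtx (e.symm x))))
      exact ⟨l, hl, by rw [← h3, ← place_comm h1 h2, h, e.apply_symm_apply]⟩
  · rw [← h3, ← base_comm h1 h2, ← rot_pow_comm h1, h5]
    exact hM.explores.unmarked_pair p hp
  · rw [← h3, ← base_comm h1 h2, h5]
    exact hM.explores.unmarked_child p j hp
  · have h6 := hM.explores.pairwise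
    rw [leafList_eq_ofFn _ (by simp), List.pairwise_ofFn] at h6 ⊢
    intro s t hst hopp hc
    rw [← h3, ← place_comm h1 h2] at hopp hc ⊢
    rw [← place_comm h1 h2, ← h2] at hopp
    rw [h5]
    exact h6 hst (e.injective hopp) ((hcol _).symm.trans hc)

end Iso

/-- A map explored by a tree is obtained from it by matching the leaves. -/
theorem ExploresAll.exists_iso_glue {M : MarkedMap m} {T : PairTree m} (hm : 3 ≤ m)
    (hT : T ≠ closing) (hex : M.ExploresAll T) (hblack : ∀ x, M.col x = Color.black → M.mult x = 0)
    (hi : M.totalMult < i) : ∃ g : LeafClosure T.word i, Iso (glue hm hT g) M := by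
  have hcol : ∀ {x}, x ∈ T.halves → M.col (M.place T M.root x) = x.2.1 := fun hx =>
    M.col_place M.root_white (mem_halves.1 hx).1
  -- The other end of a cut edge is black. If it were not a closing leaf, it would lie on a tree
  -- edge, whose white end would then be the opening or root leaf.
  have hfwd : ∀ s, ∃ t, M.opp (M.place T M.root (T.openAt s)) = M.place T M.root (T.closeAt t) := by
    intro s
    obtain ⟨y, hy, h⟩ := Explores.exists_place hex (M.opp (M.place T M.root (T.openAt s)))
    have hc : y.2.1 = Color.black := by
      rw [← hcol hy, h, col_opp, hcol (openAt_mem_halves hm hT s), color_openAt hT]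
      rfl
    rcases exists_closeAt_or_treeEdge hy hc with ⟨t, rfl⟩ | ⟨x, hx⟩
    · exact ⟨t, h.symm⟩
    · rw [← opp_place_of_treeEdge hx] at h
      have h1 := Explores.place_injective hex hx.mem_halves.1 (openAt_mem_halves hm hT s)
        (M.opp_injective h)
      rw [h1] at hx
      exact absurd hx (not_treeEdge_openAt hT s y)
  have hbwd : ∀ t, ∃ s, M.opp (M.place T M.root (T.openAt s)) = M.place T M.root (T.closeAt t) := by
    intro t
    obtain ⟨x, hx, h⟩ := Explores.exists_place hex (M.opp (M.place T M.root (T.closeAt t)))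
    have hc : x.2.1 = Color.white := by
      rw [← hcol hx, h, col_opp, hcol (closeAt_mem_halves hT t), color_closeAt hT]
      rfl
    rcases exists_openAt_or_treeEdge hx hc with ⟨s, rfl⟩ | ⟨y, hy⟩
    · exact ⟨s, by rw [h, M.opp_opp]⟩
    · have h1 := congrArg M.opp h
      rw [opp_place_of_treeEdge hy, M.opp_opp] at h1
      have h2 := Explores.place_injective hex hy.mem_halves.2 (closeAt_mem_halves hT t) h1
      rw [h2] at hy
      exact absurd hy (not_treeEdge_closeAt hT t x)
  choose f hf using hfwd
  have hinj : Function.Injective f := fun s s' h => by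
    have h1 := (hf s).trans ((congrArg _ (congrArg _ h)).trans (hf s').symm)
    exact openAt_injective hT (Explores.place_injective hex (openAt_mem_halves hm hT s)
      (openAt_mem_halves hm hT s') (M.opp_injective h1))
  have hsurj : Function.Surjective f := fun t => by
    obtain ⟨s, hs⟩ := hbwd t
    exact ⟨s, closeAt_injective hT (Explores.place_injective hex (closeAt_mem_halves hT _)
      (closeAt_mem_halves hT t) ((hf s).symm.trans hs))⟩
  let g : LeafClosure T.word i :=
    { partner := Equiv.ofBijective f ⟨hinj, hsurj⟩
      mult := fun s => M.mult (M.place T M.root (T.openAt s))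
      mult_ne_zero := fun s hs hrel => by
        induction s with
        | bot => exact absurd rfl hs
        | coe s =>
          -- The opening leaf does not precede its partner, so the order condition of the
          -- exploration makes the edge marked.
          have h1 : ¬ s.1 < (f s).1 := fun h => hrel fun x hx => by
            rwa [← WithBot.coe_inj.1 hx]
          have h2 : (f s).1 ≠ s.1 := fun h => by
            have h3 := (f s).2
            rw [h, s.2] at h3
            cases h3
          have h4 := hex.pairwise
          rw [leafList_eq_ofFn _ hT, List.pairwise_ofFn] at h4
          exact h4 (lt_of_le_of_ne (not_lt.1 h1) h2) (hf s)
            ((hcol (openAt_mem_halves hm hT s)).trans (color_openAt hT s))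
      sum_lt := by
        have := Fintype.ofFinite M.D
        have h1 : M.totalMult = ∑ x, M.mult x := finsum_eq_sum_of_fintype _
        -- Opening and root leaves are placed at distinct half-edges, so their multiplicities are
        -- part of the total.
        refine lt_of_le_of_lt ?_ (h1 ▸ hi)
        let φ : WithBot (LetterPos T.word LeafKind.opening) ↪ M.D :=
          ⟨fun s => M.place T M.root (T.openAt s), fun s s' h => openAt_injective hT
            (Explores.place_injective hex (openAt_mem_halves hm hT s)
              (openAt_mem_halves hm hT s') h)⟩
        exact (Finset.sum_map Finset.univ φ M.mult).symm.trans_le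
          (Finset.sum_le_sum_of_subset (Finset.subset_univ _)) }
  have hopp : ∀ {x y}, T.Joined g.partner x y →
      M.opp (M.place T M.root x) = M.place T M.root y := by
    rintro x y (h | ⟨s, rfl, rfl⟩)
    · exact opp_place_of_treeEdge h _
    · exact hf s
  let e : (glue hm hT g).D ≃ M.D :=
    Equiv.ofBijective (fun x => M.place T M.root x.1)
      ⟨fun x y h => Subtype.ext (Explores.place_injective hex x.2 y.2 h), fun x => by
        obtain ⟨l, hl, h⟩ := Explores.exists_place hex x
        exact ⟨glueHalf hm hT g hl, h⟩⟩
  have he : ∀ {x} (hx : x ∈ T.halves), e (glueHalf hm hT g hx) = M.place T M.root x := fun _ => rfl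
  refine ⟨g, e, fun h => ?_, fun h => ?_, ?_, fun h => ?_, fun h => ?_⟩
  · obtain ⟨x, hx, rfl⟩ := exists_glueHalf h
    change M.place T M.root (x.1, x.2.1, (x.2.2 + 1) % m) = M.σ (M.place T M.root x)
    rw [place, rot_pow_mod, pow_succ', Equiv.Perm.mul_apply]
    rfl
  · obtain ⟨x, hx, rfl⟩ := exists_glueHalf h
    obtain ⟨y, hy⟩ := exists_joined g.partner hx
    have hyT : y ∈ T.halves :=
      hy.elim (fun h => (h.mem_halves hm hT).2) fun h => (h.mem_halves hm hT).1
    rw [opp_glueHalf (hy := hyT) hy, he, he]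
    rcases hy with hy | hy
    · exact (hopp hy).symm
    · rw [← hopp hy, M.opp_opp]
  · rw [root_glue, he]
    cases T with
    | closing => exact absurd rfl hT
    | node a child => rfl
  · obtain ⟨x, hx, rfl⟩ := exists_glueHalf h
    exact hcol hx
  · obtain ⟨x, hx, rfl⟩ := exists_glueHalf h
    rw [he, mult_glueHalf]
    rcases x.2.1.eq_white_or_black with hc | hc
    · rcases exists_openAt_or_treeEdge hx hc with ⟨s, rfl⟩ | ⟨y, hy⟩
      · rw [multOf_openAt g hT]
      · rw [multOf_of_treeEdge g hT hy, Explores.unmarked_of_treeEdge hex hy]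
    · rw [multOf_black g hT hc]
      exact hblack _ ((hcol hx).trans hc)

end MarkedMap

namespace PairTree

open MarkedMap

variable {m i : ℕ}

/-- An isomorphism preserves the root and commutes with placing, so it fixes every label; the
matching and the multiplicities are then read off the labels. -/
theorem eq_of_iso_glue {T : PairTree m} {hm : 3 ≤ m} {hT : T ≠ closing} {g g' : LeafClosure T.word i}
    (h : Iso (glue hm hT g) (glue hm hT g')) : g = g' := by
  obtain ⟨e, h1, h2, h3, -, h5⟩ := h
  have he : ∀ {x} (hx : x ∈ T.halves), e (glueHalf hm hT g hx) = glueHalf hm hT g' hx := fun hx => by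
    rw [← place_glue hx, place_comm h1 h2, h3, place_glue hx]
  refine WeightedMatching.ext' (Equiv.ext fun s => ?_) (funext fun s => ?_)
  · have h6 := h2 (glueHalf hm hT g (openAt_mem_halves hm hT s))
    rw [he, opp_glueHalf (hy := closeAt_mem_halves hT (g.partner s)) (Or.inl (Or.inr ⟨s, rfl, rfl⟩)),
      opp_glueHalf (hy := closeAt_mem_halves hT (g'.partner s)) (Or.inl (Or.inr ⟨s, rfl, rfl⟩)),
      he, glueHalf_inj] at h6
    exact closeAt_injective hT h6
  · have h6 := h5 (glueHalf hm hT g (openAt_mem_halves hm hT s))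
    rw [he, mult_glueHalf, mult_glueHalf, multOf_openAt g hT, multOf_openAt g' hT] at h6
    exact h6.symm

/-- The admissible map obtained by matching the leaves of a tree with rightmost root child. -/
noncomputable def toAdmissible (hm : 3 ≤ m) (i : ℕ)
    (x : Σ child, LeafClosure (node (lastPos hm) child).word i) : AdmissibleMaps m i :=
  Quotient.mk (admissibleSetoid m i) ⟨glue hm (by simp) x.2, isAdmissible_glue hm x.2,
    totalMult_glue.trans_lt x.2.sum_lt⟩

theorem blackVertices_toAdmissible (hm : 3 ≤ m) (i : ℕ)
    (x : Σ child, LeafClosure (node (lastPos hm) child).word i) :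
    (toAdmissible hm i x).blackVertices = (node (lastPos hm) x.1).size :=
  blackVertices_glue

/-- Injectivity is the uniqueness of the tree followed by `eq_of_iso_glue`; surjectivity is its
existence followed by `ExploresAll.exists_iso_glue`. -/
theorem toAdmissible_bijective (hm : 3 ≤ m) (i : ℕ) :
    Function.Bijective (toAdmissible hm i) := by
  constructor
  · rintro ⟨c, g⟩ ⟨c', g'⟩ h
    have h1 : Iso (glue hm _ g) (glue hm _ g') := Quotient.exact h
    obtain rfl := (h1.isTreeOf (isTreeOf_glue hm g)).unique (isTreeOf_glue hm g')
    rw [eq_of_iso_glue h1]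
  · intro M
    induction M using Quotient.inductionOn with
    | h M =>
      obtain ⟨M, hM, hi⟩ := M
      obtain ⟨child, hc⟩ := hM.exists_isTreeOf hm
      obtain ⟨g, hg⟩ := ExploresAll.exists_iso_glue hm (by simp) hc.explores hc.mult_black hi
      exact ⟨⟨child, g⟩, Quotient.sound hg⟩

end PairTree

theorem mainTheorem9 (m i : ℕ) (hm : 3 ≤ m) (hi : 1 ≤ i) :
    (∃ φ : RightEnrichedTree m i ≃ AdmissibleMaps m i,
      ∀ T, (φ T).blackVertices = T.blackNodes) ∧
    (∀ n, Finite {T : RightEnrichedTree m i // T.blackNodes = n}) ∧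
    (∀ n, Finite {M : AdmissibleMaps m i // M.blackVertices = n}) ∧
    RightEnrichedTree.series m i = QSystem.qSeries m i ∧
    AdmissibleMaps.series m i = QSystem.qSeries m i := by
  have hF : ∀ c, Finite (LeafClosure (PairTree.node (PairTree.lastPos hm) c).word i) ∧
      Nat.card (LeafClosure (PairTree.node (PairTree.lastPos hm) c).word i) =
        (PairTree.node (PairTree.lastPos hm) c).weight i :=
    fun c => card_leafClosure _ (PairTree.netHeight_word _) i
  have hfin : ∀ c, Finite (LeafClosure (PairTree.node (PairTree.lastPos hm) c).word i) := fun c => (hF c).1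
  obtain ⟨h1, h2⟩ := PairTree.finiteFibres_and_gf_eq_qSeries hm i _ fun c => (hF c).2
  -- Indexings and leaf closures of a tree are equinumerous, both being counted by its product of
  -- heights; any bijection between them serves.
  have e : ∀ c, Nonempty ((PairTree.node (PairTree.lastPos hm) c).toBlossom.Indexing i ≃
      LeafClosure (PairTree.node (PairTree.lastPos hm) c).word i) := fun c =>
    Finite.card_eq.1 ((PairTree.card_indexing _ i).trans (hF c).2.symm)
  let ψ := Equiv.sigmaCongrRight fun c => (e c).some
  let trees := Equiv.ofBijective _ (PairTree.enrichedTree_bijective hm i)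
  let maps := Equiv.ofBijective _ (PairTree.toAdmissible_bijective hm i)
  have hmaps : ∀ x, (maps x).blackVertices = (PairTree.node (PairTree.lastPos hm) x.1).size :=
    PairTree.blackVertices_toAdmissible hm i
  have htrees : ∀ x, (trees (ψ.symm x)).blackNodes =
      (PairTree.node (PairTree.lastPos hm) x.1).size := fun x =>
    PairTree.blackNodes_enrichedTree hm i (ψ.symm x)
  refine ⟨⟨trees.symm.trans (ψ.trans maps), fun T => ?_⟩, h1.congr (ψ.symm.trans trees) htrees,
    h1.congr maps hmaps, ?_, ?_⟩
  · obtain ⟨x, rfl⟩ := (ψ.symm.trans trees).surjective T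
    simp [hmaps, htrees]
  · rw [← h2]
    exact (gf_congr (ψ.symm.trans trees) htrees).symm
  · rw [← h2]
    exact (gf_congr maps hmaps).symm
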